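/- Let $A\to M$ be a Lie algebroid over a smooth manifold (Hausdorff, second countable, without boundary, $A$ of finite rank), with anchor $\rho$, and let $A[1]$ be the associated graded manifold: its algebra of functions is $C(A[1])=\Gamma(\wedge^\bullet A^*)$, its vector fields $\chi(A[1])$ are the graded derivations of $C(A[1])$, with the graded commutator as bracket, and $Q_A\in\chi_1(A[1])$ is the Lie algebroid differential, so that $\chi(A[1])$ has the differential $[Q_A,\cdot]$. Let $L=\mathfrak h[1]\oplus\mathfrak g$ be a finite-dimensional real strict Lie 2-algebra, that is, a differential graded Lie algebra $(L,[\cdot,\cdot],\delta)$ concentrated in degrees $-1$ (where it is $\mathfrak h[1]$) and $0$ (where it is $\mathfrak g$). Let $\mu\colon L\to\chi(A[1])$ be a morphism of graded Lie algebras. Choose bases $(v_i)$ of $\mathfrak g$ and $(w_\alpha)$ of $\mathfrak h[1]$; write $(e_j)$ for their union, $\eta^i$ (of degree $1$) and $P^\alpha$ (of degree $2$) for the dual coordinates on $L[1]$, and $\xi^j$ for all these coordinates. On $L[1]\times A[1]$, whose algebra of functions is $S(L[1]^*)\otimes C(A[1])$, consider the vector field $Q_A$ and $$Q_\delta=\sum_{i,k}\xi^iQ_i^k\,\partial_{\xi^k},\qquad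 Q_{br}=\tfrac12\sum_{i,j,k}\xi^j\xi^iQ_{ij}^k\,\partial_{\xi^k},\qquad Q_{action}=\sum_i\eta^i\mu(v_i)-\sum_\alpha P^\alpha\mu(w_\alpha),$$ where $\delta e_i=(-1)^{|e_i|}\sum_kQ_i^ke_k$ and $[e_i,e_j]=(-1)^{|e_j|}\sum_kQ_{ij}^ke_k$. The transformation algebroid $T_\mu$ of $\mu$ is the trivial bundle $L\times A[1]\to A[1]$, with sections $C(A[1])\otimes L$, anchor $f\otimes v\mapsto f\mu(v)$, and the bracket that extends the one of $L$ by the Leibniz rule. An algebroid structure on $L\times A[1]\to A[1]$ is encoded by a homological vector field $Q'$ on $L[1]\times A[1]$ which raises the polynomial degree on the fibers by one, through $\rho(a)f=[Q',\iota_a]f$ and $\iota_{[a,b]}=(-1)^{|a|}[[Q',\iota_a],\iota_b]$; here $\iota_a$ is the vertical vector field given by a section $a$, with $\iota_{e_j}=\partial_{\xi^j}$ and $\iota_{fa}=(-1)^{|f|}f\iota_a$ for a function $f$. The algebroid with a vector field $Q$ is a Q-algebroid if $Q$ is homological and linear on the fibers and, viewed as a vector field on $L[1]\times A[1]$, commutes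 with $Q'$. Then $T_\mu$ is an algebroid, the unique vector field encoding it is $Q_{br}+Q_{action}$, and the following are equivalent: 1. $\mu$ is a morphism of differential graded Lie algebras, i.e. $\mu(\delta x)=[Q_A,\mu(x)]$ for all $x\in L$; 2. $T_\mu$, endowed with the vector field $-Q_\delta+Q_A$, is a Q-algebroid; 3. $[-Q_\delta+Q_A,\;Q_{br}+Q_{action}]=0$ on $L[1]\times A[1]$. -/

import Mathlib

/-- Families of maps `f (v₁, …, v_k) : R`, one for every `k`, from `k`-tuples of elements of `E`;
a `k`-tuple is a list of length `k`. -/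
def Cochain (E R : Type*) : Type _ := List E → R

namespace Cochain

@[ext] theorem ext {E R : Type*} {f g : Cochain E R} (h : ∀ l, f l = g l) : f = g := funext h

variable {E R : Type*} [CommRing R]

instance : AddCommGroup (Cochain E R) := inferInstanceAs (AddCommGroup (List E → R))

instance {S : Type*} [CommSemiring S] [Algebra S R] : Module S (Cochain E R) :=
  inferInstanceAs (Module S (List E → R))

@[simp] theorem add_apply (f g : Cochain E R) (l : List E) : (f + g) l = f l + g l := rfl
@[simp] theorem neg_apply (f : Cochain E R) (l : List E) : (-f) l = -f l := rfl
@[simp] theorem zero_apply (l : List E) : (0 : Cochain E R) l = 0 := rfl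
@[simp] theorem smul_apply {S : Type*} [CommSemiring S] [Algebra S R] (s : S) (f : Cochain E R)
    (l : List E) : (s • f) l = s • f l := rfl

/-- The contraction `ι_v f = f (v, ⋯)`. -/
def contract {E R : Type*} (v : E) (f : Cochain E R) : Cochain E R := fun l => f (v :: l)

/-- The parity involution, `(-1)^k` on families concentrated in degree `k`. -/
def sgn (f : Cochain E R) : Cochain E R := fun l => (-1) ^ l.length * f l

@[simp] theorem contract_apply {E R : Type*} (v : E) (f : Cochain E R) (l : List E) :
    contract v f l = f (v :: l) := rfl

/-- The wedge product
`(f ∧ g) (v₁, …, v_n) = ∑ ± f (v_{i₁}, …, v_{i_p}) * g (v_{j₁}, …, v_{j_q})`,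
the sum being over all splittings of `v₁, …, v_n` in two complementary subfamilies
(with their orders) and the sign being the one of the shuffle
`(v_{i₁}, …, v_{i_p}, v_{j₁}, …, v_{j_q})`. The first argument `v₁` goes either to `f`, or to `g`
and then past the arguments of `f`:
`ι_v (f ∧ g) = ι_v f ∧ g + sgn f ∧ ι_v g`. -/
def wedge : List E → Cochain E R → Cochain E R → R
  | [], f, g => f [] * g []
  | v :: l, f, g => wedge l (contract v f) g + wedge l (sgn f) (contract v g)

instance : Mul (Cochain E R) := ⟨fun f g l => wedge l f g⟩

theorem mul_nil (f g : Cochain E R) : (f * g) [] = f [] * g [] := rfl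

theorem mul_cons (f g : Cochain E R) (v : E) (l : List E) :
    (f * g) (v :: l) = (contract v f * g) l + (sgn f * contract v g) l := rfl

theorem contract_mul (v : E) (f g : Cochain E R) :
    contract v (f * g) = contract v f * g + sgn f * contract v g := rfl

theorem contract_add (v : E) (f g : Cochain E R) :
    contract v (f + g) = contract v f + contract v g := rfl

theorem contract_smul {S : Type*} [CommSemiring S] [Algebra S R] (v : E) (s : S)
    (f : Cochain E R) : contract v (s • f) = s • contract v f := rfl

theorem sgn_add (f g : Cochain E R) : sgn (f + g) = sgn f + sgn g := by
  ext l; simp [sgn, mul_add]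

theorem sgn_neg (f : Cochain E R) : sgn (-f) = -sgn f := by
  ext l; simp [sgn]

theorem sgn_smul {S : Type*} [CommSemiring S] [Algebra S R] (s : S)
    (f : Cochain E R) : sgn (s • f) = s • sgn f := by
  ext l; simp [sgn]

theorem sgn_sgn (f : Cochain E R) : sgn (sgn f) = f := by
  ext l; simp [sgn, ← mul_assoc, ← mul_pow]

theorem contract_sgn (v : E) (f : Cochain E R) : contract v (sgn f) = -sgn (contract v f) := by
  ext l; simp [sgn, pow_succ]

theorem contract_zero (v : E) : contract v (0 : Cochain E R) = 0 := rfl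

theorem add_mul' (f g h : Cochain E R) : (f + g) * h = f * h + g * h := by
  ext l
  induction l generalizing f g h with
  | nil => simp [mul_nil, add_mul]
  | cons v l ih =>
    simp only [mul_cons, contract_add, sgn_add, add_apply] at ih ⊢
    rw [ih, ih]; ring

theorem mul_add' (f g h : Cochain E R) : f * (g + h) = f * g + f * h := by
  ext l
  induction l generalizing f g h with
  | nil => simp [mul_nil, mul_add]
  | cons v l ih =>
    simp only [mul_cons, contract_add, add_apply] at ih ⊢
    rw [ih, ih]; ring

theorem smul_mul' {S : Type*} [CommSemiring S] [Algebra S R] (s : S) (f g : Cochain E R) :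
    (s • f) * g = s • (f * g) := by
  ext l
  induction l generalizing f g with
  | nil => simp [mul_nil]
  | cons v l ih =>
    simp only [mul_cons, contract_smul, sgn_smul, smul_apply, smul_add] at ih ⊢
    rw [ih, ih]

theorem mul_smul' {S : Type*} [CommSemiring S] [Algebra S R] (s : S) (f g : Cochain E R) :
    f * (s • g) = s • (f * g) := by
  ext l
  induction l generalizing f g with
  | nil => simp [mul_nil]
  | cons v l ih =>
    simp only [mul_cons, contract_smul, smul_apply, smul_add] at ih ⊢
    rw [ih, ih]

theorem zero_mul' (f : Cochain E R) : 0 * f = 0 := by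
  have := add_mul' 0 0 f; simpa using this

theorem mul_zero' (f : Cochain E R) : f * 0 = 0 := by
  have := mul_add' f 0 0; simpa using this

theorem neg_mul' (f g : Cochain E R) : (-f) * g = -(f * g) := by
  have := add_mul' f (-f) g
  rw [add_neg_cancel, zero_mul'] at this
  exact (neg_eq_of_add_eq_zero_right this.symm).symm

theorem sgn_mul (f g : Cochain E R) : sgn (f * g) = sgn f * sgn g := by
  ext l
  induction l generalizing f g with
  | nil => simp [sgn, mul_nil]
  | cons v l ih =>
    have h1 := ih (contract v f) g
    have h2 := ih (sgn f) (contract v g)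
    simp only [sgn] at h1 h2 ⊢
    rw [mul_cons, mul_cons, List.length_cons, pow_succ]
    have e1 : contract v (sgn f) = -sgn (contract v f) := contract_sgn v f
    have e2 : contract v (sgn g) = (-1 : R) • sgn (contract v g) := by
      rw [contract_sgn]; ext; simp
    have e1' : contract v (sgn f) = (-1 : R) • sgn (contract v f) := by
      rw [contract_sgn]; ext; simp
    change _ = (contract v (sgn f) * sgn g) l + (sgn (sgn f) * contract v (sgn g)) l
    rw [e1', e2, smul_mul', mul_smul', smul_apply, smul_apply]
    have h1' : (-1) ^ l.length * (contract v f * g) l = (sgn (contract v f) * sgn g) l := h1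
    have h2' : (-1) ^ l.length * (sgn f * contract v g) l
      = (sgn (sgn f) * sgn (contract v g)) l := h2
    rw [← h1', ← h2']
    simp only [smul_eq_mul]; ring

theorem mul_assoc' (f g h : Cochain E R) : f * g * h = f * (g * h) := by
  ext l
  induction l generalizing f g h with
  | nil => simp [mul_nil, mul_assoc]
  | cons v l ih =>
    simp only [mul_cons, contract_mul, sgn_mul, add_mul', mul_add', add_apply, ih]; ring

/-- Constant families, concentrated in degree `0`. -/
def const (r : R) : Cochain E R
  | [] => r
  | _ :: _ => 0

theorem contract_const (v : E) (r : R) : contract v (const r) = 0 := rfl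

theorem sgn_const (r : R) : sgn (const r : Cochain E R) = const r := by
  ext l; cases l <;> simp [sgn, const]

theorem const_mul (r : R) (f : Cochain E R) : const r * f = r • f := by
  ext l
  induction l generalizing f with
  | nil => rfl
  | cons v l ih =>
    rw [mul_cons, contract_const, zero_mul', sgn_const, ih]; simp

theorem mul_const (r : R) (f : Cochain E R) : f * const r = r • f := by
  ext l
  induction l generalizing f with
  | nil => simp [mul_nil, const, mul_comm]
  | cons v l ih =>
    rw [mul_cons, contract_const, mul_zero', ih]; simp

instance : One (Cochain E R) := ⟨const 1⟩

theorem one_def : (1 : Cochain E R) = const 1 := rfl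

instance : Ring (Cochain E R) where
  __ := (inferInstance : AddCommGroup (Cochain E R))
  left_distrib := mul_add'
  right_distrib := add_mul'
  zero_mul := zero_mul'
  mul_zero := mul_zero'
  mul_assoc := mul_assoc'
  one_mul f := by rw [one_def, const_mul, one_smul]
  mul_one f := by rw [one_def, mul_const, one_smul]

instance {S : Type*} [CommSemiring S] [Algebra S R] : Algebra S (Cochain E R) :=
  Algebra.ofModule smul_mul' fun s f g => mul_smul' s f g


variable [AddCommGroup E] [Module R E]

/-- Families of alternating `R`-multilinear maps, finitely many of which are nonzero. -/
structure IsForm (f : Cochain E R) : Prop where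
  map_add : ∀ (l₁ l₂ : List E) (v w : E),
    f (l₁ ++ (v + w) :: l₂) = f (l₁ ++ v :: l₂) + f (l₁ ++ w :: l₂)
  map_smul : ∀ (l₁ l₂ : List E) (r : R) (v : E),
    f (l₁ ++ (r • v) :: l₂) = r * f (l₁ ++ v :: l₂)
  map_eq_zero : ∀ (l₁ l₂ l₃ : List E) (v : E), f (l₁ ++ v :: (l₂ ++ v :: l₃)) = 0
  bounded : ∃ N : ℕ, ∀ l : List E, N < l.length → f l = 0

/-- A multilinear family vanishing on equal adjacent arguments is alternating. -/
theorem IsForm.of_adjacent {f : Cochain E R}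
    (hadd : ∀ (l₁ l₂ : List E) (v w : E),
      f (l₁ ++ (v + w) :: l₂) = f (l₁ ++ v :: l₂) + f (l₁ ++ w :: l₂))
    (hsmul : ∀ (l₁ l₂ : List E) (r : R) (v : E),
      f (l₁ ++ (r • v) :: l₂) = r * f (l₁ ++ v :: l₂))
    (hadj : ∀ (l₁ l₂ : List E) (v : E), f (l₁ ++ v :: v :: l₂) = 0)
    (hbd : ∃ N : ℕ, ∀ l : List E, N < l.length → f l = 0) : IsForm f := by
  have swap : ∀ (l₁ l₂ : List E) (v w : E),
      f (l₁ ++ v :: w :: l₂) = -f (l₁ ++ w :: v :: l₂) := by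
    intro l₁ l₂ v w
    have h := hadj l₁ l₂ (v + w)
    have h1 := hadd (l₁ ++ [v]) l₂ v w
    have h2 := hadd (l₁ ++ [w]) l₂ v w
    simp only [List.append_assoc, List.singleton_append] at h1 h2
    rw [hadd, h1, h2, hadj, hadj] at h
    linear_combination h
  refine ⟨hadd, hsmul, ?_, hbd⟩
  intro l₁ l₂
  induction l₂ generalizing l₁ with
  | nil => intro l₃ v; exact hadj l₁ l₃ v
  | cons w l₂ ih =>
    intro l₃ v
    rw [List.cons_append, swap]
    have := ih (l₁ ++ [w]) l₃ v
    simp only [List.append_assoc, List.singleton_append] at this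
    rw [this, neg_zero]

theorem IsForm.contract {f : Cochain E R} (hf : IsForm f) (v : E) : IsForm (contract v f) where
  map_add l₁ := hf.map_add (v :: l₁)
  map_smul l₁ := hf.map_smul (v :: l₁)
  map_eq_zero l₁ := hf.map_eq_zero (v :: l₁)
  bounded := by
    obtain ⟨N, hN⟩ := hf.bounded
    exact ⟨N, fun l hl => hN _ (by simp; omega)⟩

theorem IsForm.sgn {f : Cochain E R} (hf : IsForm f) : IsForm (sgn f) where
  map_add l₁ l₂ v w := by simp [Cochain.sgn, hf.map_add, mul_add]
  map_smul l₁ l₂ r v := by simp [Cochain.sgn, hf.map_smul]; ring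
  map_eq_zero l₁ l₂ l₃ v := by simp [Cochain.sgn, hf.map_eq_zero]
  bounded := by
    obtain ⟨N, hN⟩ := hf.bounded
    exact ⟨N, fun l hl => by simp [Cochain.sgn, hN l hl]⟩

theorem IsForm.add {f g : Cochain E R} (hf : IsForm f) (hg : IsForm g) : IsForm (f + g) where
  map_add l₁ l₂ v w := by simp only [add_apply, hf.map_add, hg.map_add]; ring
  map_smul l₁ l₂ r v := by simp only [add_apply, hf.map_smul, hg.map_smul]; ring
  map_eq_zero l₁ l₂ l₃ v := by simp [hf.map_eq_zero, hg.map_eq_zero]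
  bounded := by
    obtain ⟨N, hN⟩ := hf.bounded
    obtain ⟨N', hN'⟩ := hg.bounded
    exact ⟨N + N', fun l hl => by simp [hN l (by omega), hN' l (by omega)]⟩

theorem IsForm.smul {f : Cochain E R} (hf : IsForm f) (s : R) : IsForm (s • f) where
  map_add l₁ l₂ v w := by simp only [smul_apply, hf.map_add, smul_eq_mul]; ring
  map_smul l₁ l₂ r v := by simp only [smul_apply, hf.map_smul, smul_eq_mul]; ring
  map_eq_zero l₁ l₂ l₃ v := by simp [hf.map_eq_zero]
  bounded := by
    obtain ⟨N, hN⟩ := hf.bounded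
    exact ⟨N, fun l hl => by simp [hN l (by omega)]⟩

theorem contract_form_add {f : Cochain E R} (hf : IsForm f) (v w : E) :
    Cochain.contract (v + w) f = Cochain.contract v f + Cochain.contract w f := by
  ext l; exact hf.map_add [] l v w

theorem contract_form_smul {f : Cochain E R} (hf : IsForm f) (r : R) (v : E) :
    Cochain.contract (r • v) f = r • Cochain.contract v f := by
  ext l; exact hf.map_smul [] l r v

theorem contract_form_self {f : Cochain E R} (hf : IsForm f) (v : E) :
    Cochain.contract v (Cochain.contract v f) = 0 := by
  ext l; exact hf.map_eq_zero [] [] l v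

theorem contract_form_swap {f : Cochain E R} (hf : IsForm f) (v w : E) :
    Cochain.contract v (Cochain.contract w f) = -Cochain.contract w (Cochain.contract v f) := by
  have h := contract_form_self hf (v + w)
  rw [contract_form_add hf, contract_add, contract_form_add (hf.contract v),
    contract_form_add (hf.contract w), contract_form_self hf, contract_form_self hf] at h
  rw [zero_add, add_zero, add_comm] at h
  exact eq_neg_of_add_eq_zero_left h

theorem IsForm.mul {f g : Cochain E R} (hf : IsForm f) (hg : IsForm g) : IsForm (f * g) := by
  apply IsForm.of_adjacent
  · intro l₁
    induction l₁ generalizing f g with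
    | nil =>
      intro l₂ v w
      simp only [List.nil_append, mul_cons, contract_form_add hf, contract_form_add hg, add_mul',
        mul_add', add_apply]
      ring
    | cons u l₁ ih =>
      intro l₂ v w
      simp only [List.cons_append, mul_cons]
      rw [ih (hf.contract u) hg, ih hf.sgn (hg.contract u)]
      ring
  · intro l₁
    induction l₁ generalizing f g with
    | nil =>
      intro l₂ r v
      simp only [List.nil_append, mul_cons, contract_form_smul hf, contract_form_smul hg, smul_mul',
        mul_smul', smul_apply, smul_eq_mul]
      ring
    | cons u l₁ ih =>
      intro l₂ r v
      simp only [List.cons_append, mul_cons]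
      rw [ih (hf.contract u) hg, ih hf.sgn (hg.contract u)]
      ring
  · intro l₁
    induction l₁ generalizing f g with
    | nil =>
      intro l₂ v
      simp only [List.nil_append, mul_cons]
      rw [contract_form_self hf, contract_form_self hg, contract_sgn]
      simp
    | cons u l₁ ih =>
      intro l₂ v
      simp only [List.cons_append, mul_cons]
      rw [ih (hf.contract u) hg, ih hf.sgn (hg.contract u), add_zero]
  · obtain ⟨N, hN⟩ := hf.bounded
    obtain ⟨N', hN'⟩ := hg.bounded
    refine ⟨N + N', fun l => ?_⟩
    clear hf hg
    induction l generalizing f g N N' with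
    | nil => simp
    | cons v l ih =>
      intro hl
      rw [List.length_cons] at hl
      have hs : ∀ l : List E, N < l.length → Cochain.sgn f l = 0 := fun l hl => by
        simp [Cochain.sgn, hN l hl]
      rw [mul_cons]
      have h1 : (Cochain.contract v f * g) l = 0 := by
        rcases N with _ | N
        · have : Cochain.contract v f = 0 := by ext m; exact hN _ (by simp)
          rw [this, zero_mul']; rfl
        · exact ih N (fun m hm => hN _ (by simp; omega)) N' hN' (by omega)
      have h2 : (Cochain.sgn f * Cochain.contract v g) l = 0 := by
        rcases N' with _ | N'
        · have : Cochain.contract v g = 0 := by ext m; exact hN' _ (by simp)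
          rw [this, mul_zero']; rfl
        · exact ih N hs N' (fun m hm => hN' _ (by simp; omega)) (by omega)
      rw [h1, h2, add_zero]

theorem IsForm.const (r : R) : IsForm (const r : Cochain E R) where
  map_add l₁ l₂ v w := by cases l₁ <;> simp [Cochain.const]
  map_smul l₁ l₂ r v := by cases l₁ <;> simp [Cochain.const]
  map_eq_zero l₁ l₂ l₃ v := by cases l₁ <;> rfl
  bounded := ⟨0, fun l hl => by cases l <;> simp [Cochain.const] at hl ⊢⟩

end Cochain

section Forms

variable (E R : Type*) [CommRing R] [Algebra ℝ R] [AddCommGroup E] [Module R E]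

/-- The algebra `⨁ₖ Altᵏ_R(E, R)` of alternating forms, with the wedge product. -/
def formAlgebra : Subalgebra ℝ (Cochain E R) where
  carrier := {f | f.IsForm}
  mul_mem' := Cochain.IsForm.mul
  add_mem' := Cochain.IsForm.add
  algebraMap_mem' r := by
    have : (algebraMap ℝ (Cochain E R)) r = Cochain.const (algebraMap ℝ R r) := by
      rw [Algebra.algebraMap_eq_smul_one, Cochain.one_def]
      ext l
      cases l <;> simp [Cochain.const, Algebra.smul_def]
    rw [this]
    exact Cochain.IsForm.const _

/-- The forms of degree `k`. -/
def formDegree (k : ℕ) : Submodule ℝ (formAlgebra E R) where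
  carrier := {f | ∀ l : List E, l.length ≠ k → f.1 l = 0}
  add_mem' {f g} hf hg l hl := by
    have : (f + g).1 l = f.1 l + g.1 l := rfl
    rw [this, hf l hl, hg l hl, add_zero]
  zero_mem' _ _ := rfl
  smul_mem' c f hf l hl := by
    have : (c • f).1 l = c • f.1 l := rfl
    rw [this, hf l hl, smul_zero]

variable {E R}

/-- The component of degree `k` of a form. -/
def formComponent (k : ℕ) (f : formAlgebra E R) : formDegree E R k :=
  ⟨⟨fun l => if l.length = k then f.1 l else 0, by
    refine ⟨fun l₁ l₂ v w => ?_, fun l₁ l₂ r v => ?_, fun l₁ l₂ l₃ v => ?_, ?_⟩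
    · have := f.2.map_add l₁ l₂ v w
      simp only [List.length_append, List.length_cons] at this ⊢
      split_ifs <;> simp [this]
    · have := f.2.map_smul l₁ l₂ r v
      simp only [List.length_append, List.length_cons] at this ⊢
      split_ifs <;> simp [this]
    · have := f.2.map_eq_zero l₁ l₂ l₃ v
      split_ifs <;> simp [this]
    · exact ⟨k, fun l hl => if_neg (by omega)⟩⟩,
  fun l hl => if_neg hl⟩

theorem formDegree_isInternal : DirectSum.IsInternal (formDegree E R) := by
  classical
  constructor
  · rw [injective_iff_map_eq_zero]
    intro x hx
    ext k l
    have h1 : ∀ x : DirectSum ℕ fun k => formDegree E R k,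
        ((DirectSum.coeAddMonoidHom (formDegree E R)) x).1 l
          = ((x l.length : formDegree E R l.length) : formAlgebra E R).1 l := by
      intro x
      induction x using DirectSum.induction_on with
      | zero => rfl
      | of i y =>
        rw [DirectSum.coeAddMonoidHom_of]
        by_cases h : l.length = i
        · subst h; rw [DirectSum.of_eq_same]
        · rw [DirectSum.of_eq_of_ne _ _ _ h]; exact y.2 l h
      | add x y hx hy =>
        rw [map_add]
        have e : ∀ a b : formAlgebra E R, (a + b).1 l = a.1 l + b.1 l := fun _ _ => rfl
        rw [e, hx, hy, DirectSum.add_apply]; rfl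
    have h2 := h1 x
    rw [hx] at h2
    by_cases h : l.length = k
    · subst h; exact h2.symm
    · exact (x k).2 l h
  · intro f
    obtain ⟨N, hN⟩ := f.2.bounded
    refine ⟨∑ k ∈ Finset.range (N + 1), DirectSum.of (fun k => formDegree E R k) k
      (formComponent k f), ?_⟩
    rw [map_sum]
    simp only [DirectSum.coeAddMonoidHom_of]
    apply Subtype.ext
    rw [AddSubmonoidClass.coe_finsetSum]
    ext l
    have h1 : ∀ (s : Finset ℕ) (F : ℕ → Cochain E R), (∑ k ∈ s, F k) l = ∑ k ∈ s, F k l :=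
      fun s F => Finset.sum_apply l s F
    rw [h1]
    have h2 : ∀ k, (formComponent k f).1.1 l = if l.length = k then f.1 l else 0 := fun _ => rfl
    simp only [h2, Finset.sum_ite_eq, Finset.mem_range]
    split_ifs with h
    · rfl
    · exact (hN l (by omega)).symm

noncomputable instance formGradedAlgebra : GradedAlgebra (formDegree E R) where
  toGradedMonoid := 
    { one_mem := fun l hl => by
        cases l with
        | nil => simp at hl
        | cons v l => rfl
      mul_mem := fun i j f g hf hg l => by
        obtain ⟨f, hff⟩ := f
        obtain ⟨g, hgg⟩ := g
        replace hf : ∀ l : List E, l.length ≠ i → f l = 0 := hf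
        replace hg : ∀ l : List E, l.length ≠ j → g l = 0 := hg
        change l.length ≠ i + j → (f * g) l = 0
        clear * - hf hg
        induction l generalizing i j f g with
        | nil =>
          intro h
          rw [Cochain.mul_nil]
          by_cases hi : i = 0
          · rw [hg [] (by simp at h ⊢; omega), mul_zero]
          · rw [hf [] (by simp; omega), zero_mul]
        | cons v l ih =>
          intro h
          rw [List.length_cons] at h
          rw [Cochain.mul_cons]
          have h1 : (Cochain.contract v f * g) l = 0 := by
            rcases i with _ | i
            · have : Cochain.contract v f = 0 := by ext m; exact hf _ (by simp)
              rw [this, zero_mul]; rfl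
            · exact ih i j _ _ (fun m hm => hf _ (by simp; omega)) hg (by omega)
          have h2 : (Cochain.sgn f * Cochain.contract v g) l = 0 := by
            rcases j with _ | j
            · have : Cochain.contract v g = 0 := by ext m; exact hg _ (by simp)
              rw [this, mul_zero]; rfl
            · exact ih i j _ _ (fun m hm => by simp [Cochain.sgn, hf m hm])
                (fun m hm => hg _ (by simp; omega)) (by omega)
          rw [h1, h2, add_zero] }
  toDecomposition := formDegree_isInternal.chooseDecomposition

end Forms

/-- The structure on a module `E` over a ring of functions `R` by which the sections of a Lie
algebroid define a differential on forms: an anchor and a skew bracket with the Leibniz rule. -/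
structure AnchoredBracket (R E : Type*) [CommRing R] [Algebra ℝ R] [AddCommGroup E]
    [Module R E] where
  anchor : E →ₗ[R] Derivation ℝ R R
  bracket : E → E → E
  bracket_add : ∀ u v w, bracket u (v + w) = bracket u v + bracket u w
  bracket_self : ∀ v, bracket v v = 0
  bracket_skew : ∀ v w, bracket v w = -bracket w v
  leibniz : ∀ v w (r : R), bracket v (r • w) = r • bracket v w + anchor v r • w

namespace AnchoredBracket

variable {R E : Type*} [CommRing R] [Algebra ℝ R] [AddCommGroup E] [Module R E]
  (P : AnchoredBracket R E)

theorem add_bracket (u v w : E) : P.bracket (u + v) w = P.bracket u w + P.bracket v w := by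
  rw [P.bracket_skew, P.bracket_add, P.bracket_skew u, P.bracket_skew v]; abel

theorem smul_bracket (r : R) (v w : E) :
    P.bracket (r • v) w = r • P.bracket v w - P.anchor w r • v := by
  rw [P.bracket_skew, P.leibniz, P.bracket_skew v w, smul_neg]; abel

/-- `∑ᵢ f (v₁, …, [v, vᵢ], …, v_k)`. -/
def sumBracket (v : E) : List E → Cochain E R → R
  | [], _ => 0
  | w :: l, f => f (P.bracket v w :: l) + sumBracket v l (f.contract w)

/-- The Lie derivative
`(L_v f) (v₁, …, v_k) = ρ(v) (f (v₁, …, v_k)) - ∑ᵢ f (v₁, …, [v, vᵢ], …, v_k)`. -/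
def lieDeriv (v : E) (f : Cochain E R) : Cochain E R :=
  fun l => P.anchor v (f l) - P.sumBracket v l f

/-- The Lie algebroid differential
`(d f) (v₀, …, v_k) = ∑ᵢ (-1)ⁱ ρ(vᵢ) (f (v₀, …, v̂ᵢ, …, v_k))
  + ∑_{i < j} (-1)^{i + j} f ([vᵢ, vⱼ], v₀, …, v̂ᵢ, …, v̂ⱼ, …, v_k)`,
written recursively by splitting off the terms with `i = 0`:
`(d f) (v, v₁, …, v_k) = (L_v f) (v₁, …, v_k) - (d (ι_v f)) (v₁, …, v_k)`. -/
def differential : List E → Cochain E R → R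
  | [], _ => 0
  | v :: l, f => P.lieDeriv v f l - differential l (f.contract v)

/-- The differential as an operation on families of maps. -/
def d (f : Cochain E R) : Cochain E R := fun l => P.differential l f

theorem d_cons (v : E) (l : List E) (f : Cochain E R) :
    P.d f (v :: l) = P.lieDeriv v f l - P.d (f.contract v) l := rfl

theorem lieDeriv_cons (v w : E) (l : List E) (f : Cochain E R) :
    P.lieDeriv v f (w :: l) = P.lieDeriv v (f.contract w) l - f (P.bracket v w :: l) := by
  simp only [lieDeriv, sumBracket, Cochain.contract_apply]; ring

theorem sumBracket_add (v : E) (f g : Cochain E R) (l : List E) :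
    P.sumBracket v l (f + g) = P.sumBracket v l f + P.sumBracket v l g := by
  induction l generalizing f g with
  | nil => simp [sumBracket]
  | cons w l ih => simp only [sumBracket, Cochain.contract_add, ih, Cochain.add_apply]; ring

theorem sumBracket_smul (v : E) (r : R) (f : Cochain E R) (l : List E) :
    P.sumBracket v l (r • f) = r * P.sumBracket v l f := by
  induction l generalizing f with
  | nil => simp [sumBracket]
  | cons w l ih =>
    simp only [sumBracket, Cochain.contract_smul, ih, Cochain.smul_apply, smul_eq_mul]; ring

theorem sumBracket_real_smul (v : E) (r : ℝ) (f : Cochain E R) (l : List E) :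
    P.sumBracket v l (r • f) = r • P.sumBracket v l f := by
  induction l generalizing f with
  | nil => simp [sumBracket]
  | cons w l ih => simp only [sumBracket, Cochain.contract_smul, ih, Cochain.smul_apply, smul_add]

theorem lieDeriv_add (v : E) (f g : Cochain E R) :
    P.lieDeriv v (f + g) = P.lieDeriv v f + P.lieDeriv v g := by
  ext l; simp only [lieDeriv, sumBracket_add, Cochain.add_apply, map_add]; ring

theorem lieDeriv_real_smul (v : E) (r : ℝ) (f : Cochain E R) :
    P.lieDeriv v (r • f) = r • P.lieDeriv v f := by
  ext l; simp only [lieDeriv, sumBracket_real_smul, Cochain.smul_apply, Derivation.map_smul,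
    smul_sub]

theorem lieDeriv_smul (v : E) (r : R) (f : Cochain E R) :
    P.lieDeriv v (r • f) = r • P.lieDeriv v f + P.anchor v r • f := by
  ext l
  simp only [lieDeriv, sumBracket_smul, Cochain.smul_apply, Cochain.add_apply, smul_eq_mul,
    Derivation.leibniz]
  ring

theorem d_add (f g : Cochain E R) : P.d (f + g) = P.d f + P.d g := by
  ext l
  induction l generalizing f g with
  | nil => simp [d, differential]
  | cons v l ih =>
    simp only [d_cons, lieDeriv_add, Cochain.contract_add, ih, Cochain.add_apply]; ring

theorem d_real_smul (r : ℝ) (f : Cochain E R) : P.d (r • f) = r • P.d f := by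
  ext l
  induction l generalizing f with
  | nil => simp [d, differential]
  | cons v l ih =>
    simp only [d_cons, lieDeriv_real_smul, Cochain.contract_smul, ih, Cochain.smul_apply, smul_sub]

/-- The family `v ↦ ρ(v) r`, concentrated in degree `1`. -/
def dScalar (r : R) : Cochain E R
  | [v] => P.anchor v r
  | _ => 0

theorem contract_dScalar (v : E) (r : R) :
    (P.dScalar r).contract v = Cochain.const (P.anchor v r) := by
  ext l; cases l <;> rfl

theorem sgn_dScalar (r : R) : (P.dScalar r).sgn = -P.dScalar r := by
  ext l
  rcases l with _ | ⟨v, _ | ⟨w, l⟩⟩ <;> simp [Cochain.sgn, dScalar]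

theorem d_smul (r : R) (f : Cochain E R) : P.d (r • f) = r • P.d f + P.dScalar r * f := by
  ext l
  induction l generalizing f with
  | nil => simp [d, differential, Cochain.mul_nil, dScalar]
  | cons v l ih =>
    rw [d_cons, lieDeriv_smul, Cochain.contract_smul, ih, Cochain.add_apply, Cochain.add_apply,
      Cochain.add_apply, Cochain.mul_cons, contract_dScalar, sgn_dScalar, Cochain.const_mul,
      Cochain.neg_mul']
    simp only [Cochain.smul_apply, smul_eq_mul, d_cons, Cochain.neg_apply]
    ring

theorem d_zero : P.d (0 : Cochain E R) = 0 := by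
  simpa using P.d_real_smul 0 0

theorem sumBracket_eq_zero (v : E) {f : Cochain E R} {N : ℕ}
    (hN : ∀ l : List E, N < l.length → f l = 0) :
    ∀ l : List E, N < l.length → P.sumBracket v l f = 0 := by
  intro l
  induction l generalizing N f with
  | nil => intro _; rfl
  | cons w l ih =>
    intro hl
    have h1 : f (P.bracket v w :: l) = 0 := hN _ (by simpa using hl)
    rw [sumBracket, h1, zero_add]
    rcases N with _ | N
    · have h2 : f.contract w = 0 := by ext m; exact hN _ (by simp)
      rw [h2]
      simpa using P.sumBracket_real_smul v 0 0 l
    · exact ih (N := N) (fun m hm => hN _ (by simp; omega)) (by simp at hl; omega)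

theorem lieDeriv_eq_zero (v : E) {f : Cochain E R} {N : ℕ}
    (hN : ∀ l : List E, N < l.length → f l = 0) (l : List E) (hl : N < l.length) :
    P.lieDeriv v f l = 0 := by
  simp [lieDeriv, hN l hl, P.sumBracket_eq_zero v hN l hl]

theorem isForm_lieDeriv {f : Cochain E R} (hf : f.IsForm) (v : E) : (P.lieDeriv v f).IsForm := by
  apply Cochain.IsForm.of_adjacent
  · intro l₁
    induction l₁ generalizing f with
    | nil =>
      intro l₂ u w
      have h1 := hf.map_add [] l₂ (P.bracket v u) (P.bracket v w)
      simp only [List.nil_append] at h1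
      simp only [List.nil_append, lieDeriv_cons, Cochain.contract_form_add hf, lieDeriv_add,
        Cochain.add_apply, P.bracket_add, h1]
      ring
    | cons u l₁ ih =>
      intro l₂ w z
      simp only [List.cons_append, lieDeriv_cons]
      rw [ih (hf.contract u), ← List.cons_append, hf.map_add]
      simp only [List.cons_append]
      ring
  · intro l₁
    induction l₁ generalizing f with
    | nil =>
      intro l₂ r w
      have h1 := hf.map_add [] l₂ (r • P.bracket v w) (P.anchor v r • w)
      have h2 := hf.map_smul [] l₂ r (P.bracket v w)
      have h3 := hf.map_smul [] l₂ (P.anchor v r) w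
      simp only [List.nil_append] at h1 h2 h3
      simp only [List.nil_append, lieDeriv_cons, Cochain.contract_form_smul hf, lieDeriv_smul,
        Cochain.add_apply, P.leibniz, h1, h2, h3, Cochain.smul_apply, smul_eq_mul,
        Cochain.contract_apply]
      ring
    | cons u l₁ ih =>
      intro l₂ r w
      simp only [List.cons_append, lieDeriv_cons]
      rw [ih (hf.contract u), ← List.cons_append, hf.map_smul]
      simp only [List.cons_append]
      ring
  · intro l₁
    induction l₁ generalizing f with
    | nil =>
      intro l₂ w
      have h1 := congrFun (Cochain.contract_form_swap hf w (P.bracket v w)) l₂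
      have h2 : P.lieDeriv v (0 : Cochain E R) = 0 := by
        have := P.lieDeriv_real_smul v 0 0
        simpa using this
      simp only [List.nil_append, lieDeriv_cons]
      rw [Cochain.contract_form_self hf, h2]
      change (0 : R) - f (w :: P.bracket v w :: l₂) - f (P.bracket v w :: w :: l₂) = 0
      have h1 : f (P.bracket v w :: w :: l₂) = -f (w :: P.bracket v w :: l₂) := h1
      rw [h1]; ring
    | cons u l₁ ih =>
      intro l₂ w
      simp only [List.cons_append, lieDeriv_cons]
      have h1 := hf.map_eq_zero (P.bracket v u :: l₁) [] l₂ w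
      simp only [List.cons_append, List.nil_append] at h1
      rw [ih (hf.contract u), h1, sub_zero]
  · obtain ⟨N, hN⟩ := hf.bounded
    exact ⟨N, P.lieDeriv_eq_zero v hN⟩

theorem lieDeriv_smul_left {f : Cochain E R} (hf : f.IsForm) (r : R) (v : E) :
    P.lieDeriv (r • v) f = r • P.lieDeriv v f + P.dScalar r * f.contract v := by
  ext l
  induction l generalizing f with
  | nil => simp [lieDeriv, sumBracket, Cochain.mul_nil, dScalar]
  | cons w l ih =>
    have h1 := hf.map_add [] l (r • P.bracket v w) (-(P.anchor w r • v))
    have h2 := hf.map_smul [] l r (P.bracket v w)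
    have h3 := hf.map_smul [] l (-P.anchor w r) v
    simp only [List.nil_append] at h1 h2 h3
    rw [neg_smul] at h3
    have h4 : P.dScalar r * (f.contract v).contract w
        = -(P.dScalar r * (f.contract w).contract v) := by
      have := Cochain.mul_smul' (-1 : R) (P.dScalar r) ((f.contract w).contract v)
      rw [Cochain.contract_form_swap hf w v]
      simpa using this
    rw [lieDeriv_cons, ih (hf.contract w), smul_bracket, sub_eq_add_neg (r • _), h1, h2, h3,
      Cochain.add_apply, Cochain.add_apply, Cochain.mul_cons, contract_dScalar, sgn_dScalar,
      Cochain.const_mul, Cochain.neg_mul', h4]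
    simp only [Cochain.smul_apply, smul_eq_mul, lieDeriv_cons, Cochain.contract_apply,
      Cochain.neg_apply]
    ring

theorem lieDeriv_add_left {f : Cochain E R} (hf : f.IsForm) (u v : E) :
    P.lieDeriv (u + v) f = P.lieDeriv u f + P.lieDeriv v f := by
  ext l
  induction l generalizing f with
  | nil => simp [lieDeriv, sumBracket]
  | cons w l ih =>
    have h1 := hf.map_add [] l (P.bracket u w) (P.bracket v w)
    simp only [List.nil_append] at h1
    rw [lieDeriv_cons, ih (hf.contract w), add_bracket, h1]
    simp only [lieDeriv_cons, Cochain.add_apply]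
    ring

theorem isForm_d {f : Cochain E R} (hf : f.IsForm) : (P.d f).IsForm := by
  apply Cochain.IsForm.of_adjacent
  · intro l₁
    induction l₁ generalizing f with
    | nil =>
      intro l₂ u w
      simp only [List.nil_append, d_cons, Cochain.contract_form_add hf, d_add,
        Cochain.add_apply, P.lieDeriv_add_left hf]
      ring
    | cons u l₁ ih =>
      intro l₂ w z
      simp only [List.cons_append, d_cons]
      rw [ih (hf.contract u), (P.isForm_lieDeriv hf u).map_add]
      ring
  · intro l₁
    induction l₁ generalizing f with
    | nil =>
      intro l₂ r w
      simp only [List.nil_append, d_cons, Cochain.contract_form_smul hf, d_smul,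
        Cochain.add_apply, P.lieDeriv_smul_left hf, Cochain.smul_apply, smul_eq_mul]
      ring
    | cons u l₁ ih =>
      intro l₂ r w
      simp only [List.cons_append, d_cons]
      rw [ih (hf.contract u), (P.isForm_lieDeriv hf u).map_smul]
      ring
  · intro l₁
    induction l₁ generalizing f with
    | nil =>
      intro l₂ w
      simp only [List.nil_append, d_cons, lieDeriv_cons, P.bracket_self]
      rw [Cochain.contract_form_self hf, P.d_zero]
      have h := hf.map_smul [] l₂ 0 0
      simp only [List.nil_append, zero_smul, zero_mul] at h
      rw [h, Cochain.zero_apply]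
      ring
    | cons u l₁ ih =>
      intro l₂ w
      simp only [List.cons_append, d_cons]
      have h1 := (P.isForm_lieDeriv hf u).map_eq_zero l₁ [] l₂ w
      simp only [List.nil_append] at h1
      rw [ih (hf.contract u), h1, sub_zero]
  · obtain ⟨N, hN⟩ := hf.bounded
    refine ⟨N + 1, fun l => ?_⟩
    induction l generalizing f N with
    | nil => simp
    | cons v l ih =>
      intro hl
      rw [List.length_cons] at hl
      have h1 : P.d (f.contract v) l = 0 := by
        rcases N with _ | N
        · have h2 : f.contract v = 0 := by ext m; exact hN _ (by simp)
          rw [h2, P.d_zero]; rfl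
        · exact ih (hf.contract v) N (fun m hm => hN _ (by simp; omega)) (by omega)
      rw [d_cons, P.lieDeriv_eq_zero v hN l (by omega), h1, sub_zero]

/-- The differential as an endomorphism of the algebra of forms. -/
def formDifferential : Module.End ℝ (formAlgebra E R) where
  toFun f := ⟨P.d f.1, P.isForm_d f.2⟩
  map_add' f g := Subtype.ext (P.d_add f.1 g.1)
  map_smul' r f := Subtype.ext (P.d_real_smul r f.1)

end AnchoredBracket

section Geometry

open scoped Manifold ContDiff Bundle

variable {n : ℕ} {M : Type*} [TopologicalSpace M] [ChartedSpace (EuclideanSpace ℝ (Fin n)) M]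
  {F : Type*} [NormedAddCommGroup F] [NormedSpace ℝ F]
  {A : M → Type*} [TopologicalSpace (Bundle.TotalSpace F A)] [∀ x, TopologicalSpace (A x)]
  [∀ x, AddCommGroup (A x)] [∀ x, Module ℝ (A x)] [FiberBundle F A] [VectorBundle ℝ F A]

/-- The module structure of `Γ(A)` over `C^∞(M)`. -/
noncomputable instance sectionModule :
    Module C^∞⟮𝓡 n, M; 𝓘(ℝ, ℝ), ℝ⟯ Cₛ^∞⟮𝓡 n; F, A⟯ where
  smul f s := ⟨fun x => f x • s x, f.contMDiff.smul_section s.contMDiff⟩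
  one_smul s := ContMDiffSection.ext fun x => one_smul ℝ (s x)
  mul_smul f g s := ContMDiffSection.ext fun x => mul_smul (f x) (g x) (s x)
  smul_zero f := ContMDiffSection.ext fun x => smul_zero (f x)
  smul_add f s t := ContMDiffSection.ext fun x => smul_add (f x) (s x) (t x)
  add_smul f g s := ContMDiffSection.ext fun x => add_smul (f x) (g x) (s x)
  zero_smul s := ContMDiffSection.ext fun x => zero_smul ℝ (s x)

variable (n F A) in
/-- A Lie algebroid structure on the smooth vector bundle `A → M`: a smooth bundle map
`ρ : A → TM` (the anchor) and a Lie bracket on `Γ(A)` with the Leibniz rule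
`[X, f Y] = f [X, Y] + ρ(X)(f) Y`. -/
structure LieAlgebroid [IsManifold (𝓡 n) ∞ M] [ContMDiffVectorBundle ∞ F A (𝓡 n)] where
  anchor : ∀ x : M, A x →ₗ[ℝ] TangentSpace (𝓡 n) x
  contMDiff_anchor : ContMDiff ((𝓡 n).prod 𝓘(ℝ, F)) (𝓡 n).tangent ∞
    (fun p : Bundle.TotalSpace F A => (⟨p.1, anchor p.1 p.2⟩ : TangentBundle (𝓡 n) M))
  bracket : Cₛ^∞⟮𝓡 n; F, A⟯ →ₗ[ℝ] Cₛ^∞⟮𝓡 n; F, A⟯ →ₗ[ℝ] Cₛ^∞⟮𝓡 n; F, A⟯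
  bracket_self : ∀ X, bracket X X = 0
  jacobi : ∀ X Y Z, bracket X (bracket Y Z) = bracket (bracket X Y) Z + bracket Y (bracket X Z)
  leibniz : ∀ (X Y : Cₛ^∞⟮𝓡 n; F, A⟯) (f : C^∞⟮𝓡 n, M; 𝓘(ℝ, ℝ), ℝ⟯) (x : M),
    bracket X (f • Y) x
      = f x • bracket X Y x + mvfderiv (𝓡 n) f x (anchor x (X x)) • Y x

namespace LieAlgebroid

variable [IsManifold (𝓡 n) ∞ M] [ContMDiffVectorBundle ∞ F A (𝓡 n)] (𝔸 : LieAlgebroid n F A)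

theorem contMDiff_anchor_apply (X : Cₛ^∞⟮𝓡 n; F, A⟯) (f : C^∞⟮𝓡 n, M; 𝓘(ℝ, ℝ), ℝ⟯) :
    ContMDiff (𝓡 n) 𝓘(ℝ, ℝ) ∞ fun x => mvfderiv (𝓡 n) f x (𝔸.anchor x (X x)) := by
  have h1 := 𝔸.contMDiff_anchor.comp X.contMDiff
  have h2 := (f.contMDiff.contMDiff_tangentMap (m := ∞) (by simp)).comp h1
  exact (contMDiff_snd_tangentBundle_modelSpace ℝ 𝓘(ℝ, ℝ)).comp h2

/-- The derivation `f ↦ ρ(X)(f)` of `C^∞(M)`. -/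
noncomputable def anchorDerivation :
    Cₛ^∞⟮𝓡 n; F, A⟯ →ₗ[C^∞⟮𝓡 n, M; 𝓘(ℝ, ℝ), ℝ⟯]
      Derivation ℝ C^∞⟮𝓡 n, M; 𝓘(ℝ, ℝ), ℝ⟯ C^∞⟮𝓡 n, M; 𝓘(ℝ, ℝ), ℝ⟯ where
  toFun X := Derivation.mk'
    { toFun := fun f => ⟨_, 𝔸.contMDiff_anchor_apply X f⟩
      map_add' := fun f g => by
        ext x
        have hf := f.contMDiff.mdifferentiable (by simp) x
        have hg := g.contMDiff.mdifferentiable (by simp) x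
        have h := mvfderiv_add hf hg
        exact DFunLike.congr_fun h _
      map_smul' := fun c f => by
        ext x
        have hf := f.contMDiff.mdifferentiable (by simp) x
        have h := mvfderiv_smul (mdifferentiableAt_const (c := c)) hf
        have h' := DFunLike.congr_fun h (𝔸.anchor x (X x))
        simp only [mvfderiv_const, ContinuousLinearMap.zero_smulRight, add_zero] at h'
        exact h' }
    fun f g => by
      ext x
      have hf := f.contMDiff.mdifferentiable (by simp) x
      have hg := g.contMDiff.mdifferentiable (by simp) x
      have h := mvfderiv_mul hf hg
      exact DFunLike.congr_fun h _
  map_add' X Y := by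
    ext f x
    change mvfderiv (𝓡 n) f x (𝔸.anchor x (X x + Y x)) = _
    rw [map_add, map_add]
    rfl
  map_smul' f X := by
    ext g x
    change mvfderiv (𝓡 n) g x (𝔸.anchor x (f x • X x)) = _
    rw [map_smul, map_smul]
    rfl

/-- The anchor and the bracket on `Γ(A)`, algebraically. -/
noncomputable def anchoredBracket :
    AnchoredBracket C^∞⟮𝓡 n, M; 𝓘(ℝ, ℝ), ℝ⟯ Cₛ^∞⟮𝓡 n; F, A⟯ where
  anchor := 𝔸.anchorDerivation
  bracket X Y := 𝔸.bracket X Y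
  bracket_add X Y Z := map_add _ _ _
  bracket_self := 𝔸.bracket_self
  bracket_skew X Y := by
    have h := 𝔸.bracket_self (X + Y)
    simp only [map_add, LinearMap.add_apply, 𝔸.bracket_self, zero_add, add_zero] at h
    exact eq_neg_of_add_eq_zero_right h
  leibniz X Y f := ContMDiffSection.ext fun x => 𝔸.leibniz X Y f x

end LieAlgebroid

variable (n F A) in
/-- The algebra `C(A[1]) = Γ(⋀ A^*)` of functions on the graded manifold `A[1]`; a section of
`⋀ᵏ A^*` is an alternating `C^∞(M)`-multilinear map `Γ(A)^k → C^∞(M)`. -/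
abbrev ShiftedFunctions : Type _ :=
  formAlgebra Cₛ^∞⟮𝓡 n; F, A⟯ C^∞⟮𝓡 n, M; 𝓘(ℝ, ℝ), ℝ⟯

variable (n F A) in
/-- The grading of `C(A[1])`. -/
noncomputable abbrev shiftedDegree : ℕ → Submodule ℝ (ShiftedFunctions n F A) :=
  formDegree Cₛ^∞⟮𝓡 n; F, A⟯ C^∞⟮𝓡 n, M; 𝓘(ℝ, ℝ), ℝ⟯

/-- The vector field `Q_A` on `A[1]`, the Lie algebroid differential. -/
noncomputable def LieAlgebroid.homologicalField
    [IsManifold (𝓡 n) ∞ M] [ContMDiffVectorBundle ∞ F A (𝓡 n)] (𝔸 : LieAlgebroid n F A) :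
    Module.End ℝ (ShiftedFunctions n F A) :=
  𝔸.anchoredBracket.formDifferential

end Geometry

section GradedAlgebra

open scoped TensorProduct

/-- Multiplication by the sign `(-1)^(d * k)` on the component of degree `k`. -/
noncomputable def signTwist {B : Type*} [Ring B] [Algebra ℝ B] (𝒢 : ℕ → Submodule ℝ B)
    [GradedAlgebra 𝒢] (d : ℤ) : Module.End ℝ B :=
  DirectSum.toModule ℝ ℕ B (fun k => ((d * k).negOnePow : ℤˣ) • (𝒢 k).subtype) ∘ₗ
    (DirectSum.decomposeLinearEquiv 𝒢).toLinearMap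

/-- A grading by `ℕ`, extended by `0` to a grading by `ℤ`. -/
def intDegree {B : Type*} [Ring B] [Algebra ℝ B] (𝒢 : ℕ → Submodule ℝ B) (m : ℤ) :
    Submodule ℝ B :=
  ⨆ (k : ℕ) (_ : (k : ℤ) = m), 𝒢 k

/-- The graded commutator of endomorphisms of degrees `p` and `q`. -/
def gradedCommutator {V : Type*} [AddCommGroup V] [Module ℝ V] (p q : ℤ)
    (X Y : Module.End ℝ V) : Module.End ℝ V :=
  X * Y - ((p * q).negOnePow : ℤˣ) • (Y * X)

/-- Vector fields of degree `d` on a graded manifold with algebra of functions `B = ⨁ 𝒢 k`: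
graded derivations of `B` of degree `d`. -/
structure IsVectorField {B : Type*} [Ring B] [Algebra ℝ B] (𝒢 : ℕ → Submodule ℝ B) (d : ℤ)
    (X : Module.End ℝ B) : Prop where
  map_mem : ∀ (k : ℕ), ∀ f ∈ 𝒢 k, X f ∈ intDegree 𝒢 (k + d)
  leibniz : ∀ (k : ℕ), ∀ f ∈ 𝒢 k, ∀ g : B,
    X (f * g) = X f * g + ((d * k).negOnePow : ℤˣ) • (f * X g)

/-- Homological vector fields: degree `1` and `[Q, Q] = 0`. -/
structure IsHomological {B : Type*} [Ring B] [Algebra ℝ B] (𝒢 : ℕ → Submodule ℝ B)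
    (Q : Module.End ℝ B) : Prop where
  isVectorField : IsVectorField 𝒢 1 Q
  commutator_self : gradedCommutator 1 1 Q Q = 0

/-- Differential graded Lie algebra structures on a real vector space. -/
structure DGLA (L : Type*) [AddCommGroup L] [Module ℝ L] where
  deg : ℤ → Submodule ℝ L
  isInternal : DirectSum.IsInternal deg
  bracket : L →ₗ[ℝ] L →ₗ[ℝ] L
  bracket_mem : ∀ (i j : ℤ), ∀ a ∈ deg i, ∀ b ∈ deg j, bracket a b ∈ deg (i + j)
  bracket_skew : ∀ (i j : ℤ), ∀ a ∈ deg i, ∀ b ∈ deg j,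
    bracket a b = -(((i * j).negOnePow : ℤˣ) • bracket b a)
  jacobi : ∀ (i j : ℤ), ∀ a ∈ deg i, ∀ b ∈ deg j, ∀ c : L,
    bracket a (bracket b c)
      = bracket (bracket a b) c + ((i * j).negOnePow : ℤˣ) • bracket b (bracket a c)
  δ : L →ₗ[ℝ] L
  δ_mem : ∀ (i : ℤ), ∀ a ∈ deg i, δ a ∈ deg (i + 1)
  δ_bracket : ∀ (i : ℤ), ∀ a ∈ deg i, ∀ b : L,
    δ (bracket a b) = bracket (δ a) b + (i.negOnePow : ℤˣ) • bracket a (δ b)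
  δ_δ : ∀ a, δ (δ a) = 0

namespace DGLA

variable {L : Type*} [AddCommGroup L] [Module ℝ L] (𝔏 : DGLA L)

/-- Strict Lie 2-algebras: concentrated in degrees `-1` and `0`. -/
def IsStrictLieTwoAlgebra : Prop := ∀ i : ℤ, i ≠ -1 → i ≠ 0 → 𝔏.deg i = ⊥

/-- Bases `(v_i)` of `L₀ = 𝔤` and `(w_α)` of `L₋₁ = 𝔥[1]`. -/
structure IsHomogeneousBasis {ι κ : Type*} (e : Module.Basis (ι ⊕ κ) ℝ L) : Prop where
  inl_mem : ∀ i, e (Sum.inl i) ∈ 𝔏.deg 0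
  inr_mem : ∀ α, e (Sum.inr α) ∈ 𝔏.deg (-1)

variable {C : Type*} [Ring C] [Algebra ℝ C] (𝒞 : ℕ → Submodule ℝ C)

/-- Morphisms of graded Lie algebras from `L` to the vector fields on the graded manifold with
algebra of functions `C`. -/
structure IsGradedLieHom (μ : L →ₗ[ℝ] Module.End ℝ C) : Prop where
  map_mem : ∀ (i : ℤ), ∀ a ∈ 𝔏.deg i, IsVectorField 𝒞 i (μ a)
  map_bracket : ∀ (i j : ℤ), ∀ a ∈ 𝔏.deg i, ∀ b ∈ 𝔏.deg j,
    μ (𝔏.bracket a b) = gradedCommutator i j (μ a) (μ b)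

/-- Morphisms of DGLAs from `L` to the vector fields, with differential `[Q, ·]`. -/
structure IsDGLAHom (Q : Module.End ℝ C) (μ : L →ₗ[ℝ] Module.End ℝ C) : Prop
    extends 𝔏.IsGradedLieHom 𝒞 μ where
  map_δ : ∀ (i : ℤ), ∀ a ∈ 𝔏.deg i, μ (𝔏.δ a) = gradedCommutator 1 i Q (μ a)

end DGLA

variable {C : Type*} [Ring C] [Algebra ℝ C] (𝒞 : ℕ → Submodule ℝ C) [GradedAlgebra 𝒞]

/-- The algebra of functions on `L[1] × 𝓜`, where `𝓜` is the graded manifold with algebra of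
functions `C`, and `L = L₋₁ ⊕ L₀` has bases indexed by `κ` and `ι`. It is the graded-commutative
algebra `S(L[1]^*) ⊗ C`, and `S(L[1]^*)` is polynomial in coordinates `P^α` of degree `2`, for
`α : κ`, and exterior in coordinates `η^i` of degree `1`, for `i : ι`. -/
abbrev TotalFunctions (ι κ : Type*) : Type _ :=
  MvPolynomial κ ℝ ⊗[ℝ] ((fun k : ℕ => ⋀[ℝ]^k (ι → ℝ)) ᵍ⊗[ℝ] 𝒞)

variable {ι κ : Type*}

/-- The degrees in `L` of the basis vectors `v_i` and `w_α`. -/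
def fiberDegree : ι ⊕ κ → ℤ := Sum.elim (fun _ => 0) (fun _ => -1)

namespace TotalFunctions

/-- The function `p(P) x(η) f`. -/
noncomputable def mk (p : MvPolynomial κ ℝ) (x : ExteriorAlgebra ℝ (ι → ℝ)) (f : C) :
    TotalFunctions 𝒞 ι κ :=
  p ⊗ₜ[ℝ] (x ᵍ⊗ₜ[ℝ] f)

/-- The endomorphism `p(P) x(η) f ↦ S(p) T(x) X(f)`. -/
noncomputable def mapEnd (S : Module.End ℝ (MvPolynomial κ ℝ))
    (T : Module.End ℝ (ExteriorAlgebra ℝ (ι → ℝ))) (X : Module.End ℝ C) :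
    Module.End ℝ (TotalFunctions 𝒞 ι κ) :=
  TensorProduct.map S (TensorProduct.map T X : Module.End ℝ (ExteriorAlgebra ℝ (ι → ℝ) ⊗[ℝ] C))

/-- The functions of degree `m`; `P` has degree `2` and `η` has degree `1`. -/
noncomputable def degree (m : ℕ) : Submodule ℝ (TotalFunctions 𝒞 ι κ) :=
  Submodule.span ℝ {b | ∃ (r s k : ℕ) (p : MvPolynomial κ ℝ) (x : ExteriorAlgebra ℝ (ι → ℝ))
    (f : C), p ∈ MvPolynomial.homogeneousSubmodule κ ℝ r ∧ x ∈ ⋀[ℝ]^s (ι → ℝ) ∧ f ∈ 𝒞 k ∧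
      2 * r + s + k = m ∧ b = mk 𝒞 p x f}

/-- The functions which are homogeneous polynomials of degree `m` on the fibers of
`L[1] × 𝓜 → 𝓜`. -/
noncomputable def fiberPolynomials (m : ℕ) : Submodule ℝ (TotalFunctions 𝒞 ι κ) :=
  Submodule.span ℝ {b | ∃ (r s : ℕ) (p : MvPolynomial κ ℝ) (x : ExteriorAlgebra ℝ (ι → ℝ))
    (f : C), p ∈ MvPolynomial.homogeneousSubmodule κ ℝ r ∧ x ∈ ⋀[ℝ]^s (ι → ℝ) ∧
      r + s = m ∧ b = mk 𝒞 p x f}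

/-- Functions on `𝓜` as functions on `L[1] × 𝓜`. -/
noncomputable def ofBase (f : C) : TotalFunctions 𝒞 ι κ := mk 𝒞 1 1 f

variable [DecidableEq ι]

/-- The coordinates `ξ^j` on `L[1]`: the `η^i` and the `P^α`. -/
noncomputable def coord : ι ⊕ κ → TotalFunctions 𝒞 ι κ
  | Sum.inl i => mk 𝒞 1 (ExteriorAlgebra.ι ℝ (Pi.single i 1)) 1
  | Sum.inr α => mk 𝒞 (MvPolynomial.X α) 1 1

/-- The vector fields `∂/∂ξ^j`: the `∂/∂η^i` (of degree `-1`) and the `∂/∂P^α`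
(of degree `-2`). -/
noncomputable def partialDeriv : ι ⊕ κ → Module.End ℝ (TotalFunctions 𝒞 ι κ)
  | Sum.inl i => mapEnd 𝒞 1 (CliffordAlgebra.contractLeft (LinearMap.proj i)) 1
  | Sum.inr α => mapEnd 𝒞 (MvPolynomial.pderiv α).toLinearMap 1 1

/-- The vector field `g X`. -/
noncomputable def mulField (g : TotalFunctions 𝒞 ι κ) (X : Module.End ℝ (TotalFunctions 𝒞 ι κ)) :
    Module.End ℝ (TotalFunctions 𝒞 ι κ) :=
  LinearMap.mulLeft ℝ g * X

/-- A vector field `X` of degree `d` on `𝓜`, as a vector field on `L[1] × 𝓜`: it annihilates the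
coordinates on `L[1]`, and gets the sign `(-1)^(d * s)` when it passes a monomial of degree `s`
in the `η^i`. -/
noncomputable def ofBaseField (d : ℤ) (X : Module.End ℝ C) :
    Module.End ℝ (TotalFunctions 𝒞 ι κ) :=
  mapEnd 𝒞 1 (signTwist (fun k : ℕ => ⋀[ℝ]^k (ι → ℝ)) d) X

end TotalFunctions

/-! ### Algebroids over the graded manifold `𝓜`

Let `L = L₋₁ ⊕ L₀` be a graded vector space with basis `(e_j)`, `j : ι ⊕ κ`, the first vectors
having degree `0` and the others degree `-1`. A section of the trivial bundle `L × 𝓜 → 𝓜`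
is an element `∑ⱼ aⱼ e_j` of `C ⊗ L`, given by the family of functions `aⱼ`. -/

/-- The section `∑ⱼ aⱼ e_j` has degree `p`. -/
def IsSectionOfDegree (p : ℤ) (a : ι ⊕ κ → C) : Prop :=
  ∀ j, a j ∈ intDegree 𝒞 (p - fiberDegree j)

/-- An anchor and a bracket on the sections of `L × 𝓜 → 𝓜`. -/
structure AlgebroidData (C : Type*) [Ring C] [Algebra ℝ C] (ι κ : Type*) where
  anchor : (ι ⊕ κ → C) →ₗ[C] Module.End ℝ C
  bracket : (ι ⊕ κ → C) →ₗ[ℝ] (ι ⊕ κ → C) →ₗ[ℝ] (ι ⊕ κ → C)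

/-- The axioms of an algebroid in the category of graded manifolds. -/
structure AlgebroidData.IsAlgebroid (𝒯 : AlgebroidData C ι κ) : Prop where
  anchor_mem : ∀ (p : ℤ) (a : ι ⊕ κ → C), IsSectionOfDegree 𝒞 p a →
    IsVectorField 𝒞 p (𝒯.anchor a)
  bracket_mem : ∀ (p q : ℤ) (a b : ι ⊕ κ → C), IsSectionOfDegree 𝒞 p a →
    IsSectionOfDegree 𝒞 q b → IsSectionOfDegree 𝒞 (p + q) (𝒯.bracket a b)
  bracket_skew : ∀ (p q : ℤ) (a b : ι ⊕ κ → C), IsSectionOfDegree 𝒞 p a →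
    IsSectionOfDegree 𝒞 q b → 𝒯.bracket a b = -(((p * q).negOnePow : ℤˣ) • 𝒯.bracket b a)
  leibniz : ∀ (p : ℤ) (k : ℕ) (a b : ι ⊕ κ → C) (f : C), IsSectionOfDegree 𝒞 p a → f ∈ 𝒞 k →
    𝒯.bracket a (f • b) = 𝒯.anchor a f • b + ((p * k).negOnePow : ℤˣ) • (f • 𝒯.bracket a b)
  jacobi : ∀ (p q : ℤ) (a b c : ι ⊕ κ → C), IsSectionOfDegree 𝒞 p a →
    IsSectionOfDegree 𝒞 q b → 𝒯.bracket a (𝒯.bracket b c)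
      = 𝒯.bracket (𝒯.bracket a b) c + ((p * q).negOnePow : ℤˣ) • 𝒯.bracket b (𝒯.bracket a c)

variable [Fintype ι] [Fintype κ] [DecidableEq ι]

open TotalFunctions

/-- The vertical vector field `ι_a` on `L[1] × 𝓜` defined by a section `a` of `L × 𝓜 → 𝓜`, with
`ι_a = ∂/∂ξ^j` for `a = e_j` and `ι_{f a} = (-1)^k f ι_a` for a function `f` of degree `k`.
It has degree `p - 1` if `a` has degree `p`. -/
noncomputable def verticalField (a : ι ⊕ κ → C) : Module.End ℝ (TotalFunctions 𝒞 ι κ) :=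
  ∑ j, mulField 𝒞 (ofBase 𝒞 (signTwist 𝒞 1 (a j))) (partialDeriv 𝒞 j)

/-- The homological vector field `Q` on `L[1] × 𝓜` encodes the algebroid `L × 𝓜 → 𝓜`: it raises
the polynomial degree on the fibers by one, and the anchor and the bracket are the derived ones,
`ρ(a) f = [Q, ι_a] f` and `ι_{[a, b]} = (-1)^{|a|} [[Q, ι_a], ι_b]`. -/
structure AlgebroidData.IsEncodedBy (𝒯 : AlgebroidData C ι κ)
    (Q : Module.End ℝ (TotalFunctions 𝒞 ι κ)) : Prop where
  isHomological : IsHomological (degree 𝒞) Q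
  map_fiberPolynomials : ∀ (m : ℕ), ∀ b ∈ fiberPolynomials 𝒞 m,
    Q b ∈ fiberPolynomials 𝒞 (m + 1)
  anchor_eq : ∀ (p : ℤ) (a : ι ⊕ κ → C), IsSectionOfDegree 𝒞 p a → ∀ f : C,
    ofBase 𝒞 (𝒯.anchor a f) = gradedCommutator 1 (p - 1) Q (verticalField 𝒞 a) (ofBase 𝒞 f)
  bracket_eq : ∀ (p q : ℤ) (a b : ι ⊕ κ → C), IsSectionOfDegree 𝒞 p a →
    IsSectionOfDegree 𝒞 q b → verticalField 𝒞 (𝒯.bracket a b)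
      = (p.negOnePow : ℤˣ) • gradedCommutator p (q - 1)
          (gradedCommutator 1 (p - 1) Q (verticalField 𝒞 a)) (verticalField 𝒞 b)

/-- The algebroid `L × 𝓜 → 𝓜` with the vector field `Q` (viewed on `L[1] × 𝓜`) is a Q-algebroid:
`Q` is homological and morphic, that is, it is linear on the fibers and it commutes with
the homological vector field encoding the algebroid. -/
structure AlgebroidData.IsQAlgebroid (𝒯 : AlgebroidData C ι κ)
    (Q : Module.End ℝ (TotalFunctions 𝒞 ι κ)) : Prop where
  isAlgebroid : 𝒯.IsAlgebroid 𝒞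
  isHomological : IsHomological (degree 𝒞) Q
  linear : ∀ b ∈ fiberPolynomials 𝒞 1, Q b ∈ fiberPolynomials 𝒞 1
  morphic : ∃ Q' : Module.End ℝ (TotalFunctions 𝒞 ι κ), 𝒯.IsEncodedBy 𝒞 Q' ∧
    gradedCommutator 1 1 Q Q' = 0

/-! ### The transformation algebroid -/

variable {L : Type*} [AddCommGroup L] [Module ℝ L] (𝔏 : DGLA L)
  (e : Module.Basis (ι ⊕ κ) ℝ L) (μ : L →ₗ[ℝ] Module.End ℝ C)

/-- The transformation algebroid of `μ`: the anchor is `ρ(f v) = f μ(v)`, and the bracket is the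
extension of the bracket of `L` by the Leibniz rule,
`[f v, g w] = f μ(v)(g) w + (-1)^{|v||g|} f g [v, w]
  - (-1)^{(|f| + |v|)(|g| + |w|)} g μ(w)(f) v`.
In the last term `g` is moved to the right of `μ(w)(f)`. -/
noncomputable def DGLA.transformationAlgebroid : AlgebroidData C ι κ where
  anchor := Fintype.linearCombination C fun j => μ (e j)
  bracket := LinearMap.mk₂ ℝ
    (fun a b k =>
      (∑ i, a i * μ (e i) (b k))
      + (∑ i, ∑ j, e.repr (𝔏.bracket (e i) (e j)) k • (a i * signTwist 𝒞 (fiberDegree i) (b j)))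
      - ∑ j, ((fiberDegree k * fiberDegree j).negOnePow : ℤˣ) •
          (μ (e j) (signTwist 𝒞 (fiberDegree j) (a k))
            * signTwist 𝒞 (fiberDegree k + fiberDegree j) (b j)))
    (fun a a' b => by
      ext k
      simp only [Pi.add_apply, add_mul, map_add, smul_add, Finset.sum_add_distrib]
      abel)
    (fun c a b => by
      ext k
      simp only [Pi.smul_apply, smul_mul_assoc, map_smul, smul_sub, smul_add, Finset.smul_sum,
        smul_comm c])
    (fun a b b' => by
      ext k
      simp only [Pi.add_apply, mul_add, map_add, smul_add, Finset.sum_add_distrib]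
      abel)
    (fun c a b => by
      ext k
      simp only [Pi.smul_apply, mul_smul_comm, map_smul, smul_sub, smul_add, Finset.smul_sum,
        smul_comm c])

/-- `Q_δ = ∑ ξ^i Q_i^k ∂/∂ξ^k`, with `δ e_i = (-1)^{|e_i|} ∑ Q_i^k e_k`. -/
noncomputable def DGLA.fieldδ : Module.End ℝ (TotalFunctions 𝒞 ι κ) :=
  ∑ i, ∑ k, ((fiberDegree i).negOnePow : ℤˣ) • e.repr (𝔏.δ (e i)) k •
    mulField 𝒞 (coord 𝒞 i) (partialDeriv 𝒞 k)

/-- `Q_br = 1/2 ∑ ξ^j ξ^i Q_ij^k ∂/∂ξ^k`, with `[e_i, e_j] = (-1)^{|e_j|} ∑ Q_ij^k e_k`. -/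
noncomputable def DGLA.fieldBr : Module.End ℝ (TotalFunctions 𝒞 ι κ) :=
  (1 / 2 : ℝ) • ∑ i, ∑ j, ∑ k,
    ((fiberDegree j).negOnePow : ℤˣ) • e.repr (𝔏.bracket (e i) (e j)) k •
      mulField 𝒞 (coord 𝒞 j * coord 𝒞 i) (partialDeriv 𝒞 k)

/-- `Q_action = ∑ η^i μ(v_i) - ∑ P^α μ(w_α)`. -/
noncomputable def fieldAction : Module.End ℝ (TotalFunctions 𝒞 ι κ) :=
  (∑ i, mulField 𝒞 (coord 𝒞 (Sum.inl i)) (ofBaseField 𝒞 0 (μ (e (Sum.inl i)))))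
  - ∑ α, mulField 𝒞 (coord 𝒞 (Sum.inr α)) (ofBaseField 𝒞 (-1) (μ (e (Sum.inr α))))

end GradedAlgebra

open scoped Manifold ContDiff

/-! Write `B` for the functions on `L[1] × A[1]`, graded by polynomial degree along the fibers, and
`∂_x` for the constant vertical field of `x ∈ L`. All vector fields in play are operators on `B`,
and one rigidity principle decides every identity between them. An operator that does not lower the
fiber degree, kills the functions on the base and graded-commutes with all `∂/∂ξ^j` is zero
(`FiberModel.eq_zero_of_commutator_partialDeriv`). The proof is an induction on the fiber degree: by
Euler's identity, a polynomial of positive degree with vanishing partial derivatives is zero. If the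
operator strictly raises the fiber degree, it kills the base automatically
(`FiberModel.eq_zero_of_commutator_partialDeriv_of_raises`).

Apply this twice. A field `Q'` raising the fiber degree by one is determined by the action of `[Q',
∂_x]` on base functions and by the double commutators `[[Q', ∂_x], ∂_y]`. An encoding of `T_μ` must
have `[Q', ∂_x] f = μ(x) f` and `[[Q', ∂_x], ∂_y] = ± ∂_{[x, y]}` (`IsActionField`), which gives
uniqueness. A direct computation shows that `Q_br + Q_action` has these properties: `Q_br` produces
the bracket of `L`, with the factor `1/2` absorbed by skew-symmetry, and `Q_action` produces `μ`.

The same principle gives `[[Q', ∂_x], [Q', ∂_y]] = [Q', ∂_{[x, y]}]`: on the base this says that `μ`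
preserves brackets, and after bracketing with `∂_z` it is the Jacobi identity of `L`. Then `Q' ^ 2 =
0` follows by testing against `∂_x` and `∂_y` (`IsActionField.mul_self`). The bracket of `T_μ` is
the derived bracket of `Q'` on all sections (`IsActionField.bracket_eq`), so the algebroid axioms
come from `Q' ^ 2 = 0`, the graded Jacobi identity of operators and the injectivity of `a ↦ ι_a`.

Finally let `R = -Q_δ + Q_A`. It satisfies `[R, ∂_x] = -∂_{δx}`, hence `[[R, Q'], ∂_x] = [R, [Q',
∂_x]] - [Q', ∂_{δx}]`. On a base function this is `([Q_A, μ(x)] - μ(δx)) f`, and its commutator with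
every `∂_y` vanishes because `δ` is a derivation of the bracket. So `[R, Q'] = 0` exactly when `μ`
intertwines the differentials (`IsLinearField.commutator_eq_zero_iff`). Also `R ^ 2 = 0`, from `Q_A
^ 2 = 0` and `δ ^ 2 = 0`. By uniqueness of `Q'`, the Q-algebroid condition is the same equation.

The geometry enters only through two facts: `Γ(⋀ A^*)` is graded commutative, and `Q_A` is
homological. -/

namespace Cochain

/-! ### Graded commutativity of the algebra of forms -/

variable {E R : Type*} [CommRing R]

theorem sgn_eq_smul_of_degree {f : Cochain E R} {p : ℕ}
    (hf : ∀ l : List E, l.length ≠ p → f l = 0) : sgn f = ((-1 : R) ^ p) • f := by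
  ext l
  by_cases h : l.length = p
  · simp [sgn, h]
  · simp [sgn, hf l h]

/-- The shuffle product is graded commutative. -/
theorem mul_comm_of_degree {f g : Cochain E R} {p q : ℕ}
    (hf : ∀ l : List E, l.length ≠ p → f l = 0) (hg : ∀ l : List E, l.length ≠ q → g l = 0) :
    f * g = ((-1 : R) ^ (p * q)) • (g * f) := by
  ext l
  induction l generalizing f g p q with
  | nil =>
    rw [smul_apply, mul_nil, mul_nil, smul_eq_mul]
    rcases p with _ | p
    · simp [mul_comm]
    · simp [hf [] (by simp)]
  | cons v l ih =>
    -- The contraction has degree `p - 1`. The sign is written with `p + 1`, which has the same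
    -- parity and avoids truncated subtraction; for `p = 0` the contraction vanishes.
    have hcf : (contract v f * g) l = ((-1 : R) ^ ((p + 1) * q)) • (g * contract v f) l := by
      rcases p with _ | p
      · have : contract v f = 0 := by ext m; exact hf _ (by simp)
        rw [this, zero_mul', mul_zero']; simp
      · rw [ih (f := contract v f) (p := p) (fun m hm => hf (v :: m) (by simpa using hm)) hg, smul_apply]
        congr 1
        rw [show (p + 1 + 1) * q = p * q + 2 * q by ring, pow_add, pow_mul (-1 : R) 2]
        simp
    have hcg : (f * contract v g) l = ((-1 : R) ^ (p * (q + 1))) • (contract v g * f) l := by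
      rcases q with _ | q
      · have : contract v g = 0 := by ext m; exact hg _ (by simp)
        rw [this, zero_mul', mul_zero']; simp
      · rw [ih (g := contract v g) (q := q) hf (fun m hm => hg (v :: m) (by simpa using hm)), smul_apply]
        congr 1
        rw [show p * (q + 1 + 1) = p * q + 2 * p by ring, pow_add, pow_mul (-1 : R) 2]
        simp
    rw [smul_apply, mul_cons, mul_cons, sgn_eq_smul_of_degree hf, sgn_eq_smul_of_degree hg,
      smul_mul', smul_mul', smul_apply, smul_apply, hcf, hcg]
    simp only [smul_eq_mul, mul_add, add_mul, pow_add, one_mul, mul_one]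
    have h2 : ((-1 : R) ^ p) * (-1) ^ p = 1 := by rw [← mul_pow]; simp
    linear_combination ((-1) ^ (p * q) * (contract v g * f) l) * h2

end Cochain

theorem Int.negOnePow_natCast_smul {R : Type*} [CommRing R] {V : Type*} [AddCommGroup V]
    [Module R V] (k : ℕ) (x : V) :
    (((k : ℤ).negOnePow : ℤˣ)) • x = ((-1 : R) ^ k) • x := by
  rcases Nat.even_or_odd k with h | h
  · rw [Int.negOnePow_even _ (by exact_mod_cast h), h.neg_one_pow]; simp
  · rw [Int.negOnePow_odd _ (by exact_mod_cast h), h.neg_one_pow]; simp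

section Forms

variable {E R : Type*} [CommRing R] [Algebra ℝ R] [AddCommGroup E] [Module R E]

theorem formAlgebra_units_smul_coe (u : ℤˣ) (f : formAlgebra E R) :
    ((u • f : formAlgebra E R) : Cochain E R) = u • (f : Cochain E R) := by
  rcases Int.units_eq_one_or u with rfl | rfl
  · simp
  · simp

theorem formDegree_mul_comm {i j : ℕ} {f g : formAlgebra E R} (hf : f ∈ formDegree E R i)
    (hg : g ∈ formDegree E R j) :
    f * g = (((i : ℤ) * (j : ℤ)).negOnePow : ℤˣ) • (g * f) := by
  apply Subtype.ext
  rw [formAlgebra_units_smul_coe, ← Nat.cast_mul, Int.negOnePow_natCast_smul (R := R)]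
  exact Cochain.mul_comm_of_degree hf hg

end Forms

/-! ### Cartan calculus and `d ^ 2 = 0` -/

namespace AnchoredBracket

variable {R E : Type*} [CommRing R] [Algebra ℝ R] [AddCommGroup E] [Module R E]
  (P : AnchoredBracket R E)

/-- The Jacobi identity, in Leibniz form. -/
def IsJacobi : Prop :=
  ∀ u v w, P.bracket u (P.bracket v w) = P.bracket (P.bracket u v) w + P.bracket v (P.bracket u w)

/-- The defect of the anchor from being a morphism of Lie algebras. -/
def anchorDefect (u v : E) (r : R) : R :=
  P.anchor u (P.anchor v r) - P.anchor v (P.anchor u r) - P.anchor (P.bracket u v) r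

variable {P}

/-- Expand the Jacobi identity for `u`, `v`, `r • w` by the Leibniz rule. The mixed terms cancel,
Jacobi for `u`, `v`, `w` removes the multiples of `r`, and what remains is the defect times `w`. -/
theorem IsJacobi.anchorDefect_smul (hP : P.IsJacobi) (u v w : E) (r : R) :
    P.anchorDefect u v r • w = 0 := by
  have h := hP u v (r • w)
  simp only [P.leibniz, P.bracket_add] at h
  rw [hP u v w, smul_add] at h
  simp only [anchorDefect, sub_smul]
  rw [← sub_eq_zero] at h
  rw [← h]
  abel

variable (P) in
-- The terms that differentiate `g` cancel against the anchor of the correction term in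
-- `smul_bracket`, so the defect is tensorial in its first argument.
theorem anchorDefect_smul_left (u v : E) (g r : R) :
    P.anchorDefect (g • u) v r = g * P.anchorDefect u v r := by
  simp only [anchorDefect, smul_bracket, map_smul, map_sub, Derivation.smul_apply,
    Derivation.sub_apply, smul_eq_mul, Derivation.leibniz]
  ring

/-- The Jacobi identity forces the anchor to be a morphism of Lie algebras. -/
theorem IsJacobi.anchor_bracket [IsReduced R] (hP : P.IsJacobi) (u v : E) (r : R) :
    P.anchor (P.bracket u v) r = P.anchor u (P.anchor v r) - P.anchor v (P.anchor u r) := by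
  -- Choosing the defect itself as the scalar `g` makes `g • u = 0`, so the square of the defect is
  -- the defect at `0`, which vanishes. Reducedness of `R` finishes, and `E` need not be a faithful
  -- module.
  have h1 := P.anchorDefect_smul_left u v (P.anchorDefect u v r) r
  rw [hP.anchorDefect_smul] at h1
  have h0 := P.anchorDefect_smul_left 0 v 0 r
  rw [zero_smul, zero_mul] at h0
  rw [h0] at h1
  have h2 : P.anchorDefect u v r = 0 := by
    apply IsReduced.eq_zero
    exact ⟨2, by rw [sq, ← h1]⟩
  simp only [anchorDefect] at h2
  linear_combination -h2

variable (P)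

/-- This and `contract_d` are Cartan's relations `[L_v, ι_w] = ι_{[v, w]}` and `ι_v d + d ι_v =
L_v`. They hold by the recursive definitions. The identities below follow by contracting with the
first argument and inducting on the number of arguments. -/
theorem contract_lieDeriv (v w : E) (f : Cochain E R) :
    (P.lieDeriv v f).contract w = P.lieDeriv v (f.contract w) - f.contract (P.bracket v w) := by
  ext l; exact P.lieDeriv_cons v w l f

theorem contract_d (v : E) (f : Cochain E R) :
    (P.d f).contract v = P.lieDeriv v f - P.d (f.contract v) := by
  ext l; exact P.d_cons v l f

theorem lieDeriv_neg (v : E) (f : Cochain E R) : P.lieDeriv v (-f) = -P.lieDeriv v f := by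
  simpa using P.lieDeriv_real_smul v (-1) f

theorem lieDeriv_sub (v : E) (f g : Cochain E R) :
    P.lieDeriv v (f - g) = P.lieDeriv v f - P.lieDeriv v g := by
  rw [sub_eq_add_neg, lieDeriv_add, lieDeriv_neg, sub_eq_add_neg]

theorem d_neg (f : Cochain E R) : P.d (-f) = -P.d f := by
  simpa using P.d_real_smul (-1) f

theorem d_sub (f g : Cochain E R) : P.d (f - g) = P.d f - P.d g := by
  rw [sub_eq_add_neg, d_add, d_neg, sub_eq_add_neg]

theorem sumBracket_sgn (v : E) (f : Cochain E R) (l : List E) :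
    P.sumBracket v l f.sgn = (-1) ^ l.length * P.sumBracket v l f := by
  induction l generalizing f with
  | nil => simp [sumBracket]
  | cons w l ih =>
    have h : P.sumBracket v l (-(f.contract w).sgn) = -P.sumBracket v l (f.contract w).sgn := by
      simpa using P.sumBracket_real_smul v (-1) (f.contract w).sgn l
    simp only [sumBracket, Cochain.contract_sgn, h, ih, List.length_cons, pow_succ]
    simp only [Cochain.sgn, List.length_cons, pow_succ]
    ring

theorem lieDeriv_sgn (v : E) (f : Cochain E R) : P.lieDeriv v f.sgn = (P.lieDeriv v f).sgn := by
  ext l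
  simp only [lieDeriv, sumBracket_sgn, Cochain.sgn, Derivation.leibniz, smul_eq_mul]
  have : P.anchor v ((-1) ^ l.length) = 0 := by
    rcases Nat.even_or_odd l.length with h | h
    · simp [h.neg_one_pow]
    · simp [h.neg_one_pow]
  rw [this]; ring

theorem d_sgn (f : Cochain E R) : P.d f.sgn = -(P.d f).sgn := by
  ext l
  induction l generalizing f with
  | nil => simp [d, differential, Cochain.sgn]
  | cons v l ih =>
    have h := ih (f.contract v)
    rw [d_cons, lieDeriv_sgn, Cochain.contract_sgn, d_neg, Cochain.neg_apply, h]
    simp only [Cochain.sgn, Cochain.neg_apply, d_cons, List.length_cons, pow_succ]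
    ring

theorem lieDeriv_mul (v : E) (f g : Cochain E R) :
    P.lieDeriv v (f * g) = P.lieDeriv v f * g + f * P.lieDeriv v g := by
  ext l
  induction l generalizing f g with
  | nil => simp [lieDeriv, sumBracket, Cochain.mul_nil]; ring
  | cons w l ih =>
    have hs : ∀ x y : Cochain E R, (x - y) l = x l - y l := fun _ _ => rfl
    simp only [lieDeriv_cons, Cochain.contract_mul, lieDeriv_add, Cochain.add_apply, ih,
      Cochain.mul_cons, contract_lieDeriv, lieDeriv_sgn, sub_mul, mul_sub, hs]
    ring

/-- Contracting with `v` turns `d` into `L_v - d ι_v`. The Lie derivative is a derivation without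
signs, and the induction hypothesis treats the contracted factors; `d_sgn` accounts for `d` being
odd. -/
theorem d_mul (f g : Cochain E R) : P.d (f * g) = P.d f * g + f.sgn * P.d g := by
  ext l
  induction l generalizing f g with
  | nil => simp [d, differential, Cochain.mul_nil]
  | cons v l ih =>
    have hs : ∀ x y : Cochain E R, (x - y) l = x l - y l := fun _ _ => rfl
    simp only [d_cons, Cochain.contract_mul, d_add, Cochain.add_apply, ih, Cochain.mul_cons,
      contract_d, lieDeriv_mul, Cochain.contract_sgn, Cochain.sgn_sgn, d_sgn, sub_mul, mul_sub,
      neg_mul, Cochain.neg_apply, hs]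
    ring

variable {P}

/-- With no arguments this says that the anchor is a morphism, which is where reducedness enters.
Each further argument contributes one instance of the Jacobi identity inside `f`. -/
theorem IsJacobi.lieDeriv_bracket [IsReduced R] (hP : P.IsJacobi) (u v : E) {f : Cochain E R}
    (hf : f.IsForm) :
    P.lieDeriv (P.bracket u v) f = P.lieDeriv u (P.lieDeriv v f) - P.lieDeriv v (P.lieDeriv u f) := by
  ext l
  have hs : ∀ (x y : Cochain E R) (l : List E), (x - y) l = x l - y l := fun _ _ _ => rfl
  induction l generalizing f with
  | nil => simpa [lieDeriv, sumBracket, hs] using hP.anchor_bracket u v (f [])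
  | cons w l ih =>
    have h := ih (hf.contract w)
    have h1 : f.contract (P.bracket u (P.bracket v w))
        = f.contract (P.bracket (P.bracket u v) w) + f.contract (P.bracket v (P.bracket u w)) := by
      rw [hP u v w, Cochain.contract_form_add hf]
    simp only [hs] at h
    simp only [hs, lieDeriv_cons, h, contract_lieDeriv, lieDeriv_sub]
    have h1' : f.contract (P.bracket u (P.bracket v w)) l
      = f.contract (P.bracket (P.bracket u v) w) l + f.contract (P.bracket v (P.bracket u w)) l :=
      congrFun h1 l
    simp only [Cochain.contract_apply] at h1'
    rw [h1']
    ring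

theorem IsJacobi.lieDeriv_d [IsReduced R] (hP : P.IsJacobi) (u : E) {f : Cochain E R}
    (hf : f.IsForm) : P.lieDeriv u (P.d f) = P.d (P.lieDeriv u f) := by
  ext l
  have hs : ∀ (x y : Cochain E R) (l : List E), (x - y) l = x l - y l := fun _ _ _ => rfl
  induction l generalizing f u with
  | nil => simp [lieDeriv, sumBracket, d, differential]
  | cons w l ih =>
    simp only [lieDeriv_cons, contract_d, lieDeriv_sub, hs, ih _ (hf.contract w), d_cons,
      contract_lieDeriv, d_sub, hP.lieDeriv_bracket u w hf]
    ring

/-- By Cartan's formula `ι_v d d = L_v d - d L_v + d d ι_v`, and `L_v` commutes with `d`; induct on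
the number of arguments. -/
theorem IsJacobi.d_d [IsReduced R] (hP : P.IsJacobi) {f : Cochain E R} (hf : f.IsForm) :
    P.d (P.d f) = 0 := by
  ext l
  induction l generalizing f with
  | nil => simp [d, differential]
  | cons v l ih =>
    rw [d_cons, contract_d, d_sub, hP.lieDeriv_d v hf]
    have hs : ∀ (x y : Cochain E R) (l : List E), (x - y) l = x l - y l := fun _ _ _ => rfl
    rw [hs, ih (hf.contract v)]
    simp

end AnchoredBracket

/-! ### The Lie algebroid differential is a homological vector field -/

section Homological

variable {R E : Type*} [CommRing R] [Algebra ℝ R] [AddCommGroup E] [Module R E]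

theorem mem_intDegree_natCast {B : Type*} [Ring B] [Algebra ℝ B] {𝒢 : ℕ → Submodule ℝ B} {m : ℤ}
    {k : ℕ} (h : m = k) {f : B} : f ∈ intDegree 𝒢 m ↔ f ∈ 𝒢 k := by
  subst h
  have : intDegree 𝒢 (k : ℤ) = 𝒢 k := by
    unfold intDegree
    apply le_antisymm
    · refine iSup₂_le fun i hi => ?_
      rw [Nat.cast_inj.mp hi]
    · exact le_iSup₂_of_le k rfl le_rfl
  rw [this]

theorem eq_zero_of_mem_intDegree_neg {B : Type*} [Ring B] [Algebra ℝ B] {𝒢 : ℕ → Submodule ℝ B}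
    {m : ℤ} (h : m < 0) {f : B} (hf : f ∈ intDegree 𝒢 m) : f = 0 := by
  have : intDegree 𝒢 m = ⊥ := by
    unfold intDegree
    rw [eq_bot_iff]
    refine iSup₂_le fun i hi => ?_
    omega
  rwa [this, Submodule.mem_bot] at hf

theorem AnchoredBracket.IsJacobi.isHomological_formDifferential [IsReduced R]
    {P : AnchoredBracket R E} (hP : P.IsJacobi) :
    IsHomological (formDegree E R) P.formDifferential where
  isVectorField :=
    { map_mem := fun k f hf' => by
        rw [mem_intDegree_natCast (k := k + 1) (by push_cast; ring)]
        change ∀ l : List E, l.length ≠ k + 1 → P.d f.1 l = 0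
        intro l
        have hf : ∀ l : List E, l.length ≠ k → f.1 l = 0 := hf'
        clear hf'
        generalize f.1 = f at hf ⊢
        induction l generalizing f k with
        | nil => intro _; rfl
        | cons v l ih =>
          intro hl
          have hl' : l.length ≠ k := by simpa using hl
          -- The sum over the slots evaluates `f` only on lists of the same length as `l`, so it
          -- vanishes as soon as `f` does there.
          have hz : ∀ (l : List E) (f : Cochain E R), (∀ m : List E, m.length = l.length → f m = 0) →
              P.sumBracket v l f = 0 := by
            intro l
            induction l with
            | nil => intros; rfl
            | cons w l ih =>
              intro f hf
              simp only [AnchoredBracket.sumBracket]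
              rw [hf _ (by simp), ih (f.contract w) (fun m hm => hf (w :: m) (by simpa using hm)), add_zero]
          rw [AnchoredBracket.d_cons, AnchoredBracket.lieDeriv, hf l hl',
            hz l f (fun m hm => hf m (by omega)), map_zero]
          rcases k with _ | k
          · have : f.contract v = 0 := by ext m; exact hf _ (by simp)
            rw [this, AnchoredBracket.d_zero]; simp
          · rw [ih k (f.contract v) (fun m hm => hf (v :: m) (by simpa using hm)) (by omega)]
            simp
      leibniz := fun k f hf g => by
        apply Subtype.ext
        have h := P.d_mul f.1 g.1
        rw [Cochain.sgn_eq_smul_of_degree (p := k) (fun l hl => hf l hl)] at h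
        rw [one_mul]
        change _ = (P.formDifferential f * g).1 + (((k : ℤ).negOnePow : ℤˣ) •
          (f * P.formDifferential g) : formAlgebra E R).1
        rw [formAlgebra_units_smul_coe, Int.negOnePow_natCast_smul (R := R)]
        refine h.trans ?_
        rw [Cochain.smul_mul']
        rfl }
  commutator_self := by
    refine LinearMap.ext fun f => ?_
    have h : P.formDifferential (P.formDifferential f) = 0 := Subtype.ext (hP.d_d f.2)
    simp [gradedCommutator, h]

end Homological

section Manifold

open scoped Manifold ContDiff Bundle

variable {n : ℕ} {M : Type*} [TopologicalSpace M] [ChartedSpace (EuclideanSpace ℝ (Fin n)) M]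
  {F : Type*} [NormedAddCommGroup F] [NormedSpace ℝ F]
  {A : M → Type*} [TopologicalSpace (Bundle.TotalSpace F A)] [∀ x, TopologicalSpace (A x)]
  [∀ x, AddCommGroup (A x)] [∀ x, Module ℝ (A x)] [FiberBundle F A] [VectorBundle ℝ F A]

/-- Functions have values in a field. Besides the Lie algebroid axioms, this is the only property of
`C^∞(M)` needed for `Q_A ^ 2 = 0`. -/
theorem isReduced_contMDiffMap : IsReduced C^∞⟮𝓡 n, M; 𝓘(ℝ, ℝ), ℝ⟯ where
  eq_zero f := by
    rintro ⟨k, hk⟩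
    ext x
    have h := DFunLike.congr_fun hk x
    rw [ContMDiffMap.coe_pow] at h
    exact eq_zero_of_pow_eq_zero h

theorem LieAlgebroid.isHomological_homologicalField
    [IsManifold (𝓡 n) ∞ M] [ContMDiffVectorBundle ∞ F A (𝓡 n)] (𝔸 : LieAlgebroid n F A) :
    IsHomological (shiftedDegree n F A) 𝔸.homologicalField :=
  have := isReduced_contMDiffMap (n := n) (M := M)
  AnchoredBracket.IsJacobi.isHomological_formDifferential (P := 𝔸.anchoredBracket) 𝔸.jacobi

end Manifold

/-! ### Graded commutators and graded derivations -/

section GradedOperators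

/-- Turns sign identities into case distinctions on the parities of the degrees. -/
theorem Int.negOnePow_eq_ite (n : ℤ) : n.negOnePow = if Even n then 1 else -1 := by
  split_ifs with h
  · exact Int.negOnePow_even n h
  · exact Int.negOnePow_odd n (Int.not_even_iff_odd.mp h)

section Commutator

variable {V : Type*} [AddCommGroup V] [Module ℝ V]

theorem gradedCommutator_add_left (p q : ℤ) (X X' Y : Module.End ℝ V) :
    gradedCommutator p q (X + X') Y = gradedCommutator p q X Y + gradedCommutator p q X' Y := by
  simp only [gradedCommutator, add_mul, mul_add, smul_add]; abel

theorem gradedCommutator_add_right (p q : ℤ) (X Y Y' : Module.End ℝ V) :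
    gradedCommutator p q X (Y + Y') = gradedCommutator p q X Y + gradedCommutator p q X Y' := by
  simp only [gradedCommutator, add_mul, mul_add, smul_add]; abel

theorem gradedCommutator_smul_left (p q : ℤ) (c : ℝ) (X Y : Module.End ℝ V) :
    gradedCommutator p q (c • X) Y = c • gradedCommutator p q X Y := by
  simp only [gradedCommutator, smul_mul_assoc, mul_smul_comm, smul_sub, smul_comm c]

theorem gradedCommutator_smul_right (p q : ℤ) (c : ℝ) (X Y : Module.End ℝ V) :
    gradedCommutator p q X (c • Y) = c • gradedCommutator p q X Y := by
  simp only [gradedCommutator, smul_mul_assoc, mul_smul_comm, smul_sub, smul_comm c]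

@[simp] theorem gradedCommutator_zero_left (p q : ℤ) (Y : Module.End ℝ V) :
    gradedCommutator p q 0 Y = 0 := by simp [gradedCommutator]

@[simp] theorem gradedCommutator_zero_right (p q : ℤ) (X : Module.End ℝ V) :
    gradedCommutator p q X 0 = 0 := by simp [gradedCommutator]

theorem gradedCommutator_neg_left (p q : ℤ) (X Y : Module.End ℝ V) :
    gradedCommutator p q (-X) Y = -gradedCommutator p q X Y := by
  simpa using gradedCommutator_smul_left p q (-1) X Y

theorem gradedCommutator_neg_right (p q : ℤ) (X Y : Module.End ℝ V) :
    gradedCommutator p q X (-Y) = -gradedCommutator p q X Y := by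
  simpa using gradedCommutator_smul_right p q (-1) X Y

theorem gradedCommutator_sub_left (p q : ℤ) (X X' Y : Module.End ℝ V) :
    gradedCommutator p q (X - X') Y = gradedCommutator p q X Y - gradedCommutator p q X' Y := by
  rw [sub_eq_add_neg, gradedCommutator_add_left, gradedCommutator_neg_left, sub_eq_add_neg]

theorem gradedCommutator_units_left (p q : ℤ) (u : ℤˣ) (X Y : Module.End ℝ V) :
    gradedCommutator p q (u • X) Y = u • gradedCommutator p q X Y := by
  rcases Int.units_eq_one_or u with rfl | rfl
  · simp
  · simp [gradedCommutator_neg_left]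

theorem gradedCommutator_units_right (p q : ℤ) (u : ℤˣ) (X Y : Module.End ℝ V) :
    gradedCommutator p q X (u • Y) = u • gradedCommutator p q X Y := by
  rcases Int.units_eq_one_or u with rfl | rfl
  · simp
  · simp [gradedCommutator_neg_right]

theorem gradedCommutator_sum_left {α : Type*} (s : Finset α) (p q : ℤ) (X : α → Module.End ℝ V)
    (Y : Module.End ℝ V) :
    gradedCommutator p q (∑ i ∈ s, X i) Y = ∑ i ∈ s, gradedCommutator p q (X i) Y := by
  classical
  induction s using Finset.induction_on with
  | empty => simp
  | insert a s ha ih => rw [Finset.sum_insert ha, Finset.sum_insert ha, gradedCommutator_add_left, ih]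

theorem gradedCommutator_sum_right {α : Type*} (s : Finset α) (p q : ℤ) (X : Module.End ℝ V)
    (Y : α → Module.End ℝ V) :
    gradedCommutator p q X (∑ i ∈ s, Y i) = ∑ i ∈ s, gradedCommutator p q X (Y i) := by
  classical
  induction s using Finset.induction_on with
  | empty => simp
  | insert a s ha ih => rw [Finset.sum_insert ha, Finset.sum_insert ha, gradedCommutator_add_right, ih]

theorem gradedCommutator_skew (p q : ℤ) (X Y : Module.End ℝ V) :
    gradedCommutator p q X Y = -(((p * q).negOnePow : ℤˣ) • gradedCommutator q p Y X) := by
  simp only [gradedCommutator, Int.negOnePow_eq_ite, Int.even_mul]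
  by_cases hp : Even p <;> by_cases hq : Even q <;> simp [hp, hq, add_comm]

/-- The graded Jacobi identity. -/
theorem gradedCommutator_jacobi {p q r s t u : ℤ} (hs : s = q + r) (ht : t = p + q) (hu : u = p + r)
    (X Y Z : Module.End ℝ V) :
    gradedCommutator p s X (gradedCommutator q r Y Z)
      = gradedCommutator t r (gradedCommutator p q X Y) Z
        + ((p * q).negOnePow : ℤˣ) • gradedCommutator q u Y (gradedCommutator p r X Z) := by
  -- The identity is formal: it holds for arbitrary operators and any integers assigned to them. The
  -- total degrees are separate variables so that the lemma applies to degrees written in any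
  -- equivalent form, such as `i + j - 1`.
  subst hs ht hu
  simp only [gradedCommutator, Int.negOnePow_eq_ite, Int.even_mul, Int.even_add]
  by_cases hp : Even p <;> by_cases hq : Even q <;> by_cases hr : Even r <;>
    simp only [hp, hq, hr, if_true, if_false, one_smul, Units.neg_smul, or_true, or_false,
      iff_true, iff_false, not_true, or_self, iff_self] <;>
    noncomm_ring

theorem gradedCommutator_one_one_self (X : Module.End ℝ V) :
    gradedCommutator 1 1 X X = (2 : ℝ) • (X * X) := by
  simp [gradedCommutator, two_smul]

/-- The square of an odd operator acts by the iterated commutator. -/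
theorem gradedCommutator_sq {q t : ℤ} (ht : t = 1 + q) (s : ℤ) (hs : s = 2)
    (X Y : Module.End ℝ V) :
    gradedCommutator s q (X * X) Y = gradedCommutator 1 t X (gradedCommutator 1 q X Y) := by
  subst ht hs
  simp only [gradedCommutator, Int.negOnePow_eq_ite, Int.even_mul, Int.even_add]
  by_cases hq : Even q <;> simp [hq] <;> noncomm_ring

end Commutator

variable {B : Type*} [Ring B] [Algebra ℝ B] {𝒢 : ℕ → Submodule ℝ B}

/-- The grading `𝒢` is multiplicative and graded commutative. -/
structure IsGradedCommutative (𝒢 : ℕ → Submodule ℝ B) : Prop where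
  mul_mem : ∀ {i j : ℕ} {f g : B}, f ∈ 𝒢 i → g ∈ 𝒢 j → f * g ∈ 𝒢 (i + j)
  mul_comm : ∀ {i j : ℕ} {f g : B}, f ∈ 𝒢 i → g ∈ 𝒢 j →
    f * g = (((i : ℤ) * (j : ℤ)).negOnePow : ℤˣ) • (g * f)

/-- The grading is by `ℕ`, while fields such as `∂/∂ξ^j` lower degrees. In a negative degree the
only element is `0`, so every statement about `intDegree` reduces to natural degrees. -/
theorem intDegree_cases {m : ℤ} {f : B} (hf : f ∈ intDegree 𝒢 m) :
    (∃ k : ℕ, m = k ∧ f ∈ 𝒢 k) ∨ f = 0 := by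
  rcases lt_or_ge m 0 with h | h
  · exact Or.inr (eq_zero_of_mem_intDegree_neg h hf)
  · obtain ⟨k, rfl⟩ := Int.eq_ofNat_of_zero_le h
    exact Or.inl ⟨k, rfl, (mem_intDegree_natCast rfl).mp hf⟩

theorem mem_intDegree_of_mem {k : ℕ} {f : B} (hf : f ∈ 𝒢 k) {m : ℤ} (hm : m = k) :
    f ∈ intDegree 𝒢 m := (mem_intDegree_natCast hm).mpr hf

theorem IsGradedCommutative.mul_mem_int (h𝒢 : IsGradedCommutative 𝒢) {i j : ℤ} {f g : B}
    (hf : f ∈ intDegree 𝒢 i) (hg : g ∈ intDegree 𝒢 j) : f * g ∈ intDegree 𝒢 (i + j) := by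
  rcases intDegree_cases hf with ⟨k, rfl, hk⟩ | rfl
  · rcases intDegree_cases hg with ⟨l, rfl, hl⟩ | rfl
    · exact mem_intDegree_of_mem (h𝒢.mul_mem hk hl) (by push_cast; rfl)
    · rw [mul_zero]; exact zero_mem _
  · rw [zero_mul]; exact zero_mem _

theorem IsGradedCommutative.mul_comm_int (h𝒢 : IsGradedCommutative 𝒢) {i j : ℤ} {f g : B}
    (hf : f ∈ intDegree 𝒢 i) (hg : g ∈ intDegree 𝒢 j) :
    f * g = ((i * j).negOnePow : ℤˣ) • (g * f) := by
  rcases intDegree_cases hf with ⟨k, rfl, hk⟩ | rfl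
  · rcases intDegree_cases hg with ⟨l, rfl, hl⟩ | rfl
    · exact h𝒢.mul_comm hk hl
    · simp
  · simp

theorem units_smul_mem {S : Submodule ℝ B} (u : ℤˣ) {f : B} (hf : f ∈ S) : u • f ∈ S := by
  rcases Int.units_eq_one_or u with rfl | rfl
  · simpa
  · simpa

namespace IsVectorField

variable {d d' : ℤ} {X Y : Module.End ℝ B}

theorem map_mem_int (hX : IsVectorField 𝒢 d X) {m : ℤ} {f : B} (hf : f ∈ intDegree 𝒢 m) :
    X f ∈ intDegree 𝒢 (m + d) := by
  rcases intDegree_cases hf with ⟨k, rfl, hk⟩ | rfl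
  · exact hX.map_mem k f hk
  · rw [map_zero]; exact zero_mem _

theorem leibniz_int (hX : IsVectorField 𝒢 d X) {m : ℤ} {f : B} (hf : f ∈ intDegree 𝒢 m) (g : B) :
    X (f * g) = X f * g + ((d * m).negOnePow : ℤˣ) • (f * X g) := by
  rcases intDegree_cases hf with ⟨k, rfl, hk⟩ | rfl
  · exact hX.leibniz k f hk g
  · simp

theorem zero : IsVectorField 𝒢 d (0 : Module.End ℝ B) :=
  ⟨fun _ _ _ => zero_mem _, fun _ _ _ _ => by simp⟩

theorem add (hX : IsVectorField 𝒢 d X) (hY : IsVectorField 𝒢 d Y) : IsVectorField 𝒢 d (X + Y) where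
  map_mem k f hf := add_mem (hX.map_mem k f hf) (hY.map_mem k f hf)
  leibniz k f hf g := by
    simp only [LinearMap.add_apply, hX.leibniz k f hf, hY.leibniz k f hf, add_mul, mul_add,
      smul_add]
    abel

theorem smul (c : ℝ) (hX : IsVectorField 𝒢 d X) : IsVectorField 𝒢 d (c • X) where
  map_mem k f hf := Submodule.smul_mem _ c (hX.map_mem k f hf)
  leibniz k f hf g := by
    simp only [LinearMap.smul_apply, hX.leibniz k f hf, smul_add, smul_mul_assoc, mul_smul_comm,
      smul_comm c]

theorem neg (hX : IsVectorField 𝒢 d X) : IsVectorField 𝒢 d (-X) := by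
  rw [← neg_one_smul ℝ X]; exact hX.smul (-1)

theorem units_smul (u : ℤˣ) (hX : IsVectorField 𝒢 d X) : IsVectorField 𝒢 d (u • X) := by
  rcases Int.units_eq_one_or u with rfl | rfl
  · simpa
  · simpa using hX.neg

theorem sum {α : Type*} (s : Finset α) {X : α → Module.End ℝ B}
    (hX : ∀ i ∈ s, IsVectorField 𝒢 d (X i)) : IsVectorField 𝒢 d (∑ i ∈ s, X i) := by
  classical
  induction s using Finset.induction_on with
  | empty => simpa using zero
  | insert a s ha ih =>
    rw [Finset.sum_insert ha]
    exact (hX a (Finset.mem_insert_self a s)).add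
      (ih fun i hi => hX i (Finset.mem_insert_of_mem hi))

theorem commutator (hX : IsVectorField 𝒢 d X) (hY : IsVectorField 𝒢 d' Y) :
    IsVectorField 𝒢 (d + d') (gradedCommutator d d' X Y) where
  map_mem k f hf := by
    refine sub_mem ?_ ?_
    · have := hX.map_mem_int (hY.map_mem k f hf)
      rwa [add_assoc, add_comm d'] at this
    · have := hY.map_mem_int (hX.map_mem k f hf)
      rw [add_assoc] at this
      exact units_smul_mem _ this
  leibniz k f hf g := by
    have hf' := mem_intDegree_of_mem hf rfl
    have e : ∀ (n : ℤ) (Z : Module.End ℝ B) (b : B), Z ((n.negOnePow : ℤˣ) • b)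
        = (n.negOnePow : ℤˣ) • Z b := fun n Z b => by
      rcases Int.units_eq_one_or n.negOnePow with h | h <;> simp [h]
    simp only [gradedCommutator, LinearMap.sub_apply, Module.End.mul_apply, LinearMap.smul_apply, e,
      hX.leibniz_int hf', hY.leibniz_int hf', map_add, hX.leibniz_int (hY.map_mem_int hf'),
      hY.leibniz_int (hX.map_mem_int hf')]
    simp only [Int.negOnePow_eq_ite, Int.even_mul,
      Int.even_add]
    by_cases hp : Even d <;> by_cases hq : Even d' <;> by_cases hr : Even (k : ℤ) <;>
    simp only [hp, hq, hr, if_true, if_false, one_smul, Units.neg_smul, or_true, or_false,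
      iff_true, iff_false, not_true, or_self, iff_self] <;>
    noncomm_ring

/-- Graded commutativity is what moves the coefficient `g` past the first factor in the Leibniz
rule. -/
theorem mulLeft_mul (h𝒢 : IsGradedCommutative 𝒢) {k : ℤ} {g : B} (hg : g ∈ intDegree 𝒢 k)
    (hX : IsVectorField 𝒢 d X) : IsVectorField 𝒢 (k + d) (LinearMap.mulLeft ℝ g * X) where
  map_mem m f hf := by
    have := h𝒢.mul_mem_int hg (hX.map_mem m f hf)
    rwa [show k + ((m : ℤ) + d) = m + (k + d) by ring] at this
  leibniz m f hf b := by
    have hf' := mem_intDegree_of_mem hf rfl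
    simp only [Module.End.mul_apply, LinearMap.mulLeft_apply, hX.leibniz_int hf', mul_add,
      mul_smul_comm, ← mul_assoc, h𝒢.mul_comm_int hg hf', smul_mul_assoc, smul_smul,
      ← Int.negOnePow_add]
    rw [show d * (m : ℤ) + k * m = (k + d) * m by ring]

end IsVectorField

/-- The Leibniz rule `[X, g Y] = X(g) Y ± g [X, Y]`. Only `X` has to be a derivation; in the mirror
statement `gradedCommutator_mulLeft_left` it is only `Y`. -/
theorem gradedCommutator_mulLeft_right {p q k s : ℤ} {X : Module.End ℝ B}
    (hX : IsVectorField 𝒢 p X) {g : B} (hg : g ∈ intDegree 𝒢 k) (hs : s = k + q)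
    (Y : Module.End ℝ B) :
    gradedCommutator p s X (LinearMap.mulLeft ℝ g * Y)
      = LinearMap.mulLeft ℝ (X g) * Y
        + ((p * k).negOnePow : ℤˣ) • (LinearMap.mulLeft ℝ g * gradedCommutator p q X Y) := by
  subst hs
  ext b
  have e : ∀ (n : ℤ) (a b : B), a * ((n.negOnePow : ℤˣ) • b)
        = (n.negOnePow : ℤˣ) • (a * b) := fun n a b => by
      rcases Int.units_eq_one_or n.negOnePow with h | h <;> simp [h]
  simp only [gradedCommutator, LinearMap.sub_apply, Module.End.mul_apply, LinearMap.smul_apply,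
    LinearMap.add_apply, LinearMap.mulLeft_apply, hX.leibniz_int hg, mul_sub, smul_sub, e,
    smul_smul, ← Int.negOnePow_add, mul_add, add_sub_assoc]

theorem gradedCommutator_mulLeft_left {p q k s : ℤ} {Y : Module.End ℝ B}
    (hY : IsVectorField 𝒢 q Y) {g : B} (hg : g ∈ intDegree 𝒢 k) (hs : s = k + p)
    (X : Module.End ℝ B) :
    gradedCommutator s q (LinearMap.mulLeft ℝ g * X) Y
      = LinearMap.mulLeft ℝ g * gradedCommutator p q X Y
        - ((s * q).negOnePow : ℤˣ) • (LinearMap.mulLeft ℝ (Y g) * X) := by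
  subst hs
  ext b
  simp only [gradedCommutator, LinearMap.sub_apply, Module.End.mul_apply, LinearMap.smul_apply,
    LinearMap.mulLeft_apply, hY.leibniz_int hg, mul_sub, smul_add]
  -- The sign `(k + p) q` of the commutator combines with the sign `q k` of `Y` passing `g`; the two
  -- contributions `k q` cancel modulo 2.
  have : ((p * q).negOnePow : ℤˣ) = ((k + p) * q).negOnePow * (q * k).negOnePow := by
    rw [← Int.negOnePow_add, show (k + p) * q + q * k = p * q + (2 * (q * k)) by ring,
      Int.negOnePow_add, Int.negOnePow_even (2 * (q * k)) (even_two_mul _), mul_one]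
  rw [this, mul_smul_comm, mul_smul]
  abel

end GradedOperators

/-! ### The exterior algebra: contraction and the number operator -/

section Exterior

variable {N : Type*} [AddCommGroup N] [Module ℝ N]

/-- A homogeneous element is a sum of products of vectors, so a statement additive in it need only
be propagated from scalars through left multiplication by one vector. The degree is an index of `P`
because signs depend on it. -/
theorem exteriorPower_induction {P : ℕ → ExteriorAlgebra ℝ N → Prop}
    (algebraMap : ∀ r : ℝ, P 0 (algebraMap ℝ _ r))
    (add : ∀ s x y, P s x → P s y → P s (x + y))
    (ι_mul : ∀ s v x, x ∈ ⋀[ℝ]^s N → P s x → P (s + 1) (ExteriorAlgebra.ι ℝ v * x)) :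
    ∀ s, ∀ x ∈ ⋀[ℝ]^s N, P s x := by
  intro s
  induction s with
  | zero =>
    intro x hx
    rw [ExteriorAlgebra.exteriorPower, pow_zero, Submodule.mem_one] at hx
    obtain ⟨r, rfl⟩ := hx
    exact algebraMap r
  | succ s ih =>
    intro x hx
    rw [ExteriorAlgebra.exteriorPower, pow_succ'] at hx
    induction hx using Submodule.mul_induction_on' with
    | mem_mul_mem v hv y hy =>
      obtain ⟨v, rfl⟩ := hv
      exact ι_mul s v y hy (ih y hy)
    | add x _ y _ hx hy => exact add _ x y hx hy

theorem ι_mem_exteriorPower (v : N) : ExteriorAlgebra.ι ℝ v ∈ ⋀[ℝ]^1 N := by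
  rw [ExteriorAlgebra.exteriorPower, pow_one]; exact ⟨v, rfl⟩

theorem one_mem_exteriorPower : (1 : ExteriorAlgebra ℝ N) ∈ ⋀[ℝ]^0 N := by
  rw [ExteriorAlgebra.exteriorPower, pow_zero]; exact Submodule.one_le.mp le_rfl

theorem mul_mem_exteriorPower {s t : ℕ} {x y : ExteriorAlgebra ℝ N} (hx : x ∈ ⋀[ℝ]^s N)
    (hy : y ∈ ⋀[ℝ]^t N) : x * y ∈ ⋀[ℝ]^(s + t) N := by
  rw [ExteriorAlgebra.exteriorPower, pow_add]; exact Submodule.mul_mem_mul hx hy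

theorem contractLeft_mem_intDegree (d : Module.Dual ℝ N) (s : ℕ) :
    ∀ x ∈ ⋀[ℝ]^s N, CliffordAlgebra.contractLeft (Q := (0 : QuadraticForm ℝ N)) d x
      ∈ intDegree (fun k : ℕ => ⋀[ℝ]^k N) (s + -1) := by
  refine exteriorPower_induction (P := fun s x => CliffordAlgebra.contractLeft
    (Q := (0 : QuadraticForm ℝ N)) d x ∈ intDegree (fun k : ℕ => ⋀[ℝ]^k N) (s + -1))
    (fun r => ?_) (fun s x y hx hy => ?_) (fun s v x hx ih => ?_) s
  · rw [CliffordAlgebra.contractLeft_algebraMap]; exact zero_mem _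
  · rw [map_add]; exact add_mem hx hy
  · rw [CliffordAlgebra.contractLeft_ι_mul]
    refine sub_mem (mem_intDegree_of_mem (k := s) (Submodule.smul_mem _ _ hx) (by push_cast; ring)) ?_
    rcases intDegree_cases ih with ⟨k, hk, h⟩ | h
    · refine mem_intDegree_of_mem (mul_mem_exteriorPower (ι_mem_exteriorPower v) h) ?_
      push_cast; linarith
    · rw [h, mul_zero]; exact zero_mem _

/-- The rule `d⌋(v x) = d(v) x - v (d⌋x)` for one vector gives the full antiderivation property,
each vector contributing one sign. -/
theorem contractLeft_mul (d : Module.Dual ℝ N) (s : ℕ) : ∀ x ∈ ⋀[ℝ]^s N, ∀ y : ExteriorAlgebra ℝ N,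
    CliffordAlgebra.contractLeft (Q := (0 : QuadraticForm ℝ N)) d (x * y)
      = CliffordAlgebra.contractLeft (Q := (0 : QuadraticForm ℝ N)) d x * y
        + ((s : ℤ).negOnePow : ℤˣ) •
          (x * CliffordAlgebra.contractLeft (Q := (0 : QuadraticForm ℝ N)) d y) := by
  refine exteriorPower_induction (P := fun s x => ∀ y : ExteriorAlgebra ℝ N,
    CliffordAlgebra.contractLeft (Q := (0 : QuadraticForm ℝ N)) d (x * y)
      = CliffordAlgebra.contractLeft (Q := (0 : QuadraticForm ℝ N)) d x * y
        + ((s : ℤ).negOnePow : ℤˣ) •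
          (x * CliffordAlgebra.contractLeft (Q := (0 : QuadraticForm ℝ N)) d y))
    (fun r y => ?_) (fun s x x' hx hx' y => ?_) (fun s v x hx ih y => ?_) s
  · rw [CliffordAlgebra.contractLeft_algebraMap_mul, CliffordAlgebra.contractLeft_algebraMap]
    simp
  · simp only [add_mul, map_add, hx, hx', smul_add]; abel
  · rw [mul_assoc, CliffordAlgebra.contractLeft_ι_mul, ih, CliffordAlgebra.contractLeft_ι_mul]
    push_cast
    rw [Int.negOnePow_succ]
    simp only [mul_add, sub_mul, Units.neg_smul, smul_mul_assoc, mul_assoc, mul_smul_comm]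
    abel

theorem ι_mul_comm (v : N) (t : ℕ) : ∀ y ∈ ⋀[ℝ]^t N,
    ExteriorAlgebra.ι ℝ v * y = ((t : ℤ).negOnePow : ℤˣ) • (y * ExteriorAlgebra.ι ℝ v) := by
  refine exteriorPower_induction (P := fun t y => ExteriorAlgebra.ι ℝ v * y
    = ((t : ℤ).negOnePow : ℤˣ) • (y * ExteriorAlgebra.ι ℝ v))
    (fun r => ?_) (fun s x y hx hy => ?_) (fun s w x hx ih => ?_) t
  · simp [Algebra.commutes]
  · rw [mul_add, hx, hy, add_mul, smul_add]
  · have h : ExteriorAlgebra.ι ℝ v * ExteriorAlgebra.ι ℝ w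
        = -(ExteriorAlgebra.ι ℝ w * ExteriorAlgebra.ι ℝ v) :=
      eq_neg_of_add_eq_zero_left (ExteriorAlgebra.ι_add_mul_swap v w)
    push_cast
    rw [← mul_assoc, h, neg_mul, mul_assoc, ih, Int.negOnePow_succ, Units.neg_smul, mul_smul_comm,
      mul_assoc]

theorem isGradedCommutative_exteriorPower :
    IsGradedCommutative (fun k : ℕ => ⋀[ℝ]^k N) where
  mul_mem := mul_mem_exteriorPower
  mul_comm {i j} x y hx hy := by
    revert x
    change ∀ {x}, x ∈ ⋀[ℝ]^i N → _
    intro x hx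
    refine exteriorPower_induction (P := fun i x => x * y
      = (((i : ℤ) * (j : ℤ)).negOnePow : ℤˣ) • (y * x))
      (fun r => ?_) (fun s x y hx hy => ?_) (fun s w x hx ih => ?_) i x hx
    · simp [Algebra.commutes]
    · rw [add_mul, hx, hy, mul_add, smul_add]
    · rw [mul_assoc, ih, mul_smul_comm, ← mul_assoc, ι_mul_comm w j y hy, smul_mul_assoc, smul_smul,
        ← Int.negOnePow_add, mul_assoc]
      push_cast
      rw [add_mul, one_mul]

/-- The odd half of Euler's identity. Passing from `x` to `v * x` adds `∑ v_i e_i = v` from the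
contraction of the new vector; in the other term `e_i` anticommutes past `v`, which cancels the sign
of the contraction. -/
theorem sum_ι_mul_contractLeft {ι : Type*} [Fintype ι] [DecidableEq ι] (s : ℕ) :
    ∀ x ∈ ⋀[ℝ]^s (ι → ℝ), ∑ i : ι, ExteriorAlgebra.ι ℝ (Pi.single i 1) *
      CliffordAlgebra.contractLeft (Q := (0 : QuadraticForm ℝ (ι → ℝ))) (LinearMap.proj i) x
        = (s : ℝ) • x := by
  refine exteriorPower_induction (P := fun s x => ∑ i : ι, ExteriorAlgebra.ι ℝ (Pi.single i 1) *
      CliffordAlgebra.contractLeft (Q := (0 : QuadraticForm ℝ (ι → ℝ))) (LinearMap.proj i) x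
        = (s : ℝ) • x)
    (fun r => ?_) (fun s x y hx hy => ?_) (fun s v x hx ih => ?_) s
  · simp [CliffordAlgebra.contractLeft_algebraMap]
  · simp only [map_add, mul_add, Finset.sum_add_distrib, hx, hy, smul_add]
  · have h : ∀ i, ExteriorAlgebra.ι ℝ (Pi.single i 1 : ι → ℝ) * (ExteriorAlgebra.ι ℝ v *
        CliffordAlgebra.contractLeft (Q := (0 : QuadraticForm ℝ (ι → ℝ))) (LinearMap.proj i) x)
        = -(ExteriorAlgebra.ι ℝ v * (ExteriorAlgebra.ι ℝ (Pi.single i 1) *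
        CliffordAlgebra.contractLeft (Q := (0 : QuadraticForm ℝ (ι → ℝ))) (LinearMap.proj i) x)) := by
      intro i
      rw [← mul_assoc, ← mul_assoc, eq_neg_of_add_eq_zero_left (ExteriorAlgebra.ι_add_mul_swap _ v),
        neg_mul]
    have hv : ∑ i, v i • (Pi.single i 1 : ι → ℝ) = v := by
      ext j; simp [Finset.sum_apply, Pi.single_apply]
    simp only [CliffordAlgebra.contractLeft_ι_mul, mul_sub, h, Finset.sum_sub_distrib,
      Finset.sum_neg_distrib, ← Finset.mul_sum, ih, mul_smul_comm, LinearMap.proj_apply]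
    simp only [← smul_mul_assoc, ← map_smul, ← Finset.sum_mul, ← map_sum, hv]
    rw [map_smul, map_smul, smul_mul_assoc, smul_mul_assoc]
    push_cast
    module

end Exterior

/-! ### The algebra of functions on `L[1] × 𝓜` -/

namespace TotalFunctions

open scoped TensorProduct

variable {C : Type*} [Ring C] [Algebra ℝ C] (𝒞 : ℕ → Submodule ℝ C) [GradedAlgebra 𝒞]
  {ι κ : Type*}

theorem mk_add_left (p q : MvPolynomial κ ℝ) (x : ExteriorAlgebra ℝ (ι → ℝ)) (f : C) :
    mk 𝒞 (p + q) x f = mk 𝒞 p x f + mk 𝒞 q x f := TensorProduct.add_tmul _ _ _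

theorem mk_add_mid (p : MvPolynomial κ ℝ) (x y : ExteriorAlgebra ℝ (ι → ℝ)) (f : C) :
    mk 𝒞 p (x + y) f = mk 𝒞 p x f + mk 𝒞 p y f := by
  unfold mk
  rw [← TensorProduct.tmul_add, ← map_add, ← TensorProduct.add_tmul]

theorem mk_add_right (p : MvPolynomial κ ℝ) (x : ExteriorAlgebra ℝ (ι → ℝ)) (f g : C) :
    mk 𝒞 p x (f + g) = mk 𝒞 p x f + mk 𝒞 p x g := by
  unfold mk
  rw [← TensorProduct.tmul_add, ← map_add, ← TensorProduct.tmul_add]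

theorem mk_smul_left (c : ℝ) (p : MvPolynomial κ ℝ) (x : ExteriorAlgebra ℝ (ι → ℝ)) (f : C) :
    mk 𝒞 (c • p) x f = c • mk 𝒞 p x f := TensorProduct.smul_tmul' _ _ _

theorem mk_smul_mid (c : ℝ) (p : MvPolynomial κ ℝ) (x : ExteriorAlgebra ℝ (ι → ℝ)) (f : C) :
    mk 𝒞 p (c • x) f = c • mk 𝒞 p x f := by
  unfold mk
  rw [← TensorProduct.tmul_smul, ← map_smul, TensorProduct.smul_tmul']

theorem mk_smul_right (c : ℝ) (p : MvPolynomial κ ℝ) (x : ExteriorAlgebra ℝ (ι → ℝ)) (f : C) :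
    mk 𝒞 p x (c • f) = c • mk 𝒞 p x f := by
  unfold mk
  rw [← TensorProduct.tmul_smul, ← map_smul, ← TensorProduct.tmul_smul]

/-- `mk` as a linear map in the last argument. -/
noncomputable def mkRight (p : MvPolynomial κ ℝ) (x : ExteriorAlgebra ℝ (ι → ℝ)) :
    C →ₗ[ℝ] TotalFunctions 𝒞 ι κ where
  toFun := mk 𝒞 p x
  map_add' := mk_add_right 𝒞 p x
  map_smul' c f := mk_smul_right 𝒞 c p x f

/-- `mk` as a linear map in the middle argument. -/
noncomputable def mkMid (p : MvPolynomial κ ℝ) (f : C) :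
    ExteriorAlgebra ℝ (ι → ℝ) →ₗ[ℝ] TotalFunctions 𝒞 ι κ where
  toFun x := mk 𝒞 p x f
  map_add' x y := mk_add_mid 𝒞 p x y f
  map_smul' c x := mk_smul_mid 𝒞 c p x f

/-- `mk` as a linear map in the first argument. -/
noncomputable def mkLeft (x : ExteriorAlgebra ℝ (ι → ℝ)) (f : C) :
    MvPolynomial κ ℝ →ₗ[ℝ] TotalFunctions 𝒞 ι κ where
  toFun p := mk 𝒞 p x f
  map_add' p q := mk_add_left 𝒞 p q x f
  map_smul' c p := mk_smul_left 𝒞 c p x f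

theorem mk_zero_left (x : ExteriorAlgebra ℝ (ι → ℝ)) (f : C) :
    mk 𝒞 (0 : MvPolynomial κ ℝ) x f = 0 := (mkLeft 𝒞 x f).map_zero

theorem mk_zero_mid (p : MvPolynomial κ ℝ) (f : C) :
    mk 𝒞 p (0 : ExteriorAlgebra ℝ (ι → ℝ)) f = 0 := (mkMid 𝒞 p f).map_zero

theorem mk_zero_right (p : MvPolynomial κ ℝ) (x : ExteriorAlgebra ℝ (ι → ℝ)) :
    mk 𝒞 p x 0 = 0 := (mkRight 𝒞 p x).map_zero

theorem mk_units_smul_mid (u : ℤˣ) (p : MvPolynomial κ ℝ) (x : ExteriorAlgebra ℝ (ι → ℝ)) (f : C) :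
    mk 𝒞 p (u • x) f = u • mk 𝒞 p x f := by
  rcases Int.units_eq_one_or u with rfl | rfl
  · simp
  · rw [Units.neg_smul, Units.neg_smul, one_smul, one_smul]; exact (mkMid 𝒞 p f).map_neg x

theorem mk_units_smul_right (u : ℤˣ) (p : MvPolynomial κ ℝ) (x : ExteriorAlgebra ℝ (ι → ℝ)) (f : C) :
    mk 𝒞 p x (u • f) = u • mk 𝒞 p x f := by
  rcases Int.units_eq_one_or u with rfl | rfl
  · simp
  · rw [Units.neg_smul, Units.neg_smul, one_smul, one_smul]; exact (mkRight 𝒞 p x).map_neg f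

/-- The only sign comes from moving `f` past `y`, since the `P^α` are even. Hence only these two
inner factors have to be homogeneous. -/
theorem mk_mul_mk (p q : MvPolynomial κ ℝ) (x : ExteriorAlgebra ℝ (ι → ℝ)) (g : C)
    {k s : ℤ} {f : C} {y : ExteriorAlgebra ℝ (ι → ℝ)} (hf : f ∈ intDegree 𝒞 k)
    (hy : y ∈ intDegree (fun k : ℕ => ⋀[ℝ]^k (ι → ℝ)) s) :
    mk 𝒞 p x f * mk 𝒞 q y g
      = ((k * s).negOnePow : ℤˣ) • mk 𝒞 (p * q) (x * y) (f * g) := by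
  rcases intDegree_cases hf with ⟨k, rfl, hf'⟩ | rfl
  · rcases intDegree_cases hy with ⟨s, rfl, hy'⟩ | rfl
    · have h := GradedTensorProduct.tmul_coe_mul_coe_tmul (R := ℝ)
        (fun k : ℕ => ⋀[ℝ]^k (ι → ℝ)) 𝒞 x ⟨f, hf'⟩ ⟨y, hy'⟩ g
      unfold mk
      rw [Algebra.TensorProduct.tmul_mul_tmul, h]
      have e : ((k : ℤ) * (s : ℤ)).negOnePow = (-1 : ℤˣ) ^ (k * s) := by
        rw [← Nat.cast_mul]; rfl
      rw [e]
      rcases neg_one_pow_eq_or ℤˣ (k * s) with h | h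
      · rw [h, one_smul, one_smul]
      · rw [h, Units.neg_smul, Units.neg_smul, one_smul, one_smul, TensorProduct.tmul_neg]
    · simp [mk_zero_mid]
  · simp [mk_zero_right]

theorem mapEnd_mk (S : Module.End ℝ (MvPolynomial κ ℝ))
    (T : Module.End ℝ (ExteriorAlgebra ℝ (ι → ℝ))) (X : Module.End ℝ C) (p : MvPolynomial κ ℝ)
    (x : ExteriorAlgebra ℝ (ι → ℝ)) (f : C) :
    mapEnd 𝒞 S T X (mk 𝒞 p x f) = mk 𝒞 (S p) (T x) (X f) := rfl

theorem mk_mem_degree {r s k m : ℕ} {p : MvPolynomial κ ℝ} {x : ExteriorAlgebra ℝ (ι → ℝ)} {f : C}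
    (hp : p.IsHomogeneous r) (hx : x ∈ ⋀[ℝ]^s (ι → ℝ)) (hf : f ∈ 𝒞 k) (hm : 2 * r + s + k = m) :
    mk 𝒞 p x f ∈ degree 𝒞 (ι := ι) (κ := κ) m :=
  Submodule.subset_span ⟨r, s, k, p, x, f, hp, hx, hf, hm, rfl⟩

theorem mk_mem_fiberPolynomials {r s m : ℕ} {p : MvPolynomial κ ℝ}
    {x : ExteriorAlgebra ℝ (ι → ℝ)} {f : C}
    (hp : p.IsHomogeneous r) (hx : x ∈ ⋀[ℝ]^s (ι → ℝ)) (hm : r + s = m) :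
    mk 𝒞 p x f ∈ fiberPolynomials 𝒞 (ι := ι) (κ := κ) m :=
  Submodule.subset_span ⟨r, s, p, x, f, hp, hx, hm, rfl⟩

theorem degree_induction {m : ℕ} {P : TotalFunctions 𝒞 ι κ → Prop}
    (mem : ∀ (r s k : ℕ) (p : MvPolynomial κ ℝ) (x : ExteriorAlgebra ℝ (ι → ℝ)) (f : C),
      p.IsHomogeneous r → x ∈ ⋀[ℝ]^s (ι → ℝ) → f ∈ 𝒞 k → 2 * r + s + k = m → P (mk 𝒞 p x f))
    (zero : P 0) (add : ∀ a b, P a → P b → P (a + b)) (smul : ∀ (c : ℝ) a, P a → P (c • a))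
    {b : TotalFunctions 𝒞 ι κ} (hb : b ∈ degree 𝒞 m) : P b := by
  induction hb using Submodule.span_induction with
  | mem b hb =>
    obtain ⟨r, s, k, p, x, f, hp, hx, hf, hm, rfl⟩ := hb
    exact mem r s k p x f hp hx hf hm
  | zero => exact zero
  | add a b _ _ ha hb => exact add a b ha hb
  | smul c a _ ha => exact smul c a ha

theorem fiberPolynomials_induction {m : ℕ} {P : TotalFunctions 𝒞 ι κ → Prop}
    (mem : ∀ (r s : ℕ) (p : MvPolynomial κ ℝ) (x : ExteriorAlgebra ℝ (ι → ℝ)) (f : C),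
      p.IsHomogeneous r → x ∈ ⋀[ℝ]^s (ι → ℝ) → r + s = m → P (mk 𝒞 p x f))
    (zero : P 0) (add : ∀ a b, P a → P b → P (a + b)) (smul : ∀ (c : ℝ) a, P a → P (c • a))
    {b : TotalFunctions 𝒞 ι κ} (hb : b ∈ fiberPolynomials 𝒞 m) : P b := by
  induction hb using Submodule.span_induction with
  | mem b hb =>
    obtain ⟨r, s, p, x, f, hp, hx, hm, rfl⟩ := hb
    exact mem r s p x f hp hx hm
  | zero => exact zero
  | add a b _ _ ha hb => exact add a b ha hb
  | smul c a _ ha => exact smul c a ha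

/-- Every function is a sum of products of homogeneous functions. -/
theorem total_induction {P : TotalFunctions 𝒞 ι κ → Prop}
    (mem : ∀ (r s k : ℕ) (p : MvPolynomial κ ℝ) (x : ExteriorAlgebra ℝ (ι → ℝ)) (f : C),
      p.IsHomogeneous r → x ∈ ⋀[ℝ]^s (ι → ℝ) → f ∈ 𝒞 k → P (mk 𝒞 p x f))
    (zero : P 0) (add : ∀ a b, P a → P b → P (a + b)) (b : TotalFunctions 𝒞 ι κ) : P b := by
  have hmk : ∀ p x f, P (mk 𝒞 p x f) := by
    intro p x f
    induction p using MvPolynomial.induction_on' with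
    | add p q hp hq => rw [mk_add_left]; exact add _ _ hp hq
    | monomial u a =>
      induction x using DirectSum.Decomposition.inductionOn (fun k : ℕ => ⋀[ℝ]^k (ι → ℝ)) with
      | zero => rw [mk_zero_mid]; exact zero
      | add x y hx hy => rw [mk_add_mid]; exact add _ _ hx hy
      | @homogeneous s x =>
        induction f using DirectSum.Decomposition.inductionOn 𝒞 with
        | zero => rw [mk_zero_right]; exact zero
        | add x y hx hy => rw [mk_add_right]; exact add _ _ hx hy
        | @homogeneous k f =>
          exact mem u.degree s k _ _ _ (MvPolynomial.isHomogeneous_monomial a rfl) x.2 f.2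
  induction b using TensorProduct.induction_on with
  | zero => exact zero
  | add a b ha hb => exact add a b ha hb
  | tmul p y =>
    have : ∀ y : ExteriorAlgebra ℝ (ι → ℝ) ⊗[ℝ] C, P (p ⊗ₜ[ℝ]
      (GradedTensorProduct.of ℝ (fun k : ℕ => ⋀[ℝ]^k (ι → ℝ)) 𝒞 y)) := by
      intro y
      induction y using TensorProduct.induction_on with
      | zero => rw [map_zero, TensorProduct.tmul_zero]; exact zero
      | add a b ha hb => rw [map_add, TensorProduct.tmul_add]; exact add _ _ ha hb
      | tmul x f => exact hmk p x f
    exact this y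

end TotalFunctions

/-! ### Gradings, base functions and lifted fields -/

theorem signTwist_apply_of_mem {B : Type*} [Ring B] [Algebra ℝ B] (𝒢 : ℕ → Submodule ℝ B)
    [GradedAlgebra 𝒢] (d : ℤ) {k : ℤ} {f : B} (hf : f ∈ intDegree 𝒢 k) :
    signTwist 𝒢 d f = ((d * k).negOnePow : ℤˣ) • f := by
  rcases intDegree_cases hf with ⟨k, rfl, hf'⟩ | rfl
  · simp only [signTwist, LinearMap.comp_apply, LinearEquiv.coe_coe,
      DirectSum.decomposeLinearEquiv_apply]
    rw [DirectSum.decompose_of_mem 𝒢 hf', ← DirectSum.lof_eq_of ℝ, DirectSum.toModule_lof]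
    rfl
  · simp

theorem Module.End.map_units_smul {V : Type*} [AddCommGroup V] [Module ℝ V] (X : Module.End ℝ V)
    (u : ℤˣ) (b : V) : X (u • b) = u • X b := by
  rcases Int.units_eq_one_or u with rfl | rfl <;> simp

theorem real_smul_units_smul {V : Type*} [AddCommGroup V] [Module ℝ V] (c : ℝ) (u : ℤˣ) (b : V) :
    c • u • b = u • c • b := by
  rcases Int.units_eq_one_or u with rfl | rfl <;> simp

namespace TotalFunctions

open scoped TensorProduct

variable {C : Type*} [Ring C] [Algebra ℝ C] (𝒞 : ℕ → Submodule ℝ C) [GradedAlgebra 𝒞]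
  {ι κ : Type*}

variable {𝒞} in
theorem isGradedCommutative_degree (h𝒞 : IsGradedCommutative 𝒞) :
    IsGradedCommutative (degree 𝒞 (ι := ι) (κ := κ)) where
  mul_mem {i j} a b ha hb := by
    refine degree_induction 𝒞 (P := fun a => a * b ∈ degree 𝒞 (i + j)) ?_ (by simp)
      (fun a a' h h' => by rw [add_mul]; exact add_mem h h')
      (fun c a h => by rw [smul_mul_assoc]; exact Submodule.smul_mem _ c h) ha
    intro r s k p x f hp hx hf hm
    refine degree_induction 𝒞 (P := fun b => mk 𝒞 p x f * b ∈ degree 𝒞 (i + j)) ?_ (by simp)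
      (fun a a' h h' => by rw [mul_add]; exact add_mem h h')
      (fun c a h => by rw [mul_smul_comm]; exact Submodule.smul_mem _ c h) hb
    intro r' s' k' q y g hq hy hg hm'
    rw [mk_mul_mk 𝒞 p q x g (mem_intDegree_of_mem hf rfl) (mem_intDegree_of_mem hy rfl)]
    exact units_smul_mem _ (mk_mem_degree 𝒞 (hp.mul hq) (mul_mem_exteriorPower hx hy)
      (h𝒞.mul_mem hf hg) (by omega))
  mul_comm {i j} a b ha hb := by
    refine degree_induction 𝒞 (P := fun a => a * b = (((i : ℤ) * (j : ℤ)).negOnePow : ℤˣ) • (b * a))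
      ?_ (by simp) (fun a a' h h' => by rw [add_mul, h, h', mul_add, smul_add])
      (fun c a h => by rw [smul_mul_assoc, h, mul_smul_comm, real_smul_units_smul]) ha
    intro r s k p x f hp hx hf hm
    refine degree_induction 𝒞 (P := fun b => mk 𝒞 p x f * b
        = (((i : ℤ) * (j : ℤ)).negOnePow : ℤˣ) • (b * mk 𝒞 p x f))
      ?_ (by simp) (fun a a' h h' => by rw [mul_add, h, h', add_mul, smul_add])
      (fun c a h => by rw [mul_smul_comm, h, smul_mul_assoc, real_smul_units_smul]) hb
    intro r' s' k' q y g hq hy hg hm'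
    rw [mk_mul_mk 𝒞 p q x g (mem_intDegree_of_mem hf rfl) (mem_intDegree_of_mem hy rfl),
      mk_mul_mk 𝒞 q p y f (mem_intDegree_of_mem hg rfl) (mem_intDegree_of_mem hx rfl),
      h𝒞.mul_comm hf hg, isGradedCommutative_exteriorPower.mul_comm hx hy, mul_comm q p,
      mk_units_smul_mid, mk_units_smul_right, smul_smul, smul_smul, smul_smul]
    -- What remains is an equality of signs. The even contributions `2 * r` of the polynomial parts
    -- drop out, leaving the parities of the four odd-type degrees.
    congr 1
    subst hm hm'
    simp only [Int.negOnePow_eq_ite]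
    push_cast
    simp only [Int.even_mul, Int.even_add, even_two, true_or, true_iff]
    by_cases h1 : Even (s : ℤ) <;> by_cases h2 : Even (k : ℤ) <;> by_cases h3 : Even (s' : ℤ) <;>
      by_cases h4 : Even (k' : ℤ) <;> simp [h1, h2, h3, h4]

theorem mk_mem_intDegree {r : ℕ} {s k m : ℤ} {p : MvPolynomial κ ℝ}
    {x : ExteriorAlgebra ℝ (ι → ℝ)} {f : C}
    (hp : p.IsHomogeneous r) (hx : x ∈ intDegree (fun k : ℕ => ⋀[ℝ]^k (ι → ℝ)) s)
    (hf : f ∈ intDegree 𝒞 k) (hm : m = 2 * r + s + k) :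
    mk 𝒞 p x f ∈ intDegree (degree 𝒞 (ι := ι) (κ := κ)) m := by
  rcases intDegree_cases hf with ⟨k, rfl, hf'⟩ | rfl
  · rcases intDegree_cases hx with ⟨s, rfl, hx'⟩ | rfl
    · exact mem_intDegree_of_mem (mk_mem_degree 𝒞 hp hx' hf' rfl) (by rw [hm]; push_cast; rfl)
    · rw [mk_zero_mid]; exact zero_mem _
  · rw [mk_zero_right]; exact zero_mem _

theorem ofBase_mem {k : ℤ} {f : C} (hf : f ∈ intDegree 𝒞 k) :
    (ofBase 𝒞 f : TotalFunctions 𝒞 ι κ) ∈ intDegree (degree 𝒞) k :=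
  mk_mem_intDegree 𝒞 (MvPolynomial.isHomogeneous_one κ ℝ)
    (mem_intDegree_of_mem one_mem_exteriorPower rfl) hf (by simp)

theorem one_mem_base : (1 : C) ∈ 𝒞 0 := SetLike.GradedOne.one_mem

theorem one_mem_ext : (1 : ExteriorAlgebra ℝ (ι → ℝ)) ∈
    intDegree (fun k : ℕ => ⋀[ℝ]^k (ι → ℝ)) 0 :=
  mem_intDegree_of_mem one_mem_exteriorPower rfl

/-- `ofBase` as a linear map. -/
noncomputable def ofBaseₗ : C →ₗ[ℝ] TotalFunctions 𝒞 ι κ := mkRight 𝒞 1 1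

theorem ofBase_add (f g : C) :
    (ofBase 𝒞 (f + g) : TotalFunctions 𝒞 ι κ) = ofBase 𝒞 f + ofBase 𝒞 g := map_add (ofBaseₗ 𝒞) f g

theorem ofBase_zero : (ofBase 𝒞 0 : TotalFunctions 𝒞 ι κ) = 0 := map_zero (ofBaseₗ 𝒞)

theorem mk_mul_ofBase (p : MvPolynomial κ ℝ) (x : ExteriorAlgebra ℝ (ι → ℝ)) {f : C} (g : C)
    : mk 𝒞 p x f * ofBase 𝒞 g = mk 𝒞 p x (f * g) := by
  induction f using DirectSum.Decomposition.inductionOn 𝒞 with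
  | zero => simp [mk_zero_right]
  | add f f' h h' => rw [mk_add_right, add_mul, h, h', add_mul, mk_add_right]
  | @homogeneous k f =>
    unfold ofBase
    rw [mk_mul_mk 𝒞 p 1 x g (mem_intDegree_of_mem f.2 rfl) one_mem_ext]
    simp

theorem ofBase_mul (f g : C) :
    (ofBase 𝒞 (f * g) : TotalFunctions 𝒞 ι κ) = ofBase 𝒞 f * ofBase 𝒞 g := by
  rw [ofBase, ofBase, mk_mul_ofBase]

/-- Restriction to the zero section is a left inverse: evaluate the polynomial at `P = 0` and
project the exterior algebra to its scalars. -/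
theorem ofBase_injective :
    Function.Injective (ofBase 𝒞 : C → TotalFunctions 𝒞 ι κ) := by
  have h : Function.LeftInverse
      ((TensorProduct.lid ℝ C).toLinearMap ∘ₗ TensorProduct.map
        (MvPolynomial.aeval (R := ℝ) (fun _ : κ => (0 : ℝ))).toLinearMap
        ((TensorProduct.lid ℝ C).toLinearMap ∘ₗ TensorProduct.map
          (ExteriorAlgebra.algebraMapInv (R := ℝ) (M := ι → ℝ)).toLinearMap LinearMap.id ∘ₗ
          (GradedTensorProduct.of ℝ (fun k : ℕ => ⋀[ℝ]^k (ι → ℝ)) 𝒞).symm.toLinearMap))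
      (ofBase 𝒞 : C → TotalFunctions 𝒞 ι κ) := by
    intro f
    simp [ofBase, mk]
  exact h.injective

theorem ofBase_mem_fiberPolynomials (f : C) :
    (ofBase 𝒞 f : TotalFunctions 𝒞 ι κ) ∈ fiberPolynomials 𝒞 0 :=
  mk_mem_fiberPolynomials 𝒞 (MvPolynomial.isHomogeneous_one κ ℝ) one_mem_exteriorPower rfl

theorem exists_ofBase {b : TotalFunctions 𝒞 ι κ} (hb : b ∈ fiberPolynomials 𝒞 0) :
    ∃ f, b = ofBase 𝒞 f := by
  refine fiberPolynomials_induction 𝒞 (P := fun b => ∃ f, b = ofBase 𝒞 f) ?_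
    ⟨0, (ofBase_zero 𝒞).symm⟩ ?_ ?_ hb
  · intro r s p x f hp hx h
    obtain ⟨rfl, rfl⟩ : r = 0 ∧ s = 0 := by omega
    rw [← MvPolynomial.totalDegree_zero_iff_isHomogeneous,
      MvPolynomial.totalDegree_eq_zero_iff_eq_C] at hp
    rw [ExteriorAlgebra.exteriorPower, pow_zero, Submodule.mem_one] at hx
    obtain ⟨c, rfl⟩ := hx
    refine ⟨MvPolynomial.coeff 0 p • c • f, ?_⟩
    rw [hp, ofBase, mk_smul_right, mk_smul_right, Algebra.algebraMap_eq_smul_one, mk_smul_mid,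
      MvPolynomial.C_eq_smul_one, mk_smul_left]
    simp [smul_comm c]
  · rintro _ _ ⟨f, rfl⟩ ⟨g, rfl⟩
    exact ⟨f + g, (ofBase_add 𝒞 f g).symm⟩
  · rintro c _ ⟨f, rfl⟩
    exact ⟨c • f, (map_smul (ofBaseₗ 𝒞) c f).symm⟩

theorem iSup_fiberPolynomials : ⨆ m, fiberPolynomials 𝒞 (ι := ι) (κ := κ) m = ⊤ := by
  rw [eq_top_iff]
  intro b _
  refine total_induction 𝒞 (P := fun b => b ∈ ⨆ m, fiberPolynomials 𝒞 m) ?_ (zero_mem _)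
    (fun a b ha hb => add_mem ha hb) b
  intro r s k p x f hp hx _
  exact Submodule.mem_iSup_of_mem (r + s) (mk_mem_fiberPolynomials 𝒞 hp hx rfl)

theorem end_ext {X Y : Module.End ℝ (TotalFunctions 𝒞 ι κ)}
    (h : ∀ (r s k : ℕ) (p : MvPolynomial κ ℝ) (x : ExteriorAlgebra ℝ (ι → ℝ)) (f : C),
      p.IsHomogeneous r → x ∈ ⋀[ℝ]^s (ι → ℝ) → f ∈ 𝒞 k → X (mk 𝒞 p x f) = Y (mk 𝒞 p x f)) :
    X = Y :=
  LinearMap.ext fun b => total_induction 𝒞 (P := fun b => X b = Y b) h (by simp)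
    (fun a b ha hb => by rw [map_add, map_add, ha, hb]) b

/-- To check that an endomorphism is a vector field, it suffices to consider products of
homogeneous functions. -/
theorem isVectorField_of_mk {d : ℤ} {X : Module.End ℝ (TotalFunctions 𝒞 ι κ)}
    (hmem : ∀ (r s k : ℕ) (p : MvPolynomial κ ℝ) (x : ExteriorAlgebra ℝ (ι → ℝ)) (f : C),
      p.IsHomogeneous r → x ∈ ⋀[ℝ]^s (ι → ℝ) → f ∈ 𝒞 k →
        X (mk 𝒞 p x f) ∈ intDegree (degree 𝒞) (2 * r + s + k + d))
    (hmul : ∀ (r s k r' s' k' : ℕ) (p q : MvPolynomial κ ℝ) (x y : ExteriorAlgebra ℝ (ι → ℝ))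
      (f g : C), p.IsHomogeneous r → x ∈ ⋀[ℝ]^s (ι → ℝ) → f ∈ 𝒞 k →
        q.IsHomogeneous r' → y ∈ ⋀[ℝ]^s' (ι → ℝ) → g ∈ 𝒞 k' →
        X (mk 𝒞 p x f * mk 𝒞 q y g) = X (mk 𝒞 p x f) * mk 𝒞 q y g
          + ((d * (s + k)).negOnePow : ℤˣ) • (mk 𝒞 p x f * X (mk 𝒞 q y g))) :
    IsVectorField (degree 𝒞) d X where
  map_mem m b hb := by
    refine degree_induction 𝒞 (P := fun b => X b ∈ intDegree (degree 𝒞) (m + d)) ?_ (by simp)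
      (fun a a' h h' => by rw [map_add]; exact add_mem h h')
      (fun c a h => by rw [map_smul]; exact Submodule.smul_mem _ c h) hb
    intro r s k p x f hp hx hf hm
    have := hmem r s k p x f hp hx hf
    rw [← hm]
    push_cast
    exact this
  leibniz m b hb c := by
    refine degree_induction 𝒞 (P := fun b => X (b * c) = X b * c
        + ((d * m).negOnePow : ℤˣ) • (b * X c)) ?_ (by simp)
      (fun a a' h h' => by simp only [add_mul, map_add, h, h', smul_add]; abel)
      (fun c a h => by
        simp only [smul_mul_assoc, map_smul, h, smul_add]
        rw [real_smul_units_smul]) hb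
    intro r s k p x f hp hx hf hm
    refine total_induction 𝒞 (P := fun c => X (mk 𝒞 p x f * c) = X (mk 𝒞 p x f) * c
        + ((d * m).negOnePow : ℤˣ) • (mk 𝒞 p x f * X c)) ?_ (by simp)
      (fun a a' h h' => by simp only [mul_add, map_add, h, h', smul_add]; abel) c
    intro r' s' k' q y g hq hy hg
    rw [hmul r s k r' s' k' p q x y f g hp hx hf hq hy hg]
    congr 2
    -- The full degree is `2 * r + s + k`. The hypothesis on products may use `s + k`, because `P`
    -- has even degree.
    rw [← hm, Int.negOnePow_eq_ite, Int.negOnePow_eq_ite]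
    push_cast
    simp [Int.even_mul, Int.even_add]

theorem signTwist_mem_ext {d s : ℤ} {x : ExteriorAlgebra ℝ (ι → ℝ)}
    (hx : x ∈ intDegree (fun k : ℕ => ⋀[ℝ]^k (ι → ℝ)) s) (p : MvPolynomial κ ℝ) (f : C) :
    mk 𝒞 p (signTwist (fun k : ℕ => ⋀[ℝ]^k (ι → ℝ)) d x) f
      = ((d * s).negOnePow : ℤˣ) • mk 𝒞 p x f := by
  rw [signTwist_apply_of_mem _ d hx, mk_units_smul_mid]

theorem ofBaseField_mk (d : ℤ) (X : Module.End ℝ C) {s : ℤ} {x : ExteriorAlgebra ℝ (ι → ℝ)}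
    (hx : x ∈ intDegree (fun k : ℕ => ⋀[ℝ]^k (ι → ℝ)) s) (p : MvPolynomial κ ℝ) (f : C) :
    ofBaseField 𝒞 d X (mk 𝒞 p x f) = ((d * s).negOnePow : ℤˣ) • mk 𝒞 p x (X f) := by
  rw [ofBaseField, mapEnd_mk, signTwist_mem_ext 𝒞 hx]
  rfl

theorem ofBaseField_ofBase (d : ℤ) (X : Module.End ℝ C) (f : C) :
    ofBaseField 𝒞 d X (ofBase 𝒞 f : TotalFunctions 𝒞 ι κ) = ofBase 𝒞 (X f) := by
  rw [ofBase, ofBaseField_mk 𝒞 d X one_mem_ext]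
  simp [ofBase]

/-- The factor `(-1)^(d * s)` is the Koszul sign of `X` passing the `η`-part. With it the signs from
reordering `f` and `y` agree with those of the graded Leibniz rule. -/
theorem isVectorField_ofBaseField {d : ℤ} {X : Module.End ℝ C} (hX : IsVectorField 𝒞 d X) :
    IsVectorField (degree 𝒞) d (ofBaseField 𝒞 d X : Module.End ℝ (TotalFunctions 𝒞 ι κ)) := by
  refine isVectorField_of_mk 𝒞 ?_ ?_
  · intro r s k p x f hp hx hf
    have hx' := mem_intDegree_of_mem (𝒢 := fun k : ℕ => ⋀[ℝ]^k (ι → ℝ)) hx rfl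
    rw [ofBaseField_mk 𝒞 d X hx']
    exact units_smul_mem _ (mk_mem_intDegree 𝒞 hp hx' (hX.map_mem k f hf) (by ring))
  · intro r s k r' s' k' p q x y f g hp hx hf hq hy hg
    have hx' := mem_intDegree_of_mem (𝒢 := fun k : ℕ => ⋀[ℝ]^k (ι → ℝ)) hx rfl
    have hy' := mem_intDegree_of_mem (𝒢 := fun k : ℕ => ⋀[ℝ]^k (ι → ℝ)) hy rfl
    have hxy := mem_intDegree_of_mem (𝒢 := fun k : ℕ => ⋀[ℝ]^k (ι → ℝ))
      (mul_mem_exteriorPower hx hy) rfl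
    have hf' := mem_intDegree_of_mem hf rfl
    rw [mk_mul_mk 𝒞 p q x g hf' hy', Module.End.map_units_smul, ofBaseField_mk 𝒞 d X hxy,
      ofBaseField_mk 𝒞 d X hx', ofBaseField_mk 𝒞 d X hy', hX.leibniz k f hf, smul_mul_assoc,
      mul_smul_comm, mk_mul_mk 𝒞 p q x g (hX.map_mem k f hf) hy', mk_mul_mk 𝒞 p q x (X g) hf' hy',
      mk_add_right, mk_units_smul_right, smul_add, smul_add]
    simp only [smul_smul, Int.negOnePow_eq_ite]
    push_cast
    simp only [Int.even_mul, Int.even_add]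
    congr 2
    · by_cases h1 : Even (s : ℤ) <;> by_cases h2 : Even (k : ℤ) <;> by_cases h3 : Even (s' : ℤ) <;>
        by_cases h4 : Even d <;> simp [h1, h2, h3, h4]
    · by_cases h1 : Even (s : ℤ) <;> by_cases h2 : Even (k : ℤ) <;> by_cases h3 : Even (s' : ℤ) <;>
        by_cases h4 : Even d <;> simp [h1, h2, h3, h4]

end TotalFunctions

/-! ### Coordinates and partial derivatives on the fibers -/

namespace TotalFunctions

open scoped TensorProduct

variable {C : Type*} [Ring C] [Algebra ℝ C] (𝒞 : ℕ → Submodule ℝ C) [GradedAlgebra 𝒞]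
  {ι κ : Type*}

theorem partialDeriv_inl_mk (i : ι) (p : MvPolynomial κ ℝ) (x : ExteriorAlgebra ℝ (ι → ℝ)) (f : C) :
    partialDeriv 𝒞 (Sum.inl i) (mk 𝒞 p x f) = mk 𝒞 p
      (CliffordAlgebra.contractLeft (Q := (0 : QuadraticForm ℝ (ι → ℝ))) (LinearMap.proj i) x) f :=
  rfl

theorem partialDeriv_inr_mk (α : κ) (p : MvPolynomial κ ℝ) (x : ExteriorAlgebra ℝ (ι → ℝ)) (f : C) :
    partialDeriv 𝒞 (Sum.inr α) (mk 𝒞 p x f) = mk 𝒞 (MvPolynomial.pderiv α p) x f :=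
  rfl

theorem isVectorField_partialDeriv (j : ι ⊕ κ) :
    IsVectorField (degree 𝒞) (fiberDegree j - 1) (partialDeriv 𝒞 j) := by
  refine isVectorField_of_mk 𝒞 ?_ ?_
  · intro r s k p x f hp hx hf
    have hf' := mem_intDegree_of_mem hf rfl
    rcases j with i | α
    · rw [partialDeriv_inl_mk]
      exact mk_mem_intDegree 𝒞 hp (contractLeft_mem_intDegree _ s x hx) hf'
        (by simp [fiberDegree]; ring)
    · rw [partialDeriv_inr_mk]
      have hx' := mem_intDegree_of_mem (𝒢 := fun k : ℕ => ⋀[ℝ]^k (ι → ℝ)) hx rfl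
      -- For `r = 0` the derivative vanishes. This case is separate because truncated subtraction
      -- would otherwise assign it polynomial degree `0` instead of `-1`.
      rcases r with _ | r
      · rw [← MvPolynomial.totalDegree_zero_iff_isHomogeneous,
          MvPolynomial.totalDegree_eq_zero_iff_eq_C] at hp
        rw [hp, MvPolynomial.pderiv_C, mk_zero_left]
        exact zero_mem _
      · exact mk_mem_intDegree 𝒞 hp.pderiv hx' hf' (by simp [fiberDegree]; ring)
  · intro r s k r' s' k' p q x y f g hp hx hf hq hy hg
    have hx' := mem_intDegree_of_mem (𝒢 := fun k : ℕ => ⋀[ℝ]^k (ι → ℝ)) hx rfl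
    have hy' := mem_intDegree_of_mem (𝒢 := fun k : ℕ => ⋀[ℝ]^k (ι → ℝ)) hy rfl
    have hf' := mem_intDegree_of_mem hf rfl
    rw [mk_mul_mk 𝒞 p q x g hf' hy', Module.End.map_units_smul]
    rcases j with i | α
    · simp only [partialDeriv_inl_mk]
      rw [contractLeft_mul _ s x hx, mk_mul_mk 𝒞 p q _ g hf' hy',
        mk_mul_mk 𝒞 p q x g hf' (contractLeft_mem_intDegree _ s' y hy), mk_add_mid,
        mk_units_smul_mid, smul_add]
      simp only [smul_smul, Int.negOnePow_eq_ite, fiberDegree]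
      simp only [Sum.elim_inl, Int.even_mul, Int.even_add]
      congr 2
      by_cases h1 : Even (s : ℤ) <;> by_cases h2 : Even (k : ℤ) <;> by_cases h3 : Even (s' : ℤ) <;>
        simp [h1, h2, h3]
    · simp only [partialDeriv_inr_mk, fiberDegree, Sum.elim_inr]
      rw [Derivation.leibniz, mk_mul_mk 𝒞 _ q x g hf' hy', mk_mul_mk 𝒞 p _ x g hf' hy',
        Int.negOnePow_even ((-1 - 1) * _) (Even.mul_right (by decide) _), one_smul, mk_add_left,
        smul_add, add_comm, smul_eq_mul, smul_eq_mul, mul_comm q]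

theorem coord_mem [DecidableEq ι] (j : ι ⊕ κ) : coord 𝒞 j ∈ intDegree (degree 𝒞) (1 - fiberDegree j) := by
  rcases j with i | α
  · exact mk_mem_intDegree 𝒞 (MvPolynomial.isHomogeneous_one κ ℝ)
      (mem_intDegree_of_mem (ι_mem_exteriorPower _) rfl)
      (mem_intDegree_of_mem (one_mem_base 𝒞) rfl) (by simp [fiberDegree])
  · exact mk_mem_intDegree 𝒞 (MvPolynomial.isHomogeneous_X ℝ α) one_mem_ext
      (mem_intDegree_of_mem (one_mem_base 𝒞) rfl) (by simp [fiberDegree])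

theorem coord_inl_mul_mk [DecidableEq ι] (i : ι) (p : MvPolynomial κ ℝ) {x : ExteriorAlgebra ℝ (ι → ℝ)} {s : ℤ}
    (hx : x ∈ intDegree (fun k : ℕ => ⋀[ℝ]^k (ι → ℝ)) s) (f : C) :
    coord 𝒞 (Sum.inl i) * mk 𝒞 p x f = mk 𝒞 p (ExteriorAlgebra.ι ℝ (Pi.single i 1) * x) f := by
  rw [coord, mk_mul_mk 𝒞 1 p _ f (mem_intDegree_of_mem (one_mem_base 𝒞) rfl) hx]
  simp

theorem coord_inr_mul_mk [DecidableEq ι] (α : κ) (p : MvPolynomial κ ℝ) {x : ExteriorAlgebra ℝ (ι → ℝ)} {s : ℤ}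
    (hx : x ∈ intDegree (fun k : ℕ => ⋀[ℝ]^k (ι → ℝ)) s) (f : C) :
    coord 𝒞 (Sum.inr α) * mk 𝒞 p x f = mk 𝒞 (MvPolynomial.X α * p) x f := by
  rw [coord, mk_mul_mk 𝒞 _ p _ f (mem_intDegree_of_mem (one_mem_base 𝒞) rfl) hx]
  simp

theorem partialDeriv_ofBase (j : ι ⊕ κ) (f : C) :
    partialDeriv 𝒞 j (ofBase 𝒞 f : TotalFunctions 𝒞 ι κ) = 0 := by
  rcases j with i | α
  · rw [ofBase, partialDeriv_inl_mk, CliffordAlgebra.contractLeft_one, mk_zero_mid]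
  · rw [ofBase, partialDeriv_inr_mk, MvPolynomial.pderiv_one, mk_zero_left]

theorem one_eq_ofBase : (1 : TotalFunctions 𝒞 ι κ) = ofBase 𝒞 1 := rfl

open Classical in
theorem partialDeriv_coord [DecidableEq ι] (j k : ι ⊕ κ) :
    partialDeriv 𝒞 j (coord 𝒞 k) = if j = k then 1 else 0 := by
  rcases j with i | α <;> rcases k with i' | α'
  · rw [coord, partialDeriv_inl_mk, CliffordAlgebra.contractLeft_ι, LinearMap.proj_apply,
      Pi.single_apply]
    split_ifs with h h' h'
    · rw [map_one]; rfl
    · exact absurd (congrArg _ h) h'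
    · exact absurd (Sum.inl_injective h') h
    · rw [map_zero, mk_zero_mid]
  · rw [coord, partialDeriv_inl_mk, CliffordAlgebra.contractLeft_one, mk_zero_mid]; simp
  · rw [coord, partialDeriv_inr_mk, MvPolynomial.pderiv_one, mk_zero_left]; simp
  · rw [coord, partialDeriv_inr_mk, MvPolynomial.pderiv_X, Pi.single_apply]
    split_ifs with h h' h'
    · rfl
    · exact absurd (congrArg _ h.symm) h'
    · exact absurd (Sum.inr_injective h').symm h
    · rw [mk_zero_left]

theorem partialDeriv_mem_fiberPolynomials (j : ι ⊕ κ) {m : ℕ} {b : TotalFunctions 𝒞 ι κ}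
    (hb : b ∈ fiberPolynomials 𝒞 (m + 1)) : partialDeriv 𝒞 j b ∈ fiberPolynomials 𝒞 m := by
  refine fiberPolynomials_induction 𝒞 (P := fun b => partialDeriv 𝒞 j b ∈ fiberPolynomials 𝒞 m)
    ?_ (by simp) (fun a a' h h' => by rw [map_add]; exact add_mem h h')
    (fun c a h => by rw [map_smul]; exact Submodule.smul_mem _ c h) hb
  intro r s p x f hp hx h
  rcases j with i | α
  · rw [partialDeriv_inl_mk]
    rcases intDegree_cases (contractLeft_mem_intDegree (LinearMap.proj i) s x hx) with
      ⟨t, ht, h'⟩ | h'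
    · exact mk_mem_fiberPolynomials 𝒞 hp h' (by omega)
    · rw [h', mk_zero_mid]; exact zero_mem _
  · rw [partialDeriv_inr_mk]
    rcases r with _ | r
    · rw [← MvPolynomial.totalDegree_zero_iff_isHomogeneous,
        MvPolynomial.totalDegree_eq_zero_iff_eq_C] at hp
      rw [hp, MvPolynomial.pderiv_C, mk_zero_left]
      exact zero_mem _
    · exact mk_mem_fiberPolynomials 𝒞 hp.pderiv hx (by omega)

theorem coord_mul_mem_fiberPolynomials [DecidableEq ι] (j : ι ⊕ κ) {m : ℕ} {b : TotalFunctions 𝒞 ι κ}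
    (hb : b ∈ fiberPolynomials 𝒞 m) : coord 𝒞 j * b ∈ fiberPolynomials 𝒞 (m + 1) := by
  refine fiberPolynomials_induction 𝒞 (P := fun b => coord 𝒞 j * b ∈ fiberPolynomials 𝒞 (m + 1))
    ?_ (by simp) (fun a a' h h' => by rw [mul_add]; exact add_mem h h')
    (fun c a h => by rw [mul_smul_comm]; exact Submodule.smul_mem _ c h) hb
  intro r s p x f hp hx h
  have hx' := mem_intDegree_of_mem (𝒢 := fun k : ℕ => ⋀[ℝ]^k (ι → ℝ)) hx rfl
  rcases j with i | α
  · rw [coord_inl_mul_mk 𝒞 i p hx']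
    exact mk_mem_fiberPolynomials 𝒞 hp (mul_mem_exteriorPower (ι_mem_exteriorPower _) hx) (by omega)
  · rw [coord_inr_mul_mk 𝒞 α p hx']
    exact mk_mem_fiberPolynomials 𝒞 ((MvPolynomial.isHomogeneous_X ℝ α).mul hp) hx (by omega)

theorem ofBaseField_mem_fiberPolynomials (d : ℤ) (X : Module.End ℝ C) {m : ℕ}
    {b : TotalFunctions 𝒞 ι κ} (hb : b ∈ fiberPolynomials 𝒞 m) :
    ofBaseField 𝒞 d X b ∈ fiberPolynomials 𝒞 m := by
  refine fiberPolynomials_induction 𝒞 (P := fun b => ofBaseField 𝒞 d X b ∈ fiberPolynomials 𝒞 m)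
    ?_ (by simp) (fun a a' h h' => by rw [map_add]; exact add_mem h h')
    (fun c a h => by rw [map_smul]; exact Submodule.smul_mem _ c h) hb
  intro r s p x f hp hx h
  rw [ofBaseField_mk 𝒞 d X (mem_intDegree_of_mem hx rfl)]
  exact units_smul_mem _ (mk_mem_fiberPolynomials 𝒞 hp hx h)

/-- Euler's identity on the fibers. -/
theorem sum_coord_mul_partialDeriv [DecidableEq ι] [Fintype ι] [Fintype κ] {m : ℕ} {b : TotalFunctions 𝒞 ι κ}
    (hb : b ∈ fiberPolynomials 𝒞 m) : ∑ j, coord 𝒞 j * partialDeriv 𝒞 j b = (m : ℝ) • b := by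
  refine fiberPolynomials_induction 𝒞 (P := fun b => ∑ j, coord 𝒞 j * partialDeriv 𝒞 j b
      = (m : ℝ) • b) ?_ (by simp)
    (fun a a' h h' => by simp only [map_add, mul_add, Finset.sum_add_distrib, h, h', smul_add])
    (fun c a h => by
      simp only [map_smul, mul_smul_comm, ← Finset.smul_sum, h]
      rw [smul_comm]) hb
  intro r s p x f hp hx h
  rw [Fintype.sum_sum_type]
  have h1 : ∀ i : ι, coord 𝒞 (Sum.inl i) * partialDeriv 𝒞 (Sum.inl i) (mk 𝒞 p x f)
      = mkMid 𝒞 p f (ExteriorAlgebra.ι ℝ (Pi.single i 1) *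
        CliffordAlgebra.contractLeft (Q := (0 : QuadraticForm ℝ (ι → ℝ))) (LinearMap.proj i) x) :=
    fun i => coord_inl_mul_mk 𝒞 i p (contractLeft_mem_intDegree _ s x hx) f
  have h2 : ∀ α : κ, coord 𝒞 (Sum.inr α) * partialDeriv 𝒞 (Sum.inr α) (mk 𝒞 p x f)
      = mkLeft 𝒞 x f (MvPolynomial.X α * MvPolynomial.pderiv α p) :=
    fun α => coord_inr_mul_mk 𝒞 α _ (mem_intDegree_of_mem hx rfl) f
  simp only [h1, h2, ← map_sum]
  rw [sum_ι_mul_contractLeft s x hx, hp.sum_X_mul_pderiv, map_smul, map_nsmul]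
  change (s : ℝ) • mk 𝒞 p x f + r • mk 𝒞 p x f = _
  rw [← Nat.cast_smul_eq_nsmul ℝ r, ← add_smul, ← h]
  push_cast
  rw [add_comm]

/-- Euler's identity reads `(m + 1) b = 0`, and `m + 1` is invertible over `ℝ`. -/
theorem eq_zero_of_partialDeriv_eq_zero [Finite ι] [Finite κ] {m : ℕ} {b : TotalFunctions 𝒞 ι κ}
    (hb : b ∈ fiberPolynomials 𝒞 (m + 1)) (h : ∀ j, partialDeriv 𝒞 j b = 0) : b = 0 := by
  have := Fintype.ofFinite ι
  have := Fintype.ofFinite κ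
  classical
  have h1 := sum_coord_mul_partialDeriv 𝒞 hb
  simp only [h, mul_zero, Finset.sum_const_zero] at h1
  exact (smul_eq_zero.mp h1.symm).resolve_left (by positivity)

/-- Two contractions anticommute, two polynomial derivatives commute, and a mixed pair acts on
different tensor factors; the degrees `-1` and `-2` give the matching signs. -/
theorem commutator_partialDeriv_partialDeriv (j k : ι ⊕ κ) :
    gradedCommutator (fiberDegree j - 1) (fiberDegree k - 1) (partialDeriv 𝒞 j)
      (partialDeriv 𝒞 k) = 0 := by
  refine end_ext 𝒞 fun r s m p x f hp hx hf => ?_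
  rcases j with i | α <;> rcases k with i' | α' <;>
    simp only [gradedCommutator, fiberDegree, Sum.elim_inl, Sum.elim_inr, LinearMap.sub_apply,
      Module.End.mul_apply, LinearMap.smul_apply, partialDeriv_inl_mk, partialDeriv_inr_mk,
      LinearMap.zero_apply]
  · rw [CliffordAlgebra.contractLeft_comm, Int.negOnePow_odd _ (by decide), Units.neg_smul, one_smul,
      sub_neg_eq_add]
    rw [← mk_add_mid, neg_add_cancel, mk_zero_mid]
  · rw [Int.negOnePow_even _ (by decide), one_smul, sub_self]
  · rw [Int.negOnePow_even _ (by decide), one_smul, sub_self]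
  -- The ordinary commutator of two derivations is a derivation, so it suffices that it kills the
  -- variables.
  · have h : ⁅(MvPolynomial.pderiv α : Derivation ℝ (MvPolynomial κ ℝ) (MvPolynomial κ ℝ)),
        (MvPolynomial.pderiv α' : Derivation ℝ (MvPolynomial κ ℝ) (MvPolynomial κ ℝ))⁆ = 0 := by
      classical
      apply MvPolynomial.derivation_ext
      intro i
      simp [Derivation.commutator_apply, MvPolynomial.pderiv_X, Pi.single_apply, apply_ite]
    have h' := DFunLike.congr_fun h p
    rw [Derivation.commutator_apply] at h'
    rw [Int.negOnePow_even _ (by decide), one_smul, sub_eq_zero]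
    rw [sub_eq_zero.mp h']

/-- The operators act on different tensor factors. The sign comes from the twist alone: contraction
lowers the `η`-degree by one and changes the twist by `(-1)^d`, while `∂/∂P^α` is even. -/
theorem commutator_ofBaseField_partialDeriv (d : ℤ) (X : Module.End ℝ C) (j : ι ⊕ κ) :
    gradedCommutator d (fiberDegree j - 1) (ofBaseField 𝒞 d X) (partialDeriv 𝒞 j) = 0 := by
  refine end_ext 𝒞 fun r s m p x f hp hx hf => ?_
  have hx' := mem_intDegree_of_mem (𝒢 := fun k : ℕ => ⋀[ℝ]^k (ι → ℝ)) hx rfl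
  have hc := fun i => contractLeft_mem_intDegree (LinearMap.proj (φ := fun _ : ι => ℝ) i) s x hx
  rcases j with i | α <;>
    simp only [gradedCommutator, fiberDegree, Sum.elim_inl, Sum.elim_inr, LinearMap.sub_apply,
      Module.End.mul_apply, LinearMap.smul_apply, partialDeriv_inl_mk, partialDeriv_inr_mk,
      LinearMap.zero_apply, ofBaseField_mk 𝒞 d X hx', Module.End.map_units_smul,
      ofBaseField_mk 𝒞 d X (hc _)]
  · rw [smul_smul, ← Int.negOnePow_add, sub_eq_zero]
    congr 2
    ring
  · rw [smul_smul, ← Int.negOnePow_add, sub_eq_zero]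
    rw [Int.negOnePow_add, Int.negOnePow_even (d * (-1 - 1)) (Even.mul_left (by decide) _), one_mul]

end TotalFunctions

/-! ### Homogeneous bases of `L` -/

namespace DGLA

variable {L : Type*} [AddCommGroup L] [Module ℝ L] {𝔏 : DGLA L} {ι κ : Type*}
  {e : Module.Basis (ι ⊕ κ) ℝ L}

theorem IsHomogeneousBasis.mem (he : 𝔏.IsHomogeneousBasis e) (j : ι ⊕ κ) :
    e j ∈ 𝔏.deg (fiberDegree j) := by
  rcases j with i | α
  · exact he.inl_mem i
  · exact he.inr_mem α

/-- Expand an element of degree `i` in the basis. The part carried by basis vectors of other degrees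
also lies in degree `i`, as a difference, hence is `0` by independence of the grading. -/
theorem IsHomogeneousBasis.deg_eq_span (he : 𝔏.IsHomogeneousBasis e) (i : ℤ) :
    𝔏.deg i = Submodule.span ℝ {x | ∃ j, fiberDegree j = i ∧ x = e j} := by
  apply le_antisymm
  · intro x hx
    have hdisj := 𝔏.isInternal.submodule_iSupIndep i
    have hsum : ∀ y : L, ∃ a ∈ Submodule.span ℝ {x | ∃ j, fiberDegree j = i ∧ x = e j},
        ∃ b ∈ ⨆ k, ⨆ (_ : k ≠ i), 𝔏.deg k, y = a + b := by
      intro y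
      have hy : y ∈ Submodule.span ℝ (Set.range e) := by rw [e.span_eq]; trivial
      induction hy using Submodule.span_induction with
      | zero => exact ⟨0, zero_mem _, 0, zero_mem _, by simp⟩
      | mem y hy =>
        obtain ⟨j, rfl⟩ := hy
        by_cases h : fiberDegree j = i
        · exact ⟨e j, Submodule.subset_span ⟨j, h, rfl⟩, 0, zero_mem _, by simp⟩
        · exact ⟨0, zero_mem _, e j,
            Submodule.mem_iSup_of_mem _ (Submodule.mem_iSup_of_mem h (he.mem j)), by simp⟩
      | add y z _ _ hy hz =>
        obtain ⟨a, ha, b, hb, rfl⟩ := hy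
        obtain ⟨a', ha', b', hb', rfl⟩ := hz
        exact ⟨a + a', add_mem ha ha', b + b', add_mem hb hb', by abel⟩
      | smul c y _ hy =>
        obtain ⟨a, ha, b, hb, rfl⟩ := hy
        exact ⟨c • a, Submodule.smul_mem _ c ha, c • b, Submodule.smul_mem _ c hb, smul_add _ _ _⟩
    obtain ⟨a, ha, b, hb, rfl⟩ := hsum x
    have ha' : a ∈ 𝔏.deg i := by
      refine (Submodule.span_le (p := 𝔏.deg i)).mpr ?_ ha
      rintro _ ⟨j, rfl, rfl⟩
      exact he.mem j
    have hb' : b ∈ 𝔏.deg i := by simpa using sub_mem hx ha'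
    rw [Submodule.disjoint_def.mp hdisj b hb' hb, add_zero]
    exact ha
  · rw [Submodule.span_le]
    rintro _ ⟨j, rfl, rfl⟩
    exact he.mem j

/-- Identities linear in a homogeneous element extend from the basis vectors of its degree. This
replaces sums over structure constants by identities in `L` itself. -/
theorem IsHomogeneousBasis.induction (he : 𝔏.IsHomogeneousBasis e) {i : ℤ} {P : L → Prop}
    (basis : ∀ j, fiberDegree j = i → P (e j)) (zero : P 0) (add : ∀ x y, P x → P y → P (x + y))
    (smul : ∀ (c : ℝ) x, P x → P (c • x)) {x : L} (hx : x ∈ 𝔏.deg i) : P x := by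
  rw [he.deg_eq_span] at hx
  induction hx using Submodule.span_induction with
  | mem x hx => obtain ⟨j, hj, rfl⟩ := hx; exact basis j hj
  | zero => exact zero
  | add x y _ _ hx hy => exact add x y hx hy
  | smul c x _ hx => exact smul c x hx

end DGLA

/-! ### An abstract model of the functions on a trivial graded bundle, and rigidity -/

theorem LinearMap.map_intUnits_smul {V W : Type*} [AddCommGroup V] [Module ℝ V] [AddCommGroup W]
    [Module ℝ W] (X : V →ₗ[ℝ] W) (u : ℤˣ) (b : V) : X (u • b) = u • X b := by
  rcases Int.units_eq_one_or u with rfl | rfl <;> simp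

theorem gradedCommutator_apply {V : Type*} [AddCommGroup V] [Module ℝ V] (p q : ℤ)
    (X Y : Module.End ℝ V) (b : V) : gradedCommutator p q X Y b
      = X (Y b) - ((p * q).negOnePow : ℤˣ) • Y (X b) := rfl

/-- The structure of the algebra `B` of functions on a trivial graded vector bundle over the graded
manifold `𝓜` with algebra of functions `C`: the grading, the polynomials on the fibers, the
functions on the base, the coordinates on the fibers and their partial derivatives. -/
structure FiberModel {C : Type*} [Ring C] [Algebra ℝ C] (𝒞 : ℕ → Submodule ℝ C) (B : Type*) [Ring B]
    [Algebra ℝ B] (ι κ : Type*) where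
  degree : ℕ → Submodule ℝ B
  poly : ℕ → Submodule ℝ B
  base : C →ₗ[ℝ] B
  D : ι ⊕ κ → Module.End ℝ B
  coord : ι ⊕ κ → B
  comm : IsGradedCommutative degree
  base_mem : ∀ {k : ℤ} {f : C}, f ∈ intDegree 𝒞 k → base f ∈ intDegree degree k
  base_one : base 1 = 1
  base_mul : ∀ f g, base (f * g) = base f * base g
  base_injective : Function.Injective base
  base_mem_poly : ∀ f, base f ∈ poly 0
  exists_base : ∀ {b}, b ∈ poly 0 → ∃ f, b = base f
  iSup_poly : ⨆ m, poly m = ⊤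
  isVectorField_D : ∀ j, IsVectorField degree (fiberDegree j - 1) (D j)
  D_base : ∀ j f, D j (base f) = 0
  D_mem_poly : ∀ j {m b}, b ∈ poly (m + 1) → D j b ∈ poly m
  eq_zero_of_D_eq_zero : ∀ {m b}, b ∈ poly (m + 1) → (∀ j, D j b = 0) → b = 0
  commutator_D_D : ∀ j k,
    gradedCommutator (fiberDegree j - 1) (fiberDegree k - 1) (D j) (D k) = 0
  coord_mem : ∀ j, coord j ∈ intDegree degree (1 - fiberDegree j)
  coord_mul_mem_poly : ∀ j {m b}, b ∈ poly m → coord j * b ∈ poly (m + 1)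
  D_coord_self : ∀ j, D j (coord j) = 1
  D_coord_of_ne : ∀ {j k}, j ≠ k → D j (coord k) = 0

namespace FiberModel

variable {C : Type*} [Ring C] [Algebra ℝ C] {𝒞 : ℕ → Submodule ℝ C} {B : Type*} [Ring B]
  [Algebra ℝ B] {ι κ : Type*} (𝔉 : FiberModel 𝒞 B ι κ)

theorem D_poly_zero (j : ι ⊕ κ) {b : B} (hb : b ∈ 𝔉.poly 0) : 𝔉.D j b = 0 := by
  obtain ⟨f, rfl⟩ := 𝔉.exists_base hb
  exact 𝔉.D_base j f

/-- Endomorphisms which raise the polynomial degree on the fibers by `r`. -/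
def RaisesFiberDegree (r : ℕ) (X : Module.End ℝ B) : Prop :=
  ∀ m, ∀ b ∈ 𝔉.poly m, X b ∈ 𝔉.poly (m + r)

variable {𝔉}

namespace RaisesFiberDegree

variable {r s : ℕ} {X Y : Module.End ℝ B}

theorem add (hX : RaisesFiberDegree 𝔉 r X) (hY : RaisesFiberDegree 𝔉 r Y) :
    RaisesFiberDegree 𝔉 r (X + Y) := fun m b hb => add_mem (hX m b hb) (hY m b hb)

theorem smul (c : ℝ) (hX : RaisesFiberDegree 𝔉 r X) : RaisesFiberDegree 𝔉 r (c • X) :=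
  fun m b hb => Submodule.smul_mem _ c (hX m b hb)

theorem units_smul (u : ℤˣ) (hX : RaisesFiberDegree 𝔉 r X) : RaisesFiberDegree 𝔉 r (u • X) :=
  fun m b hb => units_smul_mem u (hX m b hb)

theorem neg (hX : RaisesFiberDegree 𝔉 r X) : RaisesFiberDegree 𝔉 r (-X) :=
  fun m b hb => neg_mem (hX m b hb)

theorem sub (hX : RaisesFiberDegree 𝔉 r X) (hY : RaisesFiberDegree 𝔉 r Y) :
    RaisesFiberDegree 𝔉 r (X - Y) := fun m b hb => sub_mem (hX m b hb) (hY m b hb)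

theorem sum {α : Type*} (s : Finset α) {X : α → Module.End ℝ B}
    (hX : ∀ i ∈ s, RaisesFiberDegree 𝔉 r (X i)) : RaisesFiberDegree 𝔉 r (∑ i ∈ s, X i) :=
  fun m b hb => by
    rw [LinearMap.sum_apply]
    exact sum_mem fun i hi => hX i hi m b hb

theorem mul (hX : RaisesFiberDegree 𝔉 r X) (hY : RaisesFiberDegree 𝔉 s Y) :
    RaisesFiberDegree 𝔉 (r + s) (X * Y) := fun m b hb => by
  have := hX _ _ (hY m b hb)
  rwa [add_assoc, add_comm s] at this

theorem commutator (hX : RaisesFiberDegree 𝔉 r X) (hY : RaisesFiberDegree 𝔉 s Y) (p q : ℤ) :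
    RaisesFiberDegree 𝔉 (r + s) (gradedCommutator p q X Y) :=
  (hX.mul hY).sub (units_smul _ (add_comm r s ▸ hY.mul hX))

/-- A derivative lowers the fiber degree by one. At degree `0` there is nothing to lower, but there
the derivative itself vanishes. -/
theorem commutator_partialDeriv (hX : RaisesFiberDegree 𝔉 (r + 1) X) (p q : ℤ) (j : ι ⊕ κ) :
    RaisesFiberDegree 𝔉 r (gradedCommutator p q X (𝔉.D j)) := fun m b hb => by
  refine sub_mem ?_ (units_smul_mem _ ?_)
  · rcases m with _ | m
    · rw [Module.End.mul_apply, 𝔉.D_poly_zero j hb, map_zero]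
      exact zero_mem _
    · have := hX m _ (𝔉.D_mem_poly j hb)
      rwa [show m + (r + 1) = m + 1 + r by ring] at this
  · exact 𝔉.D_mem_poly j (hX m b hb)

end RaisesFiberDegree

/-- An endomorphism which does not lower the degree on the fibers, annihilates the functions on
the base and commutes with the `∂/∂ξ^j` vanishes. -/
theorem eq_zero_of_commutator_partialDeriv {r : ℕ} {X : Module.End ℝ B}
    (hX : RaisesFiberDegree 𝔉 r X) (hbase : ∀ f, X (𝔉.base f) = 0) (p : ℤ)
    (h : ∀ j, gradedCommutator p (fiberDegree j - 1) X (𝔉.D j) = 0) : X = 0 := by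
  have key : ∀ m, ∀ b ∈ 𝔉.poly m, X b = 0 := by
    intro m
    induction m with
    | zero =>
      intro b hb
      obtain ⟨f, rfl⟩ := 𝔉.exists_base hb
      exact hbase f
    | succ m ih =>
      intro b hb
      have hXb := hX _ b hb
      rw [show m + 1 + r = m + r + 1 by ring] at hXb
      -- `X b` has positive fiber degree, so its derivatives decide. Up to sign, `D_j (X b)` is `X
      -- (D_j b)`, which vanishes by the induction hypothesis.
      refine 𝔉.eq_zero_of_D_eq_zero hXb fun j => ?_
      have h' := LinearMap.congr_fun (h j) b
      simp only [gradedCommutator, LinearMap.sub_apply, Module.End.mul_apply, LinearMap.smul_apply,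
        LinearMap.zero_apply, ih _ (𝔉.D_mem_poly j hb), zero_sub,
        neg_eq_zero] at h'
      rcases Int.units_eq_one_or ((p * (fiberDegree j - 1)).negOnePow) with h'' | h''
      · rwa [h'', one_smul] at h'
      · rwa [h'', Units.neg_smul, one_smul, neg_eq_zero] at h'
  refine LinearMap.ext fun b => ?_
  have hb : b ∈ ⨆ m, 𝔉.poly m := by rw [𝔉.iSup_poly]; trivial
  induction hb using Submodule.iSup_induction' with
  | mem m b hb => exact key m b hb
  | zero => simp
  | add a b _ _ ha hb => rw [map_add, ha, hb, map_add]

/-- Vanishing on the base is automatic here: `X f` has positive fiber degree, and each `D_j (X f)`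
is `± X (D_j f) = 0`. The derivation property of `X` is not involved. -/
theorem eq_zero_of_commutator_partialDeriv_of_raises {r : ℕ}
    {X : Module.End ℝ B}
    (hX : RaisesFiberDegree 𝔉 (r + 1) X) (p : ℤ)
    (h : ∀ j, gradedCommutator p (fiberDegree j - 1) X (𝔉.D j) = 0) : X = 0 := by
  refine eq_zero_of_commutator_partialDeriv hX (fun f => ?_) p h
  have hXb := hX _ _ (𝔉.base_mem_poly f)
  rw [show 0 + (r + 1) = r + 1 by ring] at hXb
  refine 𝔉.eq_zero_of_D_eq_zero hXb fun j => ?_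
  have h' := LinearMap.congr_fun (h j) (𝔉.base f)
  simp only [gradedCommutator, LinearMap.sub_apply, Module.End.mul_apply, LinearMap.smul_apply,
    LinearMap.zero_apply, 𝔉.D_base, map_zero, zero_sub, neg_eq_zero] at h'
  rcases Int.units_eq_one_or ((p * (fiberDegree j - 1)).negOnePow) with h'' | h''
  · rwa [h'', one_smul] at h'
  · rwa [h'', Units.neg_smul, one_smul, neg_eq_zero] at h'

end FiberModel

/-! ### Action fields, linear fields and their commutator -/

section Fields

open FiberModel

variable {C : Type*} [Ring C] [Algebra ℝ C] {𝒞 : ℕ → Submodule ℝ C} {B : Type*} [Ring B]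
  [Algebra ℝ B] {ι κ : Type*} (𝔉 : FiberModel 𝒞 B ι κ)
  {L : Type*} [AddCommGroup L] [Module ℝ L] (𝔏 : DGLA L)
  (e : Module.Basis (ι ⊕ κ) ℝ L) (μ : L →ₗ[ℝ] Module.End ℝ C)

/-- The constant vertical vector field on `L[1] × 𝓜` in the direction of an element of `L`. -/
noncomputable def constantField : L →ₗ[ℝ] Module.End ℝ B :=
  e.constr ℝ (𝔉.D)

@[simp] theorem constantField_basis (j : ι ⊕ κ) : constantField 𝔉 e (e j) = 𝔉.D j :=
  e.constr_basis ℝ _ j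

/-- The part of `IsEncodedBy` which concerns the constant sections of the transformation
algebroid. -/
structure IsActionField (Q : Module.End ℝ B) : Prop where
  raises : RaisesFiberDegree 𝔉 1 Q
  base : ∀ j f, gradedCommutator 1 (fiberDegree j - 1) Q (𝔉.D j) (𝔉.base f)
    = 𝔉.base (μ (e j) f)
  commutator : ∀ j k, gradedCommutator (fiberDegree j) (fiberDegree k - 1)
    (gradedCommutator 1 (fiberDegree j - 1) Q (𝔉.D j)) (𝔉.D k)
      = ((fiberDegree j).negOnePow : ℤˣ) • constantField 𝔉 e (𝔏.bracket (e j) (e k))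

/-- Vector fields of degree `1`, linear on the fibers of `L[1] × 𝓜`, which induce `QA` on `𝓜` and
`-δ` on the constant sections. -/
structure IsLinearField (QA : Module.End ℝ C) (R : Module.End ℝ B) :
    Prop where
  raises : RaisesFiberDegree 𝔉 0 R
  base : ∀ f, R (𝔉.base f) = 𝔉.base (QA f)
  commutator : ∀ j, gradedCommutator 1 (fiberDegree j - 1) R (𝔉.D j)
    = -constantField 𝔉 e (𝔏.δ (e j))

variable {𝔉 𝔏 e μ} {Q Q' R : Module.End ℝ B} {QA : Module.End ℝ C}

namespace IsActionField

/-- This and the next two lemmas extend the defining relations from basis vectors to homogeneous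
elements. The brackets and the values of `δ` can then be fed back into them. -/
theorem base_of_mem (hQ : IsActionField 𝔉 𝔏 e μ Q) (he : 𝔏.IsHomogeneousBasis e) {i : ℤ} {x : L}
    (hx : x ∈ 𝔏.deg i) (f : C) :
    gradedCommutator 1 (i - 1) Q (constantField 𝔉 e x) (𝔉.base f) = 𝔉.base (μ x f) := by
  refine he.induction (P := fun x => gradedCommutator 1 (i - 1) Q (constantField 𝔉 e x)
    (𝔉.base f) = 𝔉.base (μ x f)) ?_ (by simp [map_zero]) ?_ ?_ hx
  · rintro j rfl
    rw [constantField_basis, hQ.base]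
  · intro x y hx hy
    rw [map_add, gradedCommutator_add_right, LinearMap.add_apply, hx, hy, map_add,
      LinearMap.add_apply, map_add]
  · intro c x hx
    rw [map_smul, gradedCommutator_smul_right, LinearMap.smul_apply, hx, map_smul,
      LinearMap.smul_apply]
    rw [map_smul]

theorem raises_of_mem (hQ : IsActionField 𝔉 𝔏 e μ Q) (he : 𝔏.IsHomogeneousBasis e) {i : ℤ} {x : L}
    (hx : x ∈ 𝔏.deg i) :
    RaisesFiberDegree 𝔉 0 (gradedCommutator 1 (i - 1) Q (constantField 𝔉 e x)) := by
  refine he.induction (P := fun x => RaisesFiberDegree 𝔉 0 (gradedCommutator 1 (i - 1) Q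
    (constantField 𝔉 e x))) ?_ ?_ ?_ ?_ hx
  · intro j _
    rw [constantField_basis]
    exact RaisesFiberDegree.commutator_partialDeriv hQ.raises _ _ _
  · rw [map_zero, gradedCommutator_zero_right]
    exact fun m b hb => zero_mem _
  · intro x y hx hy
    rw [map_add, gradedCommutator_add_right]
    exact hx.add hy
  · intro c x hx
    rw [map_smul, gradedCommutator_smul_right]
    exact hx.smul c

theorem commutator_of_mem (hQ : IsActionField 𝔉 𝔏 e μ Q) (he : 𝔏.IsHomogeneousBasis e) {i j : ℤ}
    {x y : L} (hx : x ∈ 𝔏.deg i) (hy : y ∈ 𝔏.deg j) {q : ℤ} (hq : q = j - 1) :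
    gradedCommutator i q (gradedCommutator 1 (i - 1) Q (constantField 𝔉 e x))
      (constantField 𝔉 e y) = (i.negOnePow : ℤˣ) • constantField 𝔉 e (𝔏.bracket x y) := by
  subst hq
  refine he.induction (P := fun x => gradedCommutator i (j - 1) (gradedCommutator 1 (i - 1) Q
    (constantField 𝔉 e x)) (constantField 𝔉 e y)
      = (i.negOnePow : ℤˣ) • constantField 𝔉 e (𝔏.bracket x y)) ?_ (by simp) ?_ ?_ hx
  · rintro k rfl
    refine he.induction (P := fun y => gradedCommutator (fiberDegree k) (j - 1)
      (gradedCommutator 1 (fiberDegree k - 1) Q (constantField 𝔉 e (e k))) (constantField 𝔉 e y)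
        = ((fiberDegree k).negOnePow : ℤˣ) • constantField 𝔉 e (𝔏.bracket (e k) y)) ?_ (by simp)
      ?_ ?_ hy
    · rintro l rfl
      rw [constantField_basis, constantField_basis, hQ.commutator]
    · intro y z hy hz
      simp only [map_add, gradedCommutator_add_right, hy, hz, smul_add]
    · intro c y hy
      simp only [map_smul, gradedCommutator_smul_right, hy, real_smul_units_smul]
  · intro x z hx hz
    simp only [map_add, gradedCommutator_add_right, gradedCommutator_add_left, hx, hz, smul_add,
      LinearMap.add_apply]
  · intro c x hx
    simp only [map_smul, gradedCommutator_smul_right, gradedCommutator_smul_left, hx,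
      real_smul_units_smul, LinearMap.smul_apply]

end IsActionField

theorem IsLinearField.commutator_of_mem (hR : IsLinearField 𝔉 𝔏 e QA R)
    (he : 𝔏.IsHomogeneousBasis e) {i : ℤ} {x : L} (hx : x ∈ 𝔏.deg i) {q : ℤ} (hq : q = i - 1) :
    gradedCommutator 1 q R (constantField 𝔉 e x) = -constantField 𝔉 e (𝔏.δ x) := by
  subst hq
  refine he.induction (P := fun x => gradedCommutator 1 (i - 1) R (constantField 𝔉 e x)
    = -constantField 𝔉 e (𝔏.δ x)) ?_ (by simp) ?_ ?_ hx
  · rintro k rfl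
    rw [constantField_basis, hR.commutator]
  · intro x y hx hy
    simp only [map_add, gradedCommutator_add_right, hx, hy, neg_add]
  · intro c x hx
    simp only [map_smul, gradedCommutator_smul_right, hx, smul_neg]

theorem eq_zero_of_commutator_constantField (he : 𝔏.IsHomogeneousBasis e) {r : ℕ}
    {X : Module.End ℝ B} (hX : RaisesFiberDegree 𝔉 r X)
    (hbase : ∀ f, X (𝔉.base f) = 0) (p : ℤ)
    (h : ∀ (i : ℤ), ∀ x ∈ 𝔏.deg i, gradedCommutator p (i - 1) X (constantField 𝔉 e x) = 0) :
    X = 0 :=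
  eq_zero_of_commutator_partialDeriv hX hbase p fun j => by
    simpa using h (fiberDegree j) (e j) (he.mem j)

theorem eq_zero_of_commutator_constantField_of_raises (he : 𝔏.IsHomogeneousBasis e) {r : ℕ}
    {X : Module.End ℝ B} (hX : RaisesFiberDegree 𝔉 (r + 1) X) (p : ℤ)
    (h : ∀ (i : ℤ), ∀ x ∈ 𝔏.deg i, gradedCommutator p (i - 1) X (constantField 𝔉 e x) = 0) :
    X = 0 :=
  eq_zero_of_commutator_partialDeriv_of_raises hX p fun j => by
    simpa using h (fiberDegree j) (e j) (he.mem j)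

theorem Int.negOnePow_smul_smul {V : Type*} [AddCommGroup V] (m n : ℤ) (x : V) :
    (m.negOnePow : ℤˣ) • (n.negOnePow : ℤˣ) • x = ((m + n).negOnePow : ℤˣ) • x := by
  rw [smul_smul, ← Int.negOnePow_add]

/-- The field encoding the algebroid is determined by its commutators with constant fields. -/
theorem IsActionField.unique (hQ : IsActionField 𝔉 𝔏 e μ Q) (hQ' : IsActionField 𝔉 𝔏 e μ Q') :
    Q = Q' := by
  rw [← sub_eq_zero]
  -- Rigidity is used twice. The difference raises the fiber degree, so its commutators with the
  -- `∂/∂ξ^j` decide; those preserve the degree, so their base values and a second commutator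
  -- decide.
  refine eq_zero_of_commutator_partialDeriv_of_raises (r := 0) (hQ.raises.sub hQ'.raises) 1
    fun j => ?_
  refine eq_zero_of_commutator_partialDeriv (r := 0)
    (RaisesFiberDegree.commutator_partialDeriv (hQ.raises.sub hQ'.raises) _ _ _) (fun f => ?_)
    (fiberDegree j) fun k => ?_
  · rw [gradedCommutator_sub_left, LinearMap.sub_apply, hQ.base, hQ'.base, sub_self]
  · rw [gradedCommutator_sub_left, gradedCommutator_sub_left, hQ.commutator, hQ'.commutator,
      sub_self]

/-- Both sides preserve the fiber degree. On base functions the equality is the compatibility of `μ`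
with brackets; after a commutator with a constant field it is the Jacobi identity of `L`. -/
theorem IsActionField.commutator_commutator (hQ : IsActionField 𝔉 𝔏 e μ Q)
    (he : 𝔏.IsHomogeneousBasis e) (hμ : 𝔏.IsGradedLieHom 𝒞 μ) {i j : ℤ} {x y : L}
    (hx : x ∈ 𝔏.deg i) (hy : y ∈ 𝔏.deg j) :
    gradedCommutator i j (gradedCommutator 1 (i - 1) Q (constantField 𝔉 e x))
        (gradedCommutator 1 (j - 1) Q (constantField 𝔉 e y))
      = gradedCommutator 1 (i + j - 1) Q (constantField 𝔉 e (𝔏.bracket x y)) := by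
  have hxy := 𝔏.bracket_mem i j x hx y hy
  rw [← sub_eq_zero]
  refine eq_zero_of_commutator_constantField (r := 0) he
    (((hQ.raises_of_mem he hx).commutator (hQ.raises_of_mem he hy) _ _).sub
      (hQ.raises_of_mem he hxy)) (fun f => ?_) (i + j) fun k z hz => ?_
  · rw [LinearMap.sub_apply, hQ.base_of_mem he hxy, hμ.map_bracket i j x hx y hy,
      gradedCommutator_apply i j, gradedCommutator_apply i j, hQ.base_of_mem he hy,
      hQ.base_of_mem he hx, hQ.base_of_mem he hx, hQ.base_of_mem he hy, map_sub,
      LinearMap.map_intUnits_smul, sub_self]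
  · have h1 := gradedCommutator_jacobi (p := i) (q := j) (r := k - 1) rfl rfl rfl
      (gradedCommutator 1 (i - 1) Q (constantField 𝔉 e x))
      (gradedCommutator 1 (j - 1) Q (constantField 𝔉 e y)) (constantField 𝔉 e z)
    have hyz := 𝔏.bracket_mem j k y hy z hz
    have hxz := 𝔏.bracket_mem i k x hx z hz
    rw [hQ.commutator_of_mem he hy hz rfl, hQ.commutator_of_mem he hx hz rfl,
      gradedCommutator_units_right, gradedCommutator_units_right,
      hQ.commutator_of_mem he hx hyz (by ring), hQ.commutator_of_mem he hy hxz (by ring),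
      ← sub_eq_iff_eq_add] at h1
    rw [gradedCommutator_sub_left, hQ.commutator_of_mem he hxy hz rfl, ← h1,
      𝔏.jacobi i j x hx y hy z, map_add, smul_add, smul_add]
    rw [LinearMap.map_intUnits_smul]
    simp only [Int.negOnePow_smul_smul]
    rw [show j + (i + i * j) = i * j + (i + j) by ring, add_comm j i]
    abel

/-- Test `Q * Q` against two constant fields. Since `[Q * Q, ∂_x] = [Q, [Q, ∂_x]]`, a further
commutator with `∂_y` is the difference, up to sign, of `[Q, ∂_{[x, y]}]` and `[[Q, ∂_x], [Q,
∂_y]]`, which agree. -/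
theorem IsActionField.mul_self (hQ : IsActionField 𝔉 𝔏 e μ Q)
    (he : 𝔏.IsHomogeneousBasis e) (hμ : 𝔏.IsGradedLieHom 𝒞 μ) : Q * Q = 0 := by
  refine eq_zero_of_commutator_constantField_of_raises (r := 1) he (hQ.raises.mul hQ.raises) 2
    fun i x hx => ?_
  rw [gradedCommutator_sq (t := i) (by ring) 2 rfl]
  refine eq_zero_of_commutator_constantField_of_raises (r := 0) he
    (add_comm 1 0 ▸ hQ.raises.commutator (hQ.raises_of_mem he hx) _ _) (1 + i)
    fun j y hy => ?_
  have h1 := gradedCommutator_jacobi (p := 1) (q := i) (r := j - 1) rfl rfl (u := j) (by ring)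
      Q (gradedCommutator 1 (i - 1) Q (constantField 𝔉 e x)) (constantField 𝔉 e y)
  rw [hQ.commutator_of_mem he hx hy rfl, hQ.commutator_commutator he hμ hx hy,
    gradedCommutator_units_right, show i + (j - 1) = i + j - 1 by ring, one_mul] at h1
  -- The graded Jacobi identity has the same term on both sides, so the remaining summand, the
  -- double commutator of `Q * Q`, is zero.
  exact left_eq_add.mp (h1.trans (add_comm _ _))

/-- On the base this is `Q_A ^ 2 = 0`, and on constant fields it is `δ ^ 2 = 0`. The square
preserves the fiber degree, so both checks are required. -/
theorem IsLinearField.mul_self (hR : IsLinearField 𝔉 𝔏 e QA R) (he : 𝔏.IsHomogeneousBasis e)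
    (hQA : QA * QA = 0) : R * R = 0 := by
  refine eq_zero_of_commutator_constantField (r := 0) he (hR.raises.mul hR.raises) (fun f => ?_) 2
    fun i x hx => ?_
  · rw [Module.End.mul_apply, hR.base, hR.base, ← Module.End.mul_apply, hQA, LinearMap.zero_apply,
      map_zero]
  · rw [gradedCommutator_sq (t := i) (by ring) 2 rfl, hR.commutator_of_mem he hx rfl,
      gradedCommutator_neg_right, hR.commutator_of_mem he (𝔏.δ_mem i x hx) (by ring), 𝔏.δ_δ]
    simp

/-- The graded Jacobi identity; the minus sign of `[R, ∂_x] = -∂_{δx}` combines with the sign of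
exchanging the two odd fields. -/
theorem IsLinearField.commutator_actionField (hR : IsLinearField 𝔉 𝔏 e QA R)
    (he : 𝔏.IsHomogeneousBasis e) {i : ℤ} {x : L} (hx : x ∈ 𝔏.deg i) :
    gradedCommutator 2 (i - 1) (gradedCommutator 1 1 R Q) (constantField 𝔉 e x)
      = gradedCommutator 1 i R (gradedCommutator 1 (i - 1) Q (constantField 𝔉 e x))
        - gradedCommutator 1 i Q (constantField 𝔉 e (𝔏.δ x)) := by
  have h1 := gradedCommutator_jacobi (p := 1) (q := 1) (r := i - 1) (s := i) (t := 2) (u := i)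
    (by ring) (by ring) (by ring) R Q (constantField 𝔉 e x)
  rw [hR.commutator_of_mem he hx rfl, gradedCommutator_neg_right] at h1
  rw [h1]
  simp

/-- The field `Q` of the transformation algebroid commutes with `R` if and only if `μ` is
compatible with the differentials. -/
theorem IsLinearField.commutator_eq_zero_iff (hR : IsLinearField 𝔉 𝔏 e QA R)
    (hQ : IsActionField 𝔉 𝔏 e μ Q) (he : 𝔏.IsHomogeneousBasis e) :
    gradedCommutator 1 1 R Q = 0 ↔
      ∀ (i : ℤ), ∀ x ∈ 𝔏.deg i, μ (𝔏.δ x) = gradedCommutator 1 i QA (μ x) := by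
  -- On base functions the commutator measures exactly the failure of `μ` to intertwine the
  -- differentials. This alone gives the forward direction, as base functions embed injectively.
  have hbase : ∀ (i : ℤ), ∀ x ∈ 𝔏.deg i, ∀ f, gradedCommutator 2 (i - 1) (gradedCommutator 1 1 R Q)
      (constantField 𝔉 e x) (𝔉.base f)
        = 𝔉.base (gradedCommutator 1 i QA (μ x) f) - 𝔉.base (μ (𝔏.δ x) f) := by
    intro i x hx f
    have hδ := hQ.base_of_mem he (𝔏.δ_mem i x hx) f
    rw [add_sub_cancel_right] at hδ
    rw [hR.commutator_actionField he hx, LinearMap.sub_apply, hδ]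
    congr 1
    rw [gradedCommutator_apply 1 i, gradedCommutator_apply 1 i, hQ.base_of_mem he hx, hR.base,
      hR.base, hQ.base_of_mem he hx, map_sub, LinearMap.map_intUnits_smul]
  constructor
  · intro h i x hx
    ext f
    apply 𝔉.base_injective
    have := hbase i x hx f
    rw [h, gradedCommutator_zero_left, LinearMap.zero_apply] at this
    exact (sub_eq_zero.mp this.symm).symm
  · intro h
    refine eq_zero_of_commutator_constantField_of_raises (𝔉 := 𝔉) (r := 0) he
      (hR.raises.commutator hQ.raises _ _) 2 fun i x hx => ?_
    have hδx := 𝔏.δ_mem i x hx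
    refine eq_zero_of_commutator_constantField (𝔉 := 𝔉) (r := 0) he ?_ (fun f => ?_) (i + 1)
      fun j y hy => ?_
    · rw [hR.commutator_actionField he hx]
      have := hQ.raises_of_mem he hδx
      rw [add_sub_cancel_right] at this
      exact (hR.raises.commutator (hQ.raises_of_mem he hx) _ _).sub this
    · rw [hbase i x hx, h i x hx, sub_self]
    -- The second commutator vanishes without any condition relating `μ` to `δ`: it is the
    -- derivation property of `δ` on the bracket of `L`.
    · rw [hR.commutator_actionField he hx, gradedCommutator_sub_left]
      have h2 := hQ.commutator_of_mem he hδx hy rfl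
      rw [add_sub_cancel_right] at h2
      have h1 := gradedCommutator_jacobi (p := 1) (q := i) (r := j - 1) rfl (t := i + 1)
        (by ring) (u := j) (by ring) R (gradedCommutator 1 (i - 1) Q (constantField 𝔉 e x))
        (constantField 𝔉 e y)
      have hxy := 𝔏.bracket_mem i j x hx y hy
      rw [hQ.commutator_of_mem he hx hy rfl, gradedCommutator_units_right,
        hR.commutator_of_mem he hxy (by ring), hR.commutator_of_mem he hy rfl,
        gradedCommutator_neg_right, hQ.commutator_of_mem he hx (𝔏.δ_mem j y hy) (by ring),
        ← sub_eq_iff_eq_add, 𝔏.δ_bracket i x hx y, map_add] at h1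
      rw [h2, ← h1]
      rw [LinearMap.map_intUnits_smul, Int.negOnePow_succ, one_mul]
      simp only [smul_neg, smul_add, Units.neg_smul, neg_add]
      abel

end Fields

/-! ### Homogeneous sections -/

section Sections

variable {C : Type*} [Ring C] [Algebra ℝ C] {𝒞 : ℕ → Submodule ℝ C}
  {ι κ : Type*} [DecidableEq (ι ⊕ κ)]

theorem isSectionOfDegree_single {m p : ℤ} {j : ι ⊕ κ} {f : C} (hf : f ∈ intDegree 𝒞 m)
    (hp : p = m + fiberDegree j) : IsSectionOfDegree 𝒞 p (Pi.single j f) := by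
  intro k
  rcases eq_or_ne k j with rfl | h
  · rw [Pi.single_eq_same, hp, add_sub_cancel_right]; exact hf
  · rw [Pi.single_eq_of_ne h]; exact zero_mem _

variable [Fintype ι] [Fintype κ]

theorem IsSectionOfDegree.induction {p : ℤ} {P : (ι ⊕ κ → C) → Prop}
    (single : ∀ (j : ι ⊕ κ) (m : ℤ) (f : C), f ∈ intDegree 𝒞 m → p = m + fiberDegree j →
      P (Pi.single j f))
    (zero : P 0) (add : ∀ a b, P a → P b → P (a + b)) {a : ι ⊕ κ → C}
    (ha : IsSectionOfDegree 𝒞 p a) : P a := by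
  rw [← Finset.univ_sum_single a]
  refine Finset.sum_induction _ P add zero fun j _ => single j _ _ (ha j) (by ring)

theorem section_induction [GradedAlgebra 𝒞] {P : (ι ⊕ κ → C) → Prop}
    (homogeneous : ∀ (p : ℤ) (a : ι ⊕ κ → C), IsSectionOfDegree 𝒞 p a → P a)
    (add : ∀ a b, P a → P b → P (a + b)) (a : ι ⊕ κ → C) : P a := by
  have zero : P 0 := homogeneous 0 0 fun _ => zero_mem _
  rw [← Finset.univ_sum_single a]
  refine Finset.sum_induction _ P add zero fun j _ => ?_
  induction a j using DirectSum.Decomposition.inductionOn 𝒞 with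
  | zero => rw [Pi.single_zero]; exact zero
  | add f g hf hg => rw [Pi.single_add]; exact add _ _ hf hg
  | @homogeneous m f =>
    exact homogeneous _ _ (isSectionOfDegree_single (mem_intDegree_of_mem f.2 rfl) rfl)

end Sections

theorem IsVectorField.map_one {B : Type*} [Ring B] [Algebra ℝ B] {𝒢 : ℕ → Submodule ℝ B} {d : ℤ}
    {X : Module.End ℝ B} (hX : IsVectorField 𝒢 d X) (h1 : (1 : B) ∈ 𝒢 0) : X 1 = 0 := by
  have h := hX.leibniz 0 1 h1 1
  simpa using h

theorem signTwist_mem_intDegree {B : Type*} [Ring B] [Algebra ℝ B] (𝒢 : ℕ → Submodule ℝ B)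
    [GradedAlgebra 𝒢] (d : ℤ) {k : ℤ} {f : B} (hf : f ∈ intDegree 𝒢 k) :
    signTwist 𝒢 d f ∈ intDegree 𝒢 k := by
  rw [signTwist_apply_of_mem 𝒢 d hf]; exact units_smul_mem _ hf

theorem signTwist_one_signTwist_one {B : Type*} [Ring B] [Algebra ℝ B] (𝒢 : ℕ → Submodule ℝ B)
    [GradedAlgebra 𝒢] (f : B) : signTwist 𝒢 1 (signTwist 𝒢 1 f) = f := by
  induction f using DirectSum.Decomposition.inductionOn 𝒢 with
  | zero => simp
  | add f g hf hg => rw [map_add, map_add, hf, hg]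
  | @homogeneous m f =>
    rw [signTwist_apply_of_mem 𝒢 1 (mem_intDegree_of_mem f.2 rfl), LinearMap.map_intUnits_smul,
      signTwist_apply_of_mem 𝒢 1 (mem_intDegree_of_mem f.2 rfl), smul_smul, Int.units_mul_self,
      one_smul]

theorem signTwist_one_mul {B : Type*} [Ring B] [Algebra ℝ B] {𝒢 : ℕ → Submodule ℝ B}
    [GradedAlgebra 𝒢] (h𝒢 : IsGradedCommutative 𝒢) {k : ℤ} {f : B} (hf : f ∈ intDegree 𝒢 k)
    (g : B) : signTwist 𝒢 1 (f * g) = (k.negOnePow : ℤˣ) • (f * signTwist 𝒢 1 g) := by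
  induction g using DirectSum.Decomposition.inductionOn 𝒢 with
  | zero => simp
  | add g g' hg hg' => rw [mul_add, map_add, hg, hg', map_add, mul_add, smul_add]
  | @homogeneous m g =>
    have hg := mem_intDegree_of_mem g.2 rfl
    rw [signTwist_apply_of_mem 𝒢 1 (h𝒢.mul_mem_int hf hg), signTwist_apply_of_mem 𝒢 1 hg,
      mul_smul_comm, Int.negOnePow_smul_smul, one_mul, one_mul]

/-! ### The transformation algebroid on simple sections -/

namespace DGLA

variable {C : Type*} [Ring C] [Algebra ℝ C] {𝒞 : ℕ → Submodule ℝ C} [GradedAlgebra 𝒞]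
  {ι κ : Type*} {L : Type*} [AddCommGroup L] [Module ℝ L] {𝔏 : DGLA L}
  {e : Module.Basis (ι ⊕ κ) ℝ L} {μ : L →ₗ[ℝ] Module.End ℝ C}

theorem IsHomogeneousBasis.repr_eq_zero (he : 𝔏.IsHomogeneousBasis e) {i : ℤ} {x : L}
    (hx : x ∈ 𝔏.deg i) {k : ι ⊕ κ} (hk : fiberDegree k ≠ i) : e.repr x k = 0 := by
  classical
  refine he.induction (P := fun x => e.repr x k = 0) ?_ (by simp) ?_ ?_ hx
  · rintro j rfl
    rw [e.repr_self, Finsupp.single_apply, if_neg]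
    rintro rfl
    exact hk rfl
  · intro x y hx hy
    rw [map_add, Finsupp.add_apply, hx, hy, add_zero]
  · intro c x hx
    rw [map_smul, Finsupp.smul_apply, hx, smul_zero]

variable [Fintype ι] [Fintype κ]

variable (𝒞 𝔏 e μ)

theorem transformationAlgebroid_bracket_apply (a b : ι ⊕ κ → C) (k : ι ⊕ κ) :
    (𝔏.transformationAlgebroid 𝒞 e μ).bracket a b k =
      (∑ i, a i * μ (e i) (b k))
      + (∑ i, ∑ j, e.repr (𝔏.bracket (e i) (e j)) k • (a i * signTwist 𝒞 (fiberDegree i) (b j)))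
      - ∑ j, ((fiberDegree k * fiberDegree j).negOnePow : ℤˣ) •
          (μ (e j) (signTwist 𝒞 (fiberDegree j) (a k))
            * signTwist 𝒞 (fiberDegree k + fiberDegree j) (b j)) := rfl

theorem transformationAlgebroid_anchor (a : ι ⊕ κ → C) :
    (𝔏.transformationAlgebroid 𝒞 e μ).anchor a
      = ∑ j, LinearMap.mulLeft ℝ (a j) * μ (e j) := rfl

variable {𝒞 𝔏 e μ}

theorem transformationAlgebroid_anchor_single [DecidableEq (ι ⊕ κ)] (j : ι ⊕ κ) (f : C) :
    (𝔏.transformationAlgebroid 𝒞 e μ).anchor (Pi.single j f)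
      = LinearMap.mulLeft ℝ f * μ (e j) := by
  rw [transformationAlgebroid_anchor, Finset.sum_eq_single j, Pi.single_eq_same]
  · intro i _ h
    rw [Pi.single_eq_of_ne h]
    ext; simp
  · simp

/-- The coordinate formula collapses to the three-term bracket of `f v` and `g w`. In the last term
`g` stands to the right of `μ(w)(f)`; this exchange turns the sign `(|f| + |v|)(|g| + |w|)` into the
one written here. -/
theorem transformationAlgebroid_bracket_single [DecidableEq (ι ⊕ κ)] (v w : ι ⊕ κ) {m n : ℤ}
    {f g : C} (hf : f ∈ intDegree 𝒞 m) (hg : g ∈ intDegree 𝒞 n) :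
    (𝔏.transformationAlgebroid 𝒞 e μ).bracket (Pi.single v f) (Pi.single w g)
      = Pi.single w (f * μ (e v) g)
        + ((fiberDegree v * n).negOnePow : ℤˣ) •
          ∑ k, e.repr (𝔏.bracket (e v) (e w)) k • Pi.single k (f * g)
        - ((fiberDegree v * fiberDegree w + fiberDegree w * m
            + (fiberDegree v + fiberDegree w) * n).negOnePow : ℤˣ) •
          Pi.single v (μ (e w) f * g) := by
  have key : ∀ (d : ℤ) (j : ι ⊕ κ), j ≠ w → signTwist 𝒞 d ((Pi.single w g : ι ⊕ κ → C) j) = 0 :=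
    fun d j h => by rw [Pi.single_eq_of_ne h, map_zero]
  ext k
  rw [transformationAlgebroid_bracket_apply]
  simp only [Pi.add_apply, Pi.sub_apply, Pi.smul_apply, Finset.sum_apply]
  congr 1
  · congr 1
    · rw [Finset.sum_eq_single v (fun i _ h => by rw [Pi.single_eq_of_ne h, zero_mul]) (by simp),
        Pi.single_eq_same]
      rcases eq_or_ne k w with rfl | h
      · rw [Pi.single_eq_same, Pi.single_eq_same]
      · rw [Pi.single_eq_of_ne h, Pi.single_eq_of_ne h, map_zero, mul_zero]
    · rw [Finset.sum_eq_single v (fun i _ h => Finset.sum_eq_zero fun j _ => by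
          rw [Pi.single_eq_of_ne h, zero_mul, smul_zero]) (by simp),
        Finset.sum_eq_single w (fun j _ h => by rw [key _ j h, mul_zero, smul_zero]) (by simp),
        Finset.sum_eq_single k (fun j _ h => by rw [Pi.single_eq_of_ne h.symm, smul_zero]) (by simp),
        Pi.single_eq_same, Pi.single_eq_same, Pi.single_eq_same, signTwist_apply_of_mem 𝒞 _ hg,
        mul_smul_comm, real_smul_units_smul]
  · rw [Finset.sum_eq_single w (fun j _ h => by rw [key _ j h, mul_zero, smul_zero]) (by simp),
      Pi.single_eq_same]
    rcases eq_or_ne k v with rfl | h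
    · rw [Pi.single_eq_same, Pi.single_eq_same, signTwist_apply_of_mem 𝒞 _ hg,
        signTwist_apply_of_mem 𝒞 _ hf, LinearMap.map_intUnits_smul, smul_mul_assoc, mul_smul_comm,
        Int.negOnePow_smul_smul, Int.negOnePow_smul_smul, add_assoc]
    · rw [Pi.single_eq_of_ne h, Pi.single_eq_of_ne h, map_zero, map_zero, zero_mul, smul_zero,
        smul_zero]

theorem transformationAlgebroid_bracket_mem (h𝒞 : IsGradedCommutative 𝒞)
    (he : 𝔏.IsHomogeneousBasis e) (hμ : 𝔏.IsGradedLieHom 𝒞 μ) {p q : ℤ} {a b : ι ⊕ κ → C}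
    (ha : IsSectionOfDegree 𝒞 p a) (hb : IsSectionOfDegree 𝒞 q b) :
    IsSectionOfDegree 𝒞 (p + q) ((𝔏.transformationAlgebroid 𝒞 e μ).bracket a b) := by
  intro k
  rw [transformationAlgebroid_bracket_apply]
  have hμj := fun j => hμ.map_mem _ _ (he.mem j)
  refine sub_mem (add_mem (sum_mem fun i _ => ?_) (sum_mem fun i _ => sum_mem fun j _ => ?_))
    (sum_mem fun j _ => units_smul_mem _ ?_)
  · have := h𝒞.mul_mem_int (ha i) ((hμj i).map_mem_int (hb k))
    rwa [show p - fiberDegree i + (q - fiberDegree k + fiberDegree i) = p + q - fiberDegree k by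
      ring] at this
  · by_cases h : fiberDegree k = fiberDegree i + fiberDegree j
    · have := h𝒞.mul_mem_int (ha i) (signTwist_mem_intDegree 𝒞 (fiberDegree i) (hb j))
      rw [show p - fiberDegree i + (q - fiberDegree j) = p + q - fiberDegree k by rw [h]; ring]
        at this
      exact Submodule.smul_mem _ _ this
    · rw [he.repr_eq_zero (𝔏.bracket_mem _ _ _ (he.mem i) _ (he.mem j)) h, zero_smul]
      exact zero_mem _
  · have := h𝒞.mul_mem_int ((hμj j).map_mem_int (signTwist_mem_intDegree 𝒞 (fiberDegree j) (ha k)))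
      (signTwist_mem_intDegree 𝒞 (fiberDegree k + fiberDegree j) (hb j))
    rwa [show p - fiberDegree k + fiberDegree j + (q - fiberDegree j) = p + q - fiberDegree k by
      ring] at this

theorem transformationAlgebroid_anchor_mem (h𝒞 : IsGradedCommutative 𝒞)
    (he : 𝔏.IsHomogeneousBasis e) (hμ : 𝔏.IsGradedLieHom 𝒞 μ) {p : ℤ} {a : ι ⊕ κ → C}
    (ha : IsSectionOfDegree 𝒞 p a) :
    IsVectorField 𝒞 p ((𝔏.transformationAlgebroid 𝒞 e μ).anchor a) := by
  rw [transformationAlgebroid_anchor]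
  refine IsVectorField.sum _ fun j _ => ?_
  have := (hμ.map_mem _ _ (he.mem j)).mulLeft_mul h𝒞 (ha j)
  rwa [sub_add_cancel] at this

end DGLA

/-! ### Vertical fields of sections -/

namespace FiberModel

variable {C : Type*} [Ring C] [Algebra ℝ C] {𝒞 : ℕ → Submodule ℝ C} [GradedAlgebra 𝒞]
  {B : Type*} [Ring B] [Algebra ℝ B] {ι κ : Type*} [Fintype ι] [Fintype κ]
  (𝔉 : FiberModel 𝒞 B ι κ)

/-- The vertical vector field defined by a section. -/
noncomputable def vertical : (ι ⊕ κ → C) →ₗ[ℝ] Module.End ℝ B where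
  toFun a := ∑ j, LinearMap.mulLeft ℝ (𝔉.base (signTwist 𝒞 1 (a j))) * 𝔉.D j
  map_add' a b := by
    rw [← Finset.sum_add_distrib]
    refine Finset.sum_congr rfl fun j _ => ?_
    ext x
    simp [add_mul]
  map_smul' c a := by
    rw [Finset.smul_sum]
    refine Finset.sum_congr rfl fun j _ => ?_
    ext x
    simp

theorem vertical_apply (a : ι ⊕ κ → C) :
    𝔉.vertical a = ∑ j, LinearMap.mulLeft ℝ (𝔉.base (signTwist 𝒞 1 (a j))) * 𝔉.D j := rfl

theorem mulLeft_units_smul (u : ℤˣ) (x : B) (X : Module.End ℝ B) :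
    LinearMap.mulLeft ℝ (u • x) * X = u • (LinearMap.mulLeft ℝ x * X) := by
  ext y; simp [smul_mul_assoc]

theorem vertical_single [DecidableEq (ι ⊕ κ)] (j : ι ⊕ κ) {m : ℤ} {f : C}
    (hf : f ∈ intDegree 𝒞 m) :
    𝔉.vertical (Pi.single j f)
      = (m.negOnePow : ℤˣ) • (LinearMap.mulLeft ℝ (𝔉.base f) * 𝔉.D j) := by
  rw [vertical_apply, Finset.sum_eq_single j, Pi.single_eq_same, signTwist_apply_of_mem 𝒞 1 hf,
    LinearMap.map_intUnits_smul, one_mul, mulLeft_units_smul]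
  · intro i _ h
    rw [Pi.single_eq_of_ne h]
    ext; simp
  · simp

/-- Applying the field to the coordinate `ξ^k` returns the `k`-th coefficient up to the sign twist.
Identities between sections can therefore be checked between vector fields. -/
theorem vertical_injective : Function.Injective 𝔉.vertical := by
  intro a b h
  have h1 : ∀ (a : ι ⊕ κ → C) k, 𝔉.vertical a (𝔉.coord k) = 𝔉.base (signTwist 𝒞 1 (a k)) := by
    intro a k
    rw [vertical_apply, LinearMap.sum_apply, Finset.sum_eq_single k]
    · simp [𝔉.D_coord_self]
    · intro j _ hj
      simp [𝔉.D_coord_of_ne hj]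
    · simp
  ext k
  rw [← signTwist_one_signTwist_one 𝒞 (a k), ← signTwist_one_signTwist_one 𝒞 (b k)]
  congr 1
  apply 𝔉.base_injective
  rw [← h1, ← h1, h]

theorem vertical_smul (h𝒞 : IsGradedCommutative 𝒞) {k : ℤ} {f : C} (hf : f ∈ intDegree 𝒞 k)
    (a : ι ⊕ κ → C) :
    𝔉.vertical (f • a) = (k.negOnePow : ℤˣ) • (LinearMap.mulLeft ℝ (𝔉.base f) * 𝔉.vertical a) := by
  rw [vertical_apply, vertical_apply, Finset.mul_sum, Finset.smul_sum]
  refine Finset.sum_congr rfl fun j _ => ?_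
  rw [Pi.smul_apply, smul_eq_mul, signTwist_one_mul h𝒞 hf, LinearMap.map_intUnits_smul,
    𝔉.base_mul, mulLeft_units_smul, LinearMap.mulLeft_mul]
  rfl

theorem isVectorField_vertical {p : ℤ} {a : ι ⊕ κ → C} (ha : IsSectionOfDegree 𝒞 p a) :
    IsVectorField 𝔉.degree (p - 1) (𝔉.vertical a) := by
  rw [vertical_apply]
  refine IsVectorField.sum _ fun j _ => ?_
  have := (𝔉.isVectorField_D j).mulLeft_mul 𝔉.comm
    (𝔉.base_mem (signTwist_mem_intDegree 𝒞 1 (ha j)))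
  rwa [show p - fiberDegree j + (fiberDegree j - 1) = p - 1 by ring] at this

theorem vertical_base (a : ι ⊕ κ → C) (f : C) : 𝔉.vertical a (𝔉.base f) = 0 := by
  rw [vertical_apply, LinearMap.sum_apply]
  refine Finset.sum_eq_zero fun j _ => ?_
  simp [𝔉.D_base]

/-- The coefficients are base functions, which vertical fields kill, and the partial derivatives
graded-commute. -/
theorem commutator_vertical_vertical {p q : ℤ} {a b : ι ⊕ κ → C} (ha : IsSectionOfDegree 𝒞 p a)
    (hb : IsSectionOfDegree 𝒞 q b) :
    gradedCommutator (p - 1) (q - 1) (𝔉.vertical a) (𝔉.vertical b) = 0 := by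
  rw [𝔉.vertical_apply b, gradedCommutator_sum_right]
  refine Finset.sum_eq_zero fun k _ => ?_
  rw [gradedCommutator_mulLeft_right (𝔉.isVectorField_vertical ha)
    (𝔉.base_mem (signTwist_mem_intDegree 𝒞 1 (hb k))) (q := fiberDegree k - 1) (by ring),
    vertical_base, 𝔉.vertical_apply a, gradedCommutator_sum_left, Finset.sum_eq_zero]
  · simp
  · intro j _
    rw [gradedCommutator_mulLeft_left (𝔉.isVectorField_D k)
      (𝔉.base_mem (signTwist_mem_intDegree 𝒞 1 (ha j))) (p := fiberDegree j - 1) (by ring),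
      𝔉.D_base, 𝔉.commutator_D_D]
    simp

end FiberModel

/-- Compares two signs through an explicit half-difference `k` of the exponents, so that only a
polynomial identity is left to check. -/
theorem Int.negOnePow_congr {m n : ℤ} (k : ℤ) (h : m = n + 2 * k) : m.negOnePow = n.negOnePow := by
  rw [h, Int.negOnePow_add, Int.negOnePow_even _ (even_two_mul k), mul_one]

theorem FiberModel.mulLeft_mul_mul {B : Type*} [Ring B] [Algebra ℝ B] (x y : B)
    (X : Module.End ℝ B) :
    LinearMap.mulLeft ℝ x * (LinearMap.mulLeft ℝ y * X) = LinearMap.mulLeft ℝ (x * y) * X := by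
  ext z; simp

/-! ### The bracket of the transformation algebroid as a derived bracket -/

section Encoding

open FiberModel DGLA

variable {C : Type*} [Ring C] [Algebra ℝ C] {𝒞 : ℕ → Submodule ℝ C}
  {B : Type*} [Ring B] [Algebra ℝ B] {ι κ : Type*}
  {𝔉 : FiberModel 𝒞 B ι κ} {L : Type*} [AddCommGroup L] [Module ℝ L] {𝔏 : DGLA L}
  {e : Module.Basis (ι ⊕ κ) ℝ L} {μ : L →ₗ[ℝ] Module.End ℝ C} {Q : Module.End ℝ B}

/-- Only one half of the commutator survives on base functions, so the derivatives of `Q f` are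
known even though `Q f` itself is not described. -/
theorem IsActionField.partialDeriv_base (hQ : IsActionField 𝔉 𝔏 e μ Q) (j : ι ⊕ κ) (f : C) :
    𝔉.D j (Q (𝔉.base f)) = ((fiberDegree j).negOnePow : ℤˣ) • 𝔉.base (μ (e j) f) := by
  rw [← hQ.base j f, gradedCommutator_apply, 𝔉.D_base, map_zero, zero_sub, one_mul,
    Int.negOnePow_sub, Int.negOnePow_one, mul_neg, mul_one, Units.neg_smul, neg_neg,
    smul_smul, Int.units_mul_self, one_smul]

/-- Up to sign, `[Q, ι_{f v}]` splits as `Q(f) ∂_v` and `f [Q, ∂_v]`. The bracket of the first piece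
with `g ∂_w` gives the term with `μ(w)(f)`, because `∂_w` differentiates `Q(f)`. -/
theorem IsActionField.commutator_mulLeft_partialDeriv (hQ : IsActionField 𝔉 𝔏 e μ Q)
    (hQV : IsVectorField 𝔉.degree 1 Q) (v w : ι ⊕ κ) {m n p q : ℤ}
    {f g : C} (hf : f ∈ intDegree 𝒞 m) (hg : g ∈ intDegree 𝒞 n)
    (hwf : μ (e w) f ∈ intDegree 𝒞 (m + fiberDegree w)) (hp : p = m + fiberDegree v)
    (hq : q = n + (fiberDegree w - 1)) :
    gradedCommutator p q (LinearMap.mulLeft ℝ (Q (𝔉.base f)) * 𝔉.D v)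
      (LinearMap.mulLeft ℝ (𝔉.base g) * 𝔉.D w)
      = ((p * n + (p * (fiberDegree w - 1) + fiberDegree w + 1 + n * (m + fiberDegree w))).negOnePow
          : ℤˣ) • (LinearMap.mulLeft ℝ (𝔉.base (μ (e w) f * g)) * 𝔉.D v) := by
  have hQf := hQV.map_mem_int (𝔉.base_mem hf)
  have hX := (𝔉.isVectorField_D v).mulLeft_mul 𝔉.comm hQf
  rw [show m + 1 + (fiberDegree v - 1) = p by rw [hp]; ring] at hX
  have h0 : gradedCommutator p (fiberDegree w - 1) (LinearMap.mulLeft ℝ (Q (𝔉.base f)) * 𝔉.D v)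
      (𝔉.D w) = ((p * (fiberDegree w - 1) + fiberDegree w + 1).negOnePow : ℤˣ) •
        (LinearMap.mulLeft ℝ (𝔉.base (μ (e w) f)) * 𝔉.D v) := by
    rw [gradedCommutator_mulLeft_left (𝔉.isVectorField_D w) hQf (p := fiberDegree v - 1)
      (by rw [hp]; ring), 𝔉.commutator_D_D, hQ.partialDeriv_base, mul_zero, mulLeft_units_smul,
      Int.negOnePow_smul_smul, zero_sub, Int.negOnePow_succ, Units.neg_smul]
  rw [gradedCommutator_mulLeft_right hX (𝔉.base_mem hg) hq, h0, Module.End.mul_apply, 𝔉.D_base,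
    map_zero, LinearMap.mulLeft_zero_eq_zero, zero_mul, zero_add, mul_smul_comm, mulLeft_mul_mul,
    𝔉.comm.mul_comm_int (𝔉.base_mem hg) (𝔉.base_mem hwf), mulLeft_units_smul, 𝔉.base_mul,
    Int.negOnePow_smul_smul, Int.negOnePow_smul_smul, add_assoc]

/-- The second piece of `[Q, ι_{f v}]`. It differentiates `g`, giving `f μ(v)(g) ∂_w`, and its
double commutator gives the bracket of `L`. -/
theorem IsActionField.commutator_mulLeft_commutator (hQ : IsActionField 𝔉 𝔏 e μ Q)
    (hQV : IsVectorField 𝔉.degree 1 Q) (v w : ι ⊕ κ) {m n p q : ℤ}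
    {f g : C} (hf : f ∈ intDegree 𝒞 m) (hg : g ∈ intDegree 𝒞 n) (hp : p = m + fiberDegree v)
    (hq : q = n + (fiberDegree w - 1)) :
    gradedCommutator p q (LinearMap.mulLeft ℝ (𝔉.base f)
        * gradedCommutator 1 (fiberDegree v - 1) Q (𝔉.D v))
      (LinearMap.mulLeft ℝ (𝔉.base g) * 𝔉.D w)
      = LinearMap.mulLeft ℝ (𝔉.base (f * μ (e v) g)) * 𝔉.D w
        + ((p * n + (fiberDegree v + n * m)).negOnePow : ℤˣ) •
          (LinearMap.mulLeft ℝ (𝔉.base (f * g))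
            * constantField 𝔉 e (𝔏.bracket (e v) (e w))) := by
  have hX := (hQV.commutator (𝔉.isVectorField_D v)).mulLeft_mul 𝔉.comm (𝔉.base_mem hf)
  rw [show m + (1 + (fiberDegree v - 1)) = p by rw [hp]; ring] at hX
  rw [gradedCommutator_mulLeft_right hX (𝔉.base_mem hg) hq,
    gradedCommutator_mulLeft_left (𝔉.isVectorField_D w) (𝔉.base_mem hf) hp, hQ.commutator,
    𝔉.D_base, Module.End.mul_apply, hQ.base, LinearMap.mulLeft_zero_eq_zero, zero_mul, smul_zero,
    sub_zero, mul_smul_comm, mul_smul_comm, mulLeft_mul_mul,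
    𝔉.comm.mul_comm_int (𝔉.base_mem hg) (𝔉.base_mem hf), mulLeft_units_smul, 𝔉.base_mul,
    𝔉.base_mul, LinearMap.mulLeft_apply, Int.negOnePow_smul_smul, Int.negOnePow_smul_smul,
    add_assoc]

variable [Fintype ι] [Fintype κ]

theorem constantField_eq_sum (x : L) : constantField 𝔉 e x = ∑ k, e.repr x k • 𝔉.D k := by
  conv_lhs => rw [← e.sum_repr x]
  rw [map_sum]
  refine Finset.sum_congr rfl fun k _ => ?_
  rw [map_smul, constantField_basis]

variable [GradedAlgebra 𝒞]

/-- The vertical field of a section of `C ⊗ L` of the form `f x`. -/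
theorem FiberModel.vertical_sum_single [DecidableEq (ι ⊕ κ)] {m : ℤ} {f : C}
    (hf : f ∈ intDegree 𝒞 m) (x : L) :
    𝔉.vertical (∑ k, e.repr x k • Pi.single k f)
      = (m.negOnePow : ℤˣ) • (LinearMap.mulLeft ℝ (𝔉.base f) * constantField 𝔉 e x) := by
  rw [map_sum, constantField_eq_sum, Finset.mul_sum, Finset.smul_sum]
  refine Finset.sum_congr rfl fun k _ => ?_
  rw [map_smul, 𝔉.vertical_single k hf, mul_smul_comm, real_smul_units_smul]

namespace IsActionField

theorem commutator_vertical_single [DecidableEq (ι ⊕ κ)] (hQV : IsVectorField 𝔉.degree 1 Q)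
    (v : ι ⊕ κ) {m : ℤ} {f : C} (hf : f ∈ intDegree 𝒞 m) {s : ℤ} (hs : s = m + (fiberDegree v - 1)) :
    gradedCommutator 1 s Q (𝔉.vertical (Pi.single v f))
      = (m.negOnePow : ℤˣ) • (LinearMap.mulLeft ℝ (Q (𝔉.base f)) * 𝔉.D v)
        + LinearMap.mulLeft ℝ (𝔉.base f) * gradedCommutator 1 (fiberDegree v - 1) Q (𝔉.D v) := by
  rw [𝔉.vertical_single v hf, gradedCommutator_units_right,
    gradedCommutator_mulLeft_right hQV (𝔉.base_mem hf) hs, smul_add, one_mul, smul_smul,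
    Int.units_mul_self, one_smul]

theorem anchor_eq (hQ : IsActionField 𝔉 𝔏 e μ Q) (hQV : IsVectorField 𝔉.degree 1 Q) {p : ℤ}
    {a : ι ⊕ κ → C} (ha : IsSectionOfDegree 𝒞 p a) (f : C) :
    𝔉.base ((𝔏.transformationAlgebroid 𝒞 e μ).anchor a f)
      = gradedCommutator 1 (p - 1) Q (𝔉.vertical a) (𝔉.base f) := by
  classical
  refine ha.induction (P := fun a => 𝔉.base ((𝔏.transformationAlgebroid 𝒞 e μ).anchor a f)
      = gradedCommutator 1 (p - 1) Q (𝔉.vertical a) (𝔉.base f)) ?_ ?_ ?_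
  · rintro j m g hg rfl
    rw [transformationAlgebroid_anchor_single,
      commutator_vertical_single hQV j hg (by ring), LinearMap.add_apply, LinearMap.smul_apply,
      Module.End.mul_apply, Module.End.mul_apply, Module.End.mul_apply, hQ.base, 𝔉.D_base]
    simp [𝔉.base_mul]
  · simp
  · intro a b ha hb
    rw [map_add, map_add, LinearMap.add_apply, map_add, gradedCommutator_add_right,
      LinearMap.add_apply, ha, hb]

theorem bracket_eq_single [DecidableEq (ι ⊕ κ)] (hQ : IsActionField 𝔉 𝔏 e μ Q)
    (hQV : IsVectorField 𝔉.degree 1 Q) (h𝒞 : IsGradedCommutative 𝒞)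
    (he : 𝔏.IsHomogeneousBasis e) (hμ : 𝔏.IsGradedLieHom 𝒞 μ) (v w : ι ⊕ κ) {m n p q : ℤ}
    {f g : C} (hf : f ∈ intDegree 𝒞 m) (hg : g ∈ intDegree 𝒞 n) (hp : p = m + fiberDegree v)
    (hq : q = n + fiberDegree w) :
    𝔉.vertical ((𝔏.transformationAlgebroid 𝒞 e μ).bracket (Pi.single v f) (Pi.single w g))
      = (p.negOnePow : ℤˣ) • gradedCommutator p (q - 1)
          (gradedCommutator 1 (p - 1) Q (𝔉.vertical (Pi.single v f)))
          (𝔉.vertical (Pi.single w g)) := by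
  have hvg := (hμ.map_mem _ _ (he.mem v)).map_mem_int hg
  have hwf := (hμ.map_mem _ _ (he.mem w)).map_mem_int hf
  rw [transformationAlgebroid_bracket_single v w hf hg, map_sub, map_add,
    LinearMap.map_intUnits_smul, LinearMap.map_intUnits_smul,
    𝔉.vertical_single w (h𝒞.mul_mem_int hf hvg), 𝔉.vertical_single v (h𝒞.mul_mem_int hwf hg),
    vertical_sum_single (h𝒞.mul_mem_int hf hg),
    commutator_vertical_single hQV v hf (by rw [hp]; ring), 𝔉.vertical_single w hg,
    gradedCommutator_units_right, gradedCommutator_add_left, gradedCommutator_units_left,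
    hQ.commutator_mulLeft_partialDeriv hQV v w hf hg hwf hp (by rw [hq]; ring),
    hQ.commutator_mulLeft_commutator hQV v w hf hg hp (by rw [hq]; ring),
    sub_eq_add_neg, ← Units.neg_smul, ← Int.negOnePow_succ]
  simp only [smul_add, Int.negOnePow_smul_smul]
  -- After exchanging the two groups of terms, the summands match one by one. The witnesses are half
  -- the differences of the exponents, with `p = |f| + |v|` substituted.
  refine (add_comm _ _).trans (congr_arg₂ _ ?_ (congr_arg₂ _ ?_ ?_))
  · exact congr_arg (· • _) (Int.negOnePow_congr (-(m * n)) (by rw [hp]; ring))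
  · exact congr_arg (· • _) (Int.negOnePow_congr 0 (by rw [hp]; ring))
  · exact congr_arg (· • _) (Int.negOnePow_congr (-(m * n + fiberDegree v)) (by rw [hp]; ring))

theorem bracket_eq (hQ : IsActionField 𝔉 𝔏 e μ Q)
    (hQV : IsVectorField 𝔉.degree 1 Q) (h𝒞 : IsGradedCommutative 𝒞)
    (he : 𝔏.IsHomogeneousBasis e) (hμ : 𝔏.IsGradedLieHom 𝒞 μ) {p q : ℤ} {a b : ι ⊕ κ → C}
    (ha : IsSectionOfDegree 𝒞 p a) (hb : IsSectionOfDegree 𝒞 q b) :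
    𝔉.vertical ((𝔏.transformationAlgebroid 𝒞 e μ).bracket a b)
      = (p.negOnePow : ℤˣ) • gradedCommutator p (q - 1)
          (gradedCommutator 1 (p - 1) Q (𝔉.vertical a)) (𝔉.vertical b) := by
  classical
  refine ha.induction (P := fun a => 𝔉.vertical ((𝔏.transformationAlgebroid 𝒞 e μ).bracket a b)
      = (p.negOnePow : ℤˣ) • gradedCommutator p (q - 1)
          (gradedCommutator 1 (p - 1) Q (𝔉.vertical a)) (𝔉.vertical b))
    (fun v m f hf hp => hb.induction (P := fun b =>
      𝔉.vertical ((𝔏.transformationAlgebroid 𝒞 e μ).bracket (Pi.single v f) b)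
        = (p.negOnePow : ℤˣ) • gradedCommutator p (q - 1)
          (gradedCommutator 1 (p - 1) Q (𝔉.vertical (Pi.single v f))) (𝔉.vertical b))
    (fun w n g hg hq => hQ.bracket_eq_single hQV h𝒞 he hμ v w hf hg hp hq) ?_ ?_) ?_ ?_
  · simp
  · intro b b' hb hb'
    simp only [map_add, gradedCommutator_add_right, hb, hb', smul_add]
  · simp
  · intro a a' ha ha'
    simp only [map_add, LinearMap.add_apply, gradedCommutator_add_left,
      gradedCommutator_add_right, ha, ha', smul_add]

/-- A field which encodes the transformation algebroid on constant sections is an action field. -/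
theorem of_derived_bracket [DecidableEq (ι ⊕ κ)] (h1 : (1 : C) ∈ 𝒞 0)
    (he : 𝔏.IsHomogeneousBasis e) (hμ : 𝔏.IsGradedLieHom 𝒞 μ)
    (raises : RaisesFiberDegree 𝔉 1 Q)
    (anchor : ∀ j f, 𝔉.base ((𝔏.transformationAlgebroid 𝒞 e μ).anchor (Pi.single j 1) f)
      = gradedCommutator 1 (fiberDegree j - 1) Q (𝔉.vertical (Pi.single j 1)) (𝔉.base f))
    (bracket : ∀ j k, 𝔉.vertical ((𝔏.transformationAlgebroid 𝒞 e μ).bracket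
        (Pi.single j 1) (Pi.single k 1))
      = ((fiberDegree j).negOnePow : ℤˣ) • gradedCommutator (fiberDegree j) (fiberDegree k - 1)
          (gradedCommutator 1 (fiberDegree j - 1) Q (𝔉.vertical (Pi.single j 1)))
          (𝔉.vertical (Pi.single k 1))) :
    IsActionField 𝔉 𝔏 e μ Q := by
  have h1' : (1 : C) ∈ intDegree 𝒞 0 := mem_intDegree_of_mem h1 rfl
  have hD : LinearMap.mulLeft ℝ (𝔉.base 1) = (1 : Module.End ℝ B) := by
    rw [𝔉.base_one, LinearMap.mulLeft_one]
    rfl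
  have hV : ∀ j, 𝔉.vertical (Pi.single j 1) = 𝔉.D j := fun j => by
    rw [𝔉.vertical_single j h1', hD, one_mul, Int.negOnePow_zero, one_smul]
  refine ⟨raises, fun j f => ?_, fun j k => ?_⟩
  · rw [← hV, ← anchor, transformationAlgebroid_anchor_single, LinearMap.mulLeft_one]
    rfl
  · have h := bracket j k
    -- The coefficients are `1`, which derivations kill, so only the structure constants of `L`
    -- remain.
    rw [transformationAlgebroid_bracket_single j k h1' h1', hV, hV,
      (hμ.map_mem _ _ (he.mem j)).map_one h1, (hμ.map_mem _ _ (he.mem k)).map_one h1, mul_zero,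
      zero_mul, mul_one, Pi.single_zero, Pi.single_zero, smul_zero, sub_zero, zero_add, mul_zero,
      Int.negOnePow_zero, one_smul, vertical_sum_single h1', hD, one_mul, Int.negOnePow_zero,
      one_smul] at h
    rw [h, smul_smul, Int.units_mul_self, one_smul]

end IsActionField

/-- The transformation algebroid satisfies the axioms of an algebroid, because `Q² = 0`. -/
theorem IsActionField.isAlgebroid (hQ : IsActionField 𝔉 𝔏 e μ Q)
    (hQV : IsVectorField 𝔉.degree 1 Q) (h𝒞 : IsGradedCommutative 𝒞)
    (he : 𝔏.IsHomogeneousBasis e) (hμ : 𝔏.IsGradedLieHom 𝒞 μ) :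
    (𝔏.transformationAlgebroid 𝒞 e μ).IsAlgebroid 𝒞 := by
  classical
  have hbr := fun {p q : ℤ} {a b : ι ⊕ κ → C} => hQ.bracket_eq (p := p) (q := q) (a := a) (b := b)
    hQV h𝒞 he hμ
  have hmem := fun {p q : ℤ} {a b : ι ⊕ κ → C} (ha : IsSectionOfDegree 𝒞 p a)
    (hb : IsSectionOfDegree 𝒞 q b) => transformationAlgebroid_bracket_mem h𝒞 he hμ ha hb
  -- The double commutator with the odd field `Q` is the commutator with `Q * Q`, hence zero. This
  -- is what yields the Jacobi identity below.
  have hQQ : ∀ (p : ℤ) (X : Module.End ℝ B),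
      gradedCommutator 1 p Q (gradedCommutator 1 (p - 1) Q X) = 0 := fun p X => by
    rw [← gradedCommutator_sq (by ring) 2 rfl, hQ.mul_self he hμ, gradedCommutator_zero_left]
  refine ⟨fun p a ha => transformationAlgebroid_anchor_mem h𝒞 he hμ ha, fun p q a b => hmem, ?_, ?_,
    ?_⟩
  · intro p q a b ha hb
    apply 𝔉.vertical_injective
    -- Skew-symmetry is `[Q, [ι_a, ι_b]] = 0`, since vertical fields commute; the two Jacobi terms
    -- are the two derived brackets.
    have h := gradedCommutator_jacobi (p := 1) (q := p - 1) (r := q - 1) (s := p - 1 + (q - 1))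
      (t := p) (u := q) (by ring) (by ring) (by ring) Q (𝔉.vertical a) (𝔉.vertical b)
    rw [𝔉.commutator_vertical_vertical ha hb, gradedCommutator_zero_right,
      gradedCommutator_skew (p - 1) q, smul_neg, Int.negOnePow_smul_smul, ← sub_eq_add_neg, eq_comm,
      sub_eq_zero] at h
    rw [hbr ha hb, h, map_neg, LinearMap.map_intUnits_smul, hbr hb ha, Int.negOnePow_smul_smul,
      Int.negOnePow_smul_smul, ← Units.neg_smul, ← Int.negOnePow_succ]
    exact congr_arg (· • _) (Int.negOnePow_congr (p - 1 - q) (by ring))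
  · intro p k a b f ha hf
    refine section_induction (𝒞 := 𝒞) (P := fun b =>
      (𝔏.transformationAlgebroid 𝒞 e μ).bracket a (f • b)
        = (𝔏.transformationAlgebroid 𝒞 e μ).anchor a f • b
          + ((p * k).negOnePow : ℤˣ) • (f • (𝔏.transformationAlgebroid 𝒞 e μ).bracket a b))
      (fun q b hb => ?_) (fun b b' hb hb' => ?_) b
    -- For homogeneous `b` the Leibniz axiom is the Leibniz rule for the commutator of `[Q, ι_a]`
    -- with `f ι_b`.
    · have hf' := mem_intDegree_of_mem hf rfl
      have hfb : IsSectionOfDegree 𝒞 (q + k) (f • b) := fun j => by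
        have := h𝒞.mul_mem_int hf' (hb j)
        rwa [show (k : ℤ) + (q - fiberDegree j) = q + k - fiberDegree j by ring] at this
      have hX := hQV.commutator (𝔉.isVectorField_vertical ha)
      rw [add_sub_cancel] at hX
      apply 𝔉.vertical_injective
      rw [hbr ha hfb, 𝔉.vertical_smul h𝒞 hf', gradedCommutator_units_right,
        gradedCommutator_mulLeft_right hX (𝔉.base_mem hf') (q := q - 1) (by ring),
        ← hQ.anchor_eq hQV ha, map_add, LinearMap.map_intUnits_smul, 𝔉.vertical_smul h𝒞 hf',
        𝔉.vertical_smul h𝒞 ((transformationAlgebroid_anchor_mem h𝒞 he hμ ha).map_mem_int hf'),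
        hbr ha hb, mul_smul_comm]
      simp only [smul_add, Int.negOnePow_smul_smul]
      refine congr_arg₂ _ (congr_arg (· • _) (Int.negOnePow_congr 0 (by ring)))
        (congr_arg (· • _) (Int.negOnePow_congr 0 (by ring)))
    · rw [smul_add, map_add, hb, hb', map_add]
      simp only [smul_add]
      abel
  · intro p q a b c ha hb
    refine section_induction (𝒞 := 𝒞) (P := fun c =>
      (𝔏.transformationAlgebroid 𝒞 e μ).bracket a ((𝔏.transformationAlgebroid 𝒞 e μ).bracket b c)
        = (𝔏.transformationAlgebroid 𝒞 e μ).bracket ((𝔏.transformationAlgebroid 𝒞 e μ).bracket a b) c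
          + ((p * q).negOnePow : ℤˣ) •
            (𝔏.transformationAlgebroid 𝒞 e μ).bracket b ((𝔏.transformationAlgebroid 𝒞 e μ).bracket a c))
      (fun r c hc => ?_) (fun c c' hc hc' => ?_) c
    · apply 𝔉.vertical_injective
      have h1 := gradedCommutator_jacobi (p := p) (q := q) (r := r - 1) (s := q + r - 1) (t := p + q)
        (u := p + r - 1) (by ring) (by ring) (by ring)
        (gradedCommutator 1 (p - 1) Q (𝔉.vertical a)) (gradedCommutator 1 (q - 1) Q (𝔉.vertical b))
        (𝔉.vertical c)
      -- As `[Q, [Q, ι_a]] = 0`, this identifies `[[Q, ι_a], [Q, ι_b]]`, up to sign, with `[Q,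
      -- ι_{[a, b]}]`. Then `h1` becomes the Jacobi identity of the derived bracket.
      have h2 := gradedCommutator_jacobi (p := 1) (q := p) (r := q - 1) (s := p + q - 1)
        (t := 1 + p) (u := q) (by ring) (by ring) (by ring) Q
        (gradedCommutator 1 (p - 1) Q (𝔉.vertical a)) (𝔉.vertical b)
      rw [hQQ, gradedCommutator_zero_left, zero_add, one_mul] at h2
      rw [hbr ha (hmem hb hc), hbr hb hc, gradedCommutator_units_right, h1, map_add,
        LinearMap.map_intUnits_smul, hbr (hmem ha hb) hc, hbr ha hb, gradedCommutator_units_right,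
        gradedCommutator_units_left, h2, gradedCommutator_units_left, hbr hb (hmem ha hc), hbr ha hc,
        gradedCommutator_units_right]
      simp only [smul_add, Int.negOnePow_smul_smul]
      refine congr_arg₂ _ (congr_arg (· • _) (Int.negOnePow_congr (-p) (by ring)))
        (congr_arg (· • _) (Int.negOnePow_congr 0 (by ring)))
    · simp only [map_add, hc, hc', smul_add]
      abel

end Encoding

/-! ### Construction of the encoding field and of the linear field -/

section Construction

open FiberModel

variable {C : Type*} [Ring C] [Algebra ℝ C] {𝒞 : ℕ → Submodule ℝ C}
  {B : Type*} [Ring B] [Algebra ℝ B] {ι κ : Type*}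
  {𝔉 : FiberModel 𝒞 B ι κ} {L : Type*} [AddCommGroup L] [Module ℝ L] {𝔏 : DGLA L}
  {e : Module.Basis (ι ⊕ κ) ℝ L} {μ : L →ₗ[ℝ] Module.End ℝ C} {Q : Module.End ℝ B}

theorem FiberModel.RaisesFiberDegree.coord_mul {r : ℕ} {X : Module.End ℝ B}
    (hX : RaisesFiberDegree 𝔉 r X) (j : ι ⊕ κ) :
    RaisesFiberDegree 𝔉 (r + 1) (LinearMap.mulLeft ℝ (𝔉.coord j) * X) :=
  fun m b hb => 𝔉.coord_mul_mem_poly j (hX m b hb)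

theorem isVectorField_constantField (he : 𝔏.IsHomogeneousBasis e) {i : ℤ} {x : L}
    (hx : x ∈ 𝔏.deg i) : IsVectorField 𝔉.degree (i - 1) (constantField 𝔉 e x) := by
  refine he.induction (P := fun x => IsVectorField 𝔉.degree (i - 1) (constantField 𝔉 e x)) ?_ ?_ ?_
    ?_ hx
  · rintro j rfl
    rw [constantField_basis]
    exact 𝔉.isVectorField_D j
  · rw [map_zero]; exact IsVectorField.zero
  · intro x y hx hy
    rw [map_add]; exact hx.add hy
  · intro c x hx
    rw [map_smul]; exact hx.smul c

theorem commutator_constantField_partialDeriv (he : 𝔏.IsHomogeneousBasis e) {i : ℤ} {x : L}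
    (hx : x ∈ 𝔏.deg i) (l : ι ⊕ κ) {p : ℤ} (hp : p = i - 1) :
    gradedCommutator p (fiberDegree l - 1) (constantField 𝔉 e x) (𝔉.D l) = 0 := by
  subst hp
  refine he.induction (P := fun x => gradedCommutator (i - 1) (fiberDegree l - 1)
    (constantField 𝔉 e x) (𝔉.D l) = 0) ?_ (by simp) ?_ ?_ hx
  · rintro j rfl
    rw [constantField_basis, 𝔉.commutator_D_D]
  · intro x y hx hy
    rw [map_add, gradedCommutator_add_left, hx, hy, add_zero]
  · intro c x hx
    rw [map_smul, gradedCommutator_smul_left, hx, smul_zero]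

variable [Fintype ι] [Fintype κ]

theorem constantField_base (x : L) (f : C) : constantField 𝔉 e x (𝔉.base f) = 0 := by
  rw [constantField_eq_sum, LinearMap.sum_apply]
  refine Finset.sum_eq_zero fun k _ => ?_
  rw [LinearMap.smul_apply, 𝔉.D_base, smul_zero]

theorem raises_coord_mul_constantField (j : ι ⊕ κ) (x : L) :
    RaisesFiberDegree 𝔉 0 (LinearMap.mulLeft ℝ (𝔉.coord j) * constantField 𝔉 e x) := by
  rw [constantField_eq_sum, Finset.mul_sum]
  refine RaisesFiberDegree.sum _ fun k _ => ?_
  rw [mul_smul_comm]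
  refine RaisesFiberDegree.smul _ fun m b hb => ?_
  rw [Module.End.mul_apply, LinearMap.mulLeft_apply]
  rcases m with _ | m
  · rw [𝔉.D_poly_zero k hb, mul_zero]; exact zero_mem _
  · exact 𝔉.coord_mul_mem_poly j (𝔉.D_mem_poly k hb)

namespace FiberModel

variable (𝔉) in
/-- The vector field `∑ⱼ ± ξ^j X_j`. -/
noncomputable def coordSum (X : ι ⊕ κ → Module.End ℝ B) : Module.End ℝ B :=
  ∑ j, ((fiberDegree j).negOnePow : ℤˣ) • (LinearMap.mulLeft ℝ (𝔉.coord j) * X j)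

variable {X : ι ⊕ κ → Module.End ℝ B}

theorem isVectorField_coordSum (hX : ∀ j, IsVectorField 𝔉.degree (fiberDegree j) (X j)) :
    IsVectorField 𝔉.degree 1 (𝔉.coordSum X) := by
  refine IsVectorField.sum _ fun j _ => IsVectorField.units_smul _ ?_
  have := (hX j).mulLeft_mul 𝔉.comm (𝔉.coord_mem j)
  rwa [sub_add_cancel] at this

theorem raises_coordSum {r : ℕ}
    (hX : ∀ j, RaisesFiberDegree 𝔉 r (LinearMap.mulLeft ℝ (𝔉.coord j) * X j)) :
    RaisesFiberDegree 𝔉 r (𝔉.coordSum X) :=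
  RaisesFiberDegree.sum _ fun j _ => RaisesFiberDegree.units_smul _ (hX j)

theorem coordSum_base (hX : ∀ j f, X j (𝔉.base f) = 0) (f : C) :
    𝔉.coordSum X (𝔉.base f) = 0 := by
  rw [coordSum, LinearMap.sum_apply]
  refine Finset.sum_eq_zero fun j _ => ?_
  rw [LinearMap.smul_apply, Module.End.mul_apply, hX, map_zero, smul_zero]

theorem sum_partialDeriv_coord (l : ι ⊕ κ) (Y : ι ⊕ κ → Module.End ℝ B) :
    ∑ j, LinearMap.mulLeft ℝ (𝔉.D l (𝔉.coord j)) * Y j = Y l := by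
  classical
  rw [Finset.sum_eq_single l, 𝔉.D_coord_self, LinearMap.mulLeft_one]
  · rfl
  · intro j _ h
    rw [𝔉.D_coord_of_ne h.symm, LinearMap.mulLeft_zero_eq_zero, zero_mul]
  · simp

/-- The derivative `D l` meets either the operators `X j` or the coordinates. By duality the second
contribution is `X l` alone, and the signs in `coordSum` are chosen so that it appears with sign
`+`. -/
theorem commutator_coordSum_partialDeriv (l : ι ⊕ κ) :
    gradedCommutator 1 (fiberDegree l - 1) (𝔉.coordSum X) (𝔉.D l)
      = 𝔉.coordSum (fun j => gradedCommutator (fiberDegree j) (fiberDegree l - 1) (X j) (𝔉.D l))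
        + X l := by
  rw [coordSum, coordSum, gradedCommutator_sum_left]
  have h : ∀ j, gradedCommutator 1 (fiberDegree l - 1)
      (((fiberDegree j).negOnePow : ℤˣ) • (LinearMap.mulLeft ℝ (𝔉.coord j) * X j)) (𝔉.D l)
      = ((fiberDegree j).negOnePow : ℤˣ) • (LinearMap.mulLeft ℝ (𝔉.coord j)
          * gradedCommutator (fiberDegree j) (fiberDegree l - 1) (X j) (𝔉.D l))
        + LinearMap.mulLeft ℝ (𝔉.D l (𝔉.coord j))
          * (((fiberDegree j + fiberDegree l).negOnePow : ℤˣ) • X j) := fun j => by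
    rw [gradedCommutator_units_left, gradedCommutator_mulLeft_left (𝔉.isVectorField_D l)
      (𝔉.coord_mem j) (p := fiberDegree j) (by ring), smul_sub, mul_smul_comm,
      Int.negOnePow_smul_smul, sub_eq_add_neg, ← Units.neg_smul, ← Int.negOnePow_succ]
    exact congr_arg (_ + ·) (congr_arg (· • _) (Int.negOnePow_congr 0 (by ring)))
  rw [Finset.sum_congr rfl fun j _ => h j, Finset.sum_add_distrib, sum_partialDeriv_coord,
    Int.negOnePow_even _ ⟨_, rfl⟩, one_smul]

/-- Constant fields commute, so only the derivative of the coordinate contributes. It leaves the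
bracket of `e l` and `e j`, which graded skew-symmetry reverses. -/
theorem commutator_sum_coord_constantField (he : 𝔏.IsHomogeneousBasis e) (j l : ι ⊕ κ) :
    gradedCommutator (fiberDegree j) (fiberDegree l - 1)
        (∑ i, LinearMap.mulLeft ℝ (𝔉.coord i) * constantField 𝔉 e (𝔏.bracket (e i) (e j))) (𝔉.D l)
      = ((fiberDegree j).negOnePow : ℤˣ) • constantField 𝔉 e (𝔏.bracket (e j) (e l)) := by
  have h : ∀ i, gradedCommutator (fiberDegree j) (fiberDegree l - 1)
      (LinearMap.mulLeft ℝ (𝔉.coord i) * constantField 𝔉 e (𝔏.bracket (e i) (e j))) (𝔉.D l)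
      = LinearMap.mulLeft ℝ (𝔉.D l (𝔉.coord i)) *
        (((fiberDegree j * (fiberDegree l - 1) + 1).negOnePow : ℤˣ) •
          constantField 𝔉 e (𝔏.bracket (e i) (e j))) := fun i => by
    rw [gradedCommutator_mulLeft_left (𝔉.isVectorField_D l)
      (𝔉.coord_mem i) (p := fiberDegree i + fiberDegree j - 1) (by ring),
      commutator_constantField_partialDeriv he
        (𝔏.bracket_mem _ _ _ (he.mem i) _ (he.mem j)) l rfl, mul_zero, mul_smul_comm, zero_sub,
      ← Units.neg_smul, ← Int.negOnePow_succ]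
  rw [gradedCommutator_sum_left, Finset.sum_congr rfl fun i _ => h i, sum_partialDeriv_coord,
    𝔏.bracket_skew _ _ _ (he.mem l) _ (he.mem j), ← Units.neg_smul, ← Int.negOnePow_succ,
    LinearMap.map_intUnits_smul, Int.negOnePow_smul_smul]
  exact congr_arg (· • _) (Int.negOnePow_congr (fiberDegree j * fiberDegree l - fiberDegree j + 1)
    (by ring))

variable (𝔉 𝔏 e) in
/-- The vector field `1/2 ∑ ± ξ^j ξ^i [e_i, e_j]`. -/
noncomputable def bracketField : Module.End ℝ B :=
  (1 / 2 : ℝ) • 𝔉.coordSum fun j =>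
    ∑ i, LinearMap.mulLeft ℝ (𝔉.coord i) * constantField 𝔉 e (𝔏.bracket (e i) (e j))

/-- The derivative can hit either of the two coordinates in the quadratic expression. Skew-symmetry
makes the two contributions equal, and this cancels the factor `1/2`. -/
theorem commutator_bracketField_partialDeriv (he : 𝔏.IsHomogeneousBasis e) (l : ι ⊕ κ) :
    gradedCommutator 1 (fiberDegree l - 1) (𝔉.bracketField 𝔏 e) (𝔉.D l)
      = ∑ i, LinearMap.mulLeft ℝ (𝔉.coord i) * constantField 𝔉 e (𝔏.bracket (e i) (e l)) := by
  rw [bracketField, gradedCommutator_smul_left, commutator_coordSum_partialDeriv,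
    funext fun j => commutator_sum_coord_constantField he j l, coordSum]
  simp only [mul_smul_comm, smul_smul, Int.units_mul_self, one_smul]
  rw [← two_smul ℝ, smul_smul, one_div, inv_mul_cancel₀ two_ne_zero, one_smul]

theorem isVectorField_bracketField (he : 𝔏.IsHomogeneousBasis e) :
    IsVectorField 𝔉.degree 1 (𝔉.bracketField 𝔏 e) := by
  refine IsVectorField.smul _ (isVectorField_coordSum fun j => IsVectorField.sum _ fun i _ => ?_)
  have := (isVectorField_constantField he
    (𝔏.bracket_mem _ _ _ (he.mem i) _ (he.mem j))).mulLeft_mul 𝔉.comm (𝔉.coord_mem i)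
  rwa [show 1 - fiberDegree i + (fiberDegree i + fiberDegree j - 1) = fiberDegree j by ring] at this

theorem raises_bracketField : RaisesFiberDegree 𝔉 1 (𝔉.bracketField 𝔏 e) :=
  RaisesFiberDegree.smul _ (raises_coordSum fun _ => RaisesFiberDegree.coord_mul
    (RaisesFiberDegree.sum _ fun _ _ => raises_coord_mul_constantField _ _) _)

end FiberModel

variable {M : ι ⊕ κ → Module.End ℝ B}

/-- `X` lifts the vector field `Y` of degree `d` on `𝓜` to a trivial bundle, annihilating the
coordinates of the fibers. -/
structure FiberModel.IsLift (𝔉 : FiberModel 𝒞 B ι κ) (d : ℤ) (Y : Module.End ℝ C)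
    (X : Module.End ℝ B) : Prop where
  isVectorField : IsVectorField 𝔉.degree d X
  raises : RaisesFiberDegree 𝔉 0 X
  base : ∀ f, X (𝔉.base f) = 𝔉.base (Y f)
  commutator : ∀ j, gradedCommutator d (fiberDegree j - 1) X (𝔉.D j) = 0

theorem isVectorField_bracketField_add_coordSum (he : 𝔏.IsHomogeneousBasis e)
    (hM : ∀ j, 𝔉.IsLift (fiberDegree j) (μ (e j)) (M j)) :
    IsVectorField 𝔉.degree 1 (𝔉.bracketField 𝔏 e + 𝔉.coordSum M) :=
  (isVectorField_bracketField he).add (isVectorField_coordSum fun j => (hM j).isVectorField)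

/-- The commutator with `D l` is `∑ ξ^i ∂_{[e_i, e_l]} + M l`. On base functions only the lift `M l`
acts, and in the second commutator only the sum contributes, as lifts commute with the derivatives.
-/
theorem isActionField_bracketField_add_coordSum (he : 𝔏.IsHomogeneousBasis e)
    (hM : ∀ j, 𝔉.IsLift (fiberDegree j) (μ (e j)) (M j)) :
    IsActionField 𝔉 𝔏 e μ (𝔉.bracketField 𝔏 e + 𝔉.coordSum M) := by
  have key : ∀ l, gradedCommutator 1 (fiberDegree l - 1) (𝔉.bracketField 𝔏 e + 𝔉.coordSum M)
      (𝔉.D l) = ∑ i, LinearMap.mulLeft ℝ (𝔉.coord i)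
        * constantField 𝔉 e (𝔏.bracket (e i) (e l)) + M l := fun l => by
    rw [gradedCommutator_add_left, commutator_bracketField_partialDeriv he,
      commutator_coordSum_partialDeriv, funext fun j => (hM j).commutator l]
    simp [coordSum]
  refine ⟨raises_bracketField.add (raises_coordSum fun j => (hM j).raises.coord_mul j),
    fun j f => ?_, fun j k => ?_⟩
  · rw [key, LinearMap.add_apply, (hM j).base, LinearMap.sum_apply, Finset.sum_eq_zero, zero_add]
    intro i _
    rw [Module.End.mul_apply, constantField_base, map_zero]
  · rw [key, gradedCommutator_add_left, (hM j).commutator, add_zero,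
      commutator_sum_coord_constantField he]

variable {QA : Module.End ℝ C} {MA : Module.End ℝ B}

theorem isVectorField_neg_coordSum_add (he : 𝔏.IsHomogeneousBasis e) (hMA : 𝔉.IsLift 1 QA MA) :
    IsVectorField 𝔉.degree 1 (-𝔉.coordSum (fun j => constantField 𝔉 e (𝔏.δ (e j))) + MA) := by
  refine (isVectorField_coordSum fun j => ?_).neg.add hMA.isVectorField
  have := isVectorField_constantField (𝔉 := 𝔉) he (𝔏.δ_mem _ _ (he.mem j))
  rwa [add_sub_cancel_right] at this

/-- The coordinate sum vanishes on the base and gives `-∂_{δx}` in commutators; the lift gives `QA`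
on the base and commutes with the derivatives. -/
theorem isLinearField_neg_coordSum_add (he : 𝔏.IsHomogeneousBasis e) (hMA : 𝔉.IsLift 1 QA MA) :
    IsLinearField 𝔉 𝔏 e QA (-𝔉.coordSum (fun j => constantField 𝔉 e (𝔏.δ (e j))) + MA) := by
  refine ⟨(raises_coordSum fun j => raises_coord_mul_constantField j _).neg.add hMA.raises,
    fun f => ?_, fun j => ?_⟩
  · rw [LinearMap.add_apply, LinearMap.neg_apply, coordSum_base fun j => constantField_base _,
      neg_zero, zero_add, hMA.base]
  · have h : ∀ i, gradedCommutator (fiberDegree i) (fiberDegree j - 1)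
        (constantField 𝔉 e (𝔏.δ (e i))) (𝔉.D j) = 0 := fun i =>
      commutator_constantField_partialDeriv he (𝔏.δ_mem _ _ (he.mem i)) j (by ring)
    rw [gradedCommutator_add_left, gradedCommutator_neg_left, commutator_coordSum_partialDeriv,
      hMA.commutator, funext h]
    simp [coordSum]

end Construction

/-! ### Coordinate expressions of the fields -/

namespace FiberModel

variable {C : Type*} [Ring C] [Algebra ℝ C] {𝒞 : ℕ → Submodule ℝ C}
  {B : Type*} [Ring B] [Algebra ℝ B] {ι κ : Type*} [Fintype ι] [Fintype κ]
  (𝔉 : FiberModel 𝒞 B ι κ)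
  {L : Type*} [AddCommGroup L] [Module ℝ L] (𝔏 : DGLA L)
  (e : Module.Basis (ι ⊕ κ) ℝ L)

theorem bracketField_eq : 𝔉.bracketField 𝔏 e = (1 / 2 : ℝ) • ∑ i, ∑ j, ∑ k,
    ((fiberDegree j).negOnePow : ℤˣ) • e.repr (𝔏.bracket (e i) (e j)) k •
      (LinearMap.mulLeft ℝ (𝔉.coord j * 𝔉.coord i) * 𝔉.D k) := by
  rw [bracketField, coordSum, Finset.sum_comm]
  congr 1
  refine Finset.sum_congr rfl fun j _ => ?_
  rw [Finset.mul_sum, Finset.smul_sum]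
  refine Finset.sum_congr rfl fun i _ => ?_
  rw [constantField_eq_sum, mulLeft_mul_mul, Finset.mul_sum, Finset.smul_sum]
  simp only [mul_smul_comm]

theorem coordSum_constantField_eq (x : ι ⊕ κ → L) :
    𝔉.coordSum (fun j => constantField 𝔉 e (x j)) = ∑ i, ∑ k,
      ((fiberDegree i).negOnePow : ℤˣ) • e.repr (x i) k •
        (LinearMap.mulLeft ℝ (𝔉.coord i) * 𝔉.D k) := by
  refine Finset.sum_congr rfl fun j _ => ?_
  beta_reduce
  rw [constantField_eq_sum, Finset.mul_sum, Finset.smul_sum]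
  simp only [mul_smul_comm]

theorem coordSum_eq (M : ι ⊕ κ → Module.End ℝ B) :
    𝔉.coordSum M = (∑ i, LinearMap.mulLeft ℝ (𝔉.coord (Sum.inl i)) * M (Sum.inl i))
      - ∑ α, LinearMap.mulLeft ℝ (𝔉.coord (Sum.inr α)) * M (Sum.inr α) := by
  rw [coordSum, Fintype.sum_sum_type, sub_eq_add_neg, ← Finset.sum_neg_distrib]
  simp [fiberDegree]

end FiberModel

/-! ### The functions on `L[1] × 𝓜` as an instance of the model -/

namespace TotalFunctions

variable {C : Type*} [Ring C] [Algebra ℝ C] {𝒞 : ℕ → Submodule ℝ C} [GradedAlgebra 𝒞]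
  {ι κ : Type*} [Finite ι] [Finite κ] [DecidableEq ι]

variable (ι κ) in
/-- The functions on `L[1] × 𝓜`. -/
noncomputable def fiberModel (h𝒞 : IsGradedCommutative 𝒞) :
    FiberModel 𝒞 (TotalFunctions 𝒞 ι κ) ι κ where
  degree := degree 𝒞
  poly := fiberPolynomials 𝒞
  base := ofBaseₗ 𝒞
  D := partialDeriv 𝒞
  coord := coord 𝒞
  comm := isGradedCommutative_degree h𝒞
  base_mem := ofBase_mem 𝒞
  base_one := (one_eq_ofBase 𝒞).symm
  base_mul := ofBase_mul 𝒞
  base_injective := ofBase_injective 𝒞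
  base_mem_poly := ofBase_mem_fiberPolynomials 𝒞
  exists_base := exists_ofBase 𝒞
  iSup_poly := iSup_fiberPolynomials 𝒞
  isVectorField_D := isVectorField_partialDeriv 𝒞
  D_base := partialDeriv_ofBase 𝒞
  D_mem_poly := partialDeriv_mem_fiberPolynomials 𝒞
  eq_zero_of_D_eq_zero := eq_zero_of_partialDeriv_eq_zero 𝒞
  commutator_D_D := commutator_partialDeriv_partialDeriv 𝒞
  coord_mem := coord_mem 𝒞
  coord_mul_mem_poly := coord_mul_mem_fiberPolynomials 𝒞
  D_coord_self j := (partialDeriv_coord 𝒞 j j).trans (if_pos rfl)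
  D_coord_of_ne {j k} h := (partialDeriv_coord 𝒞 j k).trans (if_neg h)

theorem isLift_ofBaseField (h𝒞 : IsGradedCommutative 𝒞) {d : ℤ} {X : Module.End ℝ C}
    (hX : IsVectorField 𝒞 d X) : (fiberModel ι κ h𝒞).IsLift d X (ofBaseField 𝒞 d X) where
  isVectorField := isVectorField_ofBaseField 𝒞 hX
  raises _ _ hb := ofBaseField_mem_fiberPolynomials 𝒞 d X hb
  base := ofBaseField_ofBase 𝒞 d X
  commutator := commutator_ofBaseField_partialDeriv 𝒞 d X

end TotalFunctions

/-! ### The equivalences over a general graded manifold -/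

section Transformation

open TotalFunctions FiberModel

variable {C : Type*} [Ring C] [Algebra ℝ C] {𝒞 : ℕ → Submodule ℝ C} [GradedAlgebra 𝒞]
  {ι κ : Type*} [Fintype ι] [Fintype κ] [DecidableEq ι] {L : Type*} [AddCommGroup L] [Module ℝ L]
  (𝔏 : DGLA L) (e : Module.Basis (ι ⊕ κ) ℝ L) (μ : L →ₗ[ℝ] Module.End ℝ C)

theorem DGLA.fieldBr_eq (h𝒞 : IsGradedCommutative 𝒞) :
    𝔏.fieldBr 𝒞 e = (fiberModel ι κ h𝒞).bracketField 𝔏 e :=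
  ((fiberModel ι κ h𝒞).bracketField_eq 𝔏 e).symm

theorem DGLA.fieldδ_eq (h𝒞 : IsGradedCommutative 𝒞) :
    𝔏.fieldδ 𝒞 e = (fiberModel ι κ h𝒞).coordSum
      fun j => constantField (fiberModel ι κ h𝒞) e (𝔏.δ (e j)) :=
  ((fiberModel ι κ h𝒞).coordSum_constantField_eq e fun j => 𝔏.δ (e j)).symm

theorem fieldAction_eq (h𝒞 : IsGradedCommutative 𝒞) :
    fieldAction 𝒞 e μ = (fiberModel ι κ h𝒞).coordSum
      fun j => ofBaseField 𝒞 (fiberDegree j) (μ (e j)) :=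
  ((fiberModel ι κ h𝒞).coordSum_eq fun j => ofBaseField 𝒞 (fiberDegree j) (μ (e j))).symm

variable {𝔏 e μ}

theorem isActionField_fieldBr_add_fieldAction (h𝒞 : IsGradedCommutative 𝒞)
    (he : 𝔏.IsHomogeneousBasis e) (hμ : 𝔏.IsGradedLieHom 𝒞 μ) :
    IsActionField (fiberModel ι κ h𝒞) 𝔏 e μ (𝔏.fieldBr 𝒞 e + fieldAction 𝒞 e μ) := by
  rw [𝔏.fieldBr_eq e h𝒞, fieldAction_eq e μ h𝒞]
  exact isActionField_bracketField_add_coordSum he fun j =>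
    isLift_ofBaseField h𝒞 (hμ.map_mem _ _ (he.mem j))

theorem isVectorField_fieldBr_add_fieldAction (h𝒞 : IsGradedCommutative 𝒞)
    (he : 𝔏.IsHomogeneousBasis e) (hμ : 𝔏.IsGradedLieHom 𝒞 μ) :
    IsVectorField (degree 𝒞) 1 (𝔏.fieldBr 𝒞 e + fieldAction 𝒞 e μ) := by
  rw [𝔏.fieldBr_eq e h𝒞, fieldAction_eq e μ h𝒞]
  exact isVectorField_bracketField_add_coordSum (𝔉 := fiberModel ι κ h𝒞) he fun j =>
    isLift_ofBaseField h𝒞 (hμ.map_mem _ _ (he.mem j))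

theorem isLinearField_neg_fieldδ_add (h𝒞 : IsGradedCommutative 𝒞)
    (he : 𝔏.IsHomogeneousBasis e) {QA : Module.End ℝ C} (hQA : IsVectorField 𝒞 1 QA) :
    IsLinearField (fiberModel ι κ h𝒞) 𝔏 e QA (-𝔏.fieldδ 𝒞 e + ofBaseField 𝒞 1 QA) := by
  rw [𝔏.fieldδ_eq e h𝒞]
  exact isLinearField_neg_coordSum_add he (isLift_ofBaseField h𝒞 hQA)

theorem isVectorField_neg_fieldδ_add (h𝒞 : IsGradedCommutative 𝒞)
    (he : 𝔏.IsHomogeneousBasis e) {QA : Module.End ℝ C} (hQA : IsVectorField 𝒞 1 QA) :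
    IsVectorField (degree 𝒞) 1 (-𝔏.fieldδ 𝒞 e + ofBaseField 𝒞 1 QA) := by
  rw [𝔏.fieldδ_eq e h𝒞]
  exact isVectorField_neg_coordSum_add (𝔉 := fiberModel ι κ h𝒞) he (isLift_ofBaseField h𝒞 hQA)

theorem IsHomological.of_mul_self {B : Type*} [Ring B] [Algebra ℝ B] {𝒢 : ℕ → Submodule ℝ B}
    {Q : Module.End ℝ B} (hQ : IsVectorField 𝒢 1 Q) (h : Q * Q = 0) : IsHomological 𝒢 Q :=
  ⟨hQ, by rw [gradedCommutator_one_one_self, h, smul_zero]⟩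

theorem IsHomological.mul_self {B : Type*} [Ring B] [Algebra ℝ B] {𝒢 : ℕ → Submodule ℝ B}
    {Q : Module.End ℝ B} (hQ : IsHomological 𝒢 Q) : Q * Q = 0 := by
  have h := hQ.commutator_self
  rw [gradedCommutator_one_one_self] at h
  exact (smul_eq_zero.mp h).resolve_left two_ne_zero

namespace DGLA

/-- The transformation algebroid is an algebroid over a graded manifold `𝓜`. -/
theorem isAlgebroid_transformationAlgebroid (h𝒞 : IsGradedCommutative 𝒞)
    (he : 𝔏.IsHomogeneousBasis e) (hμ : 𝔏.IsGradedLieHom 𝒞 μ) :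
    (𝔏.transformationAlgebroid 𝒞 e μ).IsAlgebroid 𝒞 :=
  (isActionField_fieldBr_add_fieldAction h𝒞 he hμ).isAlgebroid
    (isVectorField_fieldBr_add_fieldAction h𝒞 he hμ) h𝒞 he hμ

theorem isEncodedBy_transformationAlgebroid (h𝒞 : IsGradedCommutative 𝒞)
    (he : 𝔏.IsHomogeneousBasis e) (hμ : 𝔏.IsGradedLieHom 𝒞 μ) :
    (𝔏.transformationAlgebroid 𝒞 e μ).IsEncodedBy 𝒞 (𝔏.fieldBr 𝒞 e + fieldAction 𝒞 e μ) where
  isHomological := IsHomological.of_mul_self (isVectorField_fieldBr_add_fieldAction h𝒞 he hμ)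
    ((isActionField_fieldBr_add_fieldAction h𝒞 he hμ).mul_self he hμ)
  map_fiberPolynomials := (isActionField_fieldBr_add_fieldAction h𝒞 he hμ).raises
  anchor_eq _ _ ha := (isActionField_fieldBr_add_fieldAction h𝒞 he hμ).anchor_eq
    (isVectorField_fieldBr_add_fieldAction h𝒞 he hμ) ha
  bracket_eq _ _ _ _ := (isActionField_fieldBr_add_fieldAction h𝒞 he hμ).bracket_eq
    (isVectorField_fieldBr_add_fieldAction h𝒞 he hμ) h𝒞 he hμ

/-- The encoding conditions on the constant sections `e_j` alone make `Q` an action field, and there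
is only one. -/
theorem isEncodedBy_transformationAlgebroid_iff (h𝒞 : IsGradedCommutative 𝒞)
    (he : 𝔏.IsHomogeneousBasis e) (hμ : 𝔏.IsGradedLieHom 𝒞 μ)
    (Q : Module.End ℝ (TotalFunctions 𝒞 ι κ)) :
    (𝔏.transformationAlgebroid 𝒞 e μ).IsEncodedBy 𝒞 Q
      ↔ Q = 𝔏.fieldBr 𝒞 e + fieldAction 𝒞 e μ := by
  refine ⟨fun h => ?_, fun h => h ▸ isEncodedBy_transformationAlgebroid h𝒞 he hμ⟩
  classical
  have h1 : (1 : C) ∈ 𝒞 0 := SetLike.GradedOne.one_mem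
  have hs : ∀ j : ι ⊕ κ, IsSectionOfDegree 𝒞 (fiberDegree j) (Pi.single j (1 : C)) := fun j =>
    isSectionOfDegree_single (mem_intDegree_of_mem h1 rfl) (by simp)
  have hQ : IsActionField (fiberModel ι κ h𝒞) 𝔏 e μ Q :=
    IsActionField.of_derived_bracket h1 he hμ h.map_fiberPolynomials
      (fun j f => h.anchor_eq _ _ (hs j) f) (fun j k => h.bracket_eq _ _ _ _ (hs j) (hs k))
  exact hQ.unique (isActionField_fieldBr_add_fieldAction h𝒞 he hμ)

variable {QA : Module.End ℝ C}

theorem commutator_fields_eq_zero_iff (h𝒞 : IsGradedCommutative 𝒞)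
    (he : 𝔏.IsHomogeneousBasis e) (hμ : 𝔏.IsGradedLieHom 𝒞 μ) (hQA : IsHomological 𝒞 QA) :
    gradedCommutator 1 1 (-𝔏.fieldδ 𝒞 e + ofBaseField 𝒞 1 QA)
      (𝔏.fieldBr 𝒞 e + fieldAction 𝒞 e μ) = 0 ↔ 𝔏.IsDGLAHom 𝒞 QA μ := by
  have h := (isLinearField_neg_fieldδ_add h𝒞 he hQA.isVectorField).commutator_eq_zero_iff
    (isActionField_fieldBr_add_fieldAction h𝒞 he hμ) he
  exact Iff.trans h ⟨fun h => ⟨hμ, h⟩, fun h => h.map_δ⟩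

/-- Uniqueness of the encoding field replaces the existentially quantified `Q'` by `Q_br +
Q_action`. The other conditions, that `-Q_δ + Q_A` be homological and linear on the fibers and that
`T_μ` be an algebroid, hold whether or not `μ` respects the differentials. -/
theorem isQAlgebroid_transformationAlgebroid_iff (h𝒞 : IsGradedCommutative 𝒞)
    (he : 𝔏.IsHomogeneousBasis e) (hμ : 𝔏.IsGradedLieHom 𝒞 μ) (hQA : IsHomological 𝒞 QA) :
    (𝔏.transformationAlgebroid 𝒞 e μ).IsQAlgebroid 𝒞 (-𝔏.fieldδ 𝒞 e + ofBaseField 𝒞 1 QA) ↔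
      gradedCommutator 1 1 (-𝔏.fieldδ 𝒞 e + ofBaseField 𝒞 1 QA)
        (𝔏.fieldBr 𝒞 e + fieldAction 𝒞 e μ) = 0 := by
  have hR := isLinearField_neg_fieldδ_add h𝒞 he hQA.isVectorField
  constructor
  · rintro ⟨-, -, -, Q, hQ, h⟩
    rwa [(isEncodedBy_transformationAlgebroid_iff h𝒞 he hμ Q).mp hQ] at h
  · intro h
    exact ⟨isAlgebroid_transformationAlgebroid h𝒞 he hμ,
      IsHomological.of_mul_self (isVectorField_neg_fieldδ_add h𝒞 he hQA.isVectorField)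
        (hR.mul_self he hQA.mul_self),
      hR.raises 1, _, isEncodedBy_transformationAlgebroid h𝒞 he hμ, h⟩

end DGLA

theorem isGradedCommutative_formDegree (E R : Type*) [CommRing R] [Algebra ℝ R] [AddCommGroup E]
    [Module R E] : IsGradedCommutative (formDegree E R) :=
  ⟨fun hf hg => SetLike.mul_mem_graded hf hg, formDegree_mul_comm⟩

end Transformation

theorem mainTheorem5
    {n : ℕ} {M : Type*} [TopologicalSpace M] [ChartedSpace (EuclideanSpace ℝ (Fin n)) M]
    [T2Space M] [SecondCountableTopology M] [IsManifold (𝓡 n) ∞ M]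
    {F : Type*} [NormedAddCommGroup F] [NormedSpace ℝ F] [FiniteDimensional ℝ F]
    {A : M → Type*} [TopologicalSpace (Bundle.TotalSpace F A)] [∀ x, TopologicalSpace (A x)]
    [∀ x, AddCommGroup (A x)] [∀ x, Module ℝ (A x)] [FiberBundle F A] [VectorBundle ℝ F A]
    [ContMDiffVectorBundle ∞ F A (𝓡 n)]
    (𝔸 : LieAlgebroid n F A)
    {L : Type*} [AddCommGroup L] [Module ℝ L]
    (𝔏 : DGLA L) (h𝔏 : 𝔏.IsStrictLieTwoAlgebra)
    {ι κ : Type*} [Fintype ι] [Fintype κ] [DecidableEq ι]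
    (e : Module.Basis (ι ⊕ κ) ℝ L) (he : 𝔏.IsHomogeneousBasis e)
    (μ : L →ₗ[ℝ] Module.End ℝ (ShiftedFunctions n F A))
    (hμ : 𝔏.IsGradedLieHom (shiftedDegree n F A) μ) :
    ((𝔏.transformationAlgebroid (shiftedDegree n F A) e μ).IsAlgebroid (shiftedDegree n F A) ∧
      ∀ Q', (𝔏.transformationAlgebroid (shiftedDegree n F A) e μ).IsEncodedBy
          (shiftedDegree n F A) Q' ↔
        Q' = 𝔏.fieldBr (shiftedDegree n F A) e + fieldAction (shiftedDegree n F A) e μ) ∧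
    (𝔏.IsDGLAHom (shiftedDegree n F A) 𝔸.homologicalField μ ↔
      (𝔏.transformationAlgebroid (shiftedDegree n F A) e μ).IsQAlgebroid (shiftedDegree n F A)
        (-𝔏.fieldδ (shiftedDegree n F A) e
          + TotalFunctions.ofBaseField (shiftedDegree n F A) 1 𝔸.homologicalField)) ∧
    ((𝔏.transformationAlgebroid (shiftedDegree n F A) e μ).IsQAlgebroid (shiftedDegree n F A)
        (-𝔏.fieldδ (shiftedDegree n F A) e
          + TotalFunctions.ofBaseField (shiftedDegree n F A) 1 𝔸.homologicalField) ↔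
      gradedCommutator 1 1
        (-𝔏.fieldδ (shiftedDegree n F A) e
          + TotalFunctions.ofBaseField (shiftedDegree n F A) 1 𝔸.homologicalField)
        (𝔏.fieldBr (shiftedDegree n F A) e + fieldAction (shiftedDegree n F A) e μ) = 0) := by

  -- Graded commutativity of `Γ(⋀ A^*)` and homologicality of `Q_A` are the only inputs from the Lie
  -- algebroid; the rest holds over any graded manifold with these properties.
  have h𝒞 : IsGradedCommutative (shiftedDegree n F A) := isGradedCommutative_formDegree _ _
  have hQA := 𝔸.isHomological_homologicalField
  have h := DGLA.isQAlgebroid_transformationAlgebroid_iff h𝒞 he hμ hQA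
  exact ⟨⟨DGLA.isAlgebroid_transformationAlgebroid h𝒞 he hμ,
    DGLA.isEncodedBy_transformationAlgebroid_iff h𝒞 he hμ⟩,
    (DGLA.commutator_fields_eq_zero_iff h𝒞 he hμ hQA).symm.trans h.symm, h⟩
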